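/- **Setting.** There are $K$ devices; device $i$ holds $n$ samples $(x_{ij},y_{ij})_{j\le n}$ with $x_{ij}\in\mathbb R^d$, $\|x_{ij}\|_2=1$, $|y_{ij}|\le B$. The data are $\varphi$-separated, $0<\varphi\le 2$: $\|x_{ij}-x_{i'j'}\|_2\ge\varphi$ and $\|x_{ij}+x_{i'j'}\|_2\ge\varphi$ whenever $(i,j)\ne(i',j')$. The network is $f(W,a,x)=\frac1{\sqrt d}\sum_{r=1}^m a_r\,\sigma(\langle W_r,x\rangle)$ with $\sigma(z)=\max(z,0)$, $W\in\mathbb R^{m\times d}$, $m\ge2$. At initialization the entries of $W(0)$ are $N(0,2/m)$, the entries of $a$ are either all uniform on $\{\pm1\}$ or all $N(0,1)$, and everything is independent; $a$ is not trained. The losses are $L_i(W)=\frac12\sum_{j}(f(W,a,x_{ij})-y_{ij})^2$ and $L=\frac1K\sum_i L_i$; $\nabla L_i$ denotes the back-propagation gradient with $\sigma'(z)=\mathbf 1_{z\ge0}$. Local GD with synchronization gap $\tau\ge1$ and step size $\eta$: $W^{(i)}(0)=W(0)$; at step $t$ every device computes $V^{(i)}=W^{(i)}(t)-\eta\nabla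 L_i(W^{(i)}(t))$; then $W^{(i)}(t+1)=\frac1K\sum_l V^{(l)}$ if $\tau\mid t+1$, and $W^{(i)}(t+1)=V^{(i)}$ otherwise. Put $W(t)=\frac1K\sum_iW^{(i)}(t)$. **Theorem (Local GD convergence).** For every $K\ge1$ and every $B$ there are constants $c\in(0,1]$ and $C>0$, depending only on $K$ and $B$, such that the following holds for all $n,d,\tau,T\ge1$, $m\ge2$, $\varphi\in(0,2]$ and all data as above. Suppose $$m\ge\frac{n^{21}(\log m)^3d}{\varphi^5},\qquad \eta=\frac{dn^2\log T}{m\varphi T},\qquad T\ge\frac{d^{1/2}n^{33/2}(\log T)^3(\log m)^{3/2}\,\tau}{\varphi^5}.$$ Then, with probability at least $1-Ce^{-c(\log m)^2}$ over the initialization, simultaneously for all $0\le t\le T$ and all $i\le K$, $$\|W(t)-W(0)\|_F\le\omega,\qquad \|W^{(i)}(t)-W(0)\|_F\le\omega,\qquad \omega=C\,\varphi^{3/2}n^{-9}(\log m)^{-3/2},$$ and $$L(W(t))\le\Big(1-c\,\frac{\eta m\varphi}{dn^2}\Big)^tL(W(0))+\exp\Big[\frac{C\,n^6}{d^{1/2}\varphi^{7/2}m^{1/2}}\Big]\cdot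 C\Big(\frac{m^{7/2}n^4\tau^3\eta^3}{\varphi^{5/2}d^{7/2}}+\frac{m^{3/2}n^2\tau\eta}{\varphi^{5/2}d^{3/2}}\Big)L(W(0)).$$ -/

import Mathlib

open MeasureTheory ProbabilityTheory

noncomputable section

namespace LocalGD

/-- Hidden-layer weight matrices: `m` neurons (rows), inputs in dimension `d`. -/
abbrev Weights (m d : ℕ) := Fin m → Fin d → ℝ

/-- Frobenius norm of a weight matrix. -/
def frobNorm {m d : ℕ} (W : Weights m d) : ℝ :=
  Real.sqrt (∑ r, ∑ k, W r k ^ 2)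

/-- The ReLU activation. -/
def relu (z : ℝ) : ℝ := max z 0

/-- The (sub)derivative of ReLU that gradient descent uses. -/
def reluDeriv (z : ℝ) : ℝ := if 0 ≤ z then 1 else 0

/-- The pre-activation `⟨W_r, x⟩` of neuron `r`. -/
def preact {m d : ℕ} (W : Weights m d) (x : EuclideanSpace ℝ (Fin d)) (r : Fin m) : ℝ :=
  ∑ k, W r k * x k

/-- The two-layer network `f(W, v, x) = vᵀ σ(W x)` with output weights `v_r = a_r / √d`. -/
def network {m d : ℕ} (a : Fin m → ℝ) (W : Weights m d) (x : EuclideanSpace ℝ (Fin d)) : ℝ :=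
  (1 / Real.sqrt d) * ∑ r, a r * relu (preact W x r)

/-- The squared loss of one device, summed over its `n` samples. -/
def localLoss {m d n : ℕ} (a : Fin m → ℝ) (x : Fin n → EuclideanSpace ℝ (Fin d)) (y : Fin n → ℝ)
    (W : Weights m d) : ℝ :=
  ∑ j, (1 / 2) * (network a W (x j) - y j) ^ 2

/-- The gradient of the loss of one device with respect to the hidden layer
(back-propagation formula, with `reluDeriv` in place of `σ'`). -/
def localGrad {m d n : ℕ} (a : Fin m → ℝ) (x : Fin n → EuclideanSpace ℝ (Fin d)) (y : Fin n → ℝ)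
    (W : Weights m d) : Weights m d :=
  fun r k => (1 / Real.sqrt d) *
    ∑ j, (network a W (x j) - y j) * a r * reluDeriv (preact W (x j) r) * x j k

/-- The global loss: the average over the `K` devices of their losses. -/
def globalLoss {m d n K : ℕ} (a : Fin m → ℝ) (x : Fin K → Fin n → EuclideanSpace ℝ (Fin d))
    (y : Fin K → Fin n → ℝ) (W : Weights m d) : ℝ :=
  (1 / (K : ℝ)) * ∑ i, localLoss a (x i) (y i) W

/-- The average over the devices of their weight matrices. -/
def average {m d K : ℕ} (V : Fin K → Weights m d) : Weights m d :=
  fun r k => (1 / (K : ℝ)) * ∑ i, V i r k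

/-- The local iterates `W⁽ⁱ⁾(t)` of Local GD: every device takes a gradient step on its own loss,
and the results are averaged whenever the new time is a multiple of `τ`. -/
def localIterate {m d n K : ℕ} (a : Fin m → ℝ) (x : Fin K → Fin n → EuclideanSpace ℝ (Fin d))
    (y : Fin K → Fin n → ℝ) (η : ℝ) (τ : ℕ) (W0 : Weights m d) : ℕ → Fin K → Weights m d
  | 0 => fun _ => W0
  | t + 1 =>
    let step : Fin K → Weights m d := fun i =>
      localIterate a x y η τ W0 t i - η • localGrad a (x i) (y i) (localIterate a x y η τ W0 t i)
    if τ ∣ t + 1 then fun _ => average step else step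

/-- The (virtual) averaged iterate `W(t)`. -/
def avgIterate {m d n K : ℕ} (a : Fin m → ℝ) (x : Fin K → Fin n → EuclideanSpace ℝ (Fin d))
    (y : Fin K → Fin n → ℝ) (η : ℝ) (τ : ℕ) (W0 : Weights m d) (t : ℕ) : Weights m d :=
  average (localIterate a x y η τ W0 t)

/-- The uniform distribution on `{-1, 1}`. -/
def rademacher : Measure ℝ :=
  (2⁻¹ : ENNReal) • Measure.dirac 1 + (2⁻¹ : ENNReal) • Measure.dirac (-1)

/-- The law of the initialization `(W(0), a)`: the entries of `W(0)` are `N(0, 2/m)`, the entries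
of `a` have law `ρ`, and all of them are independent. -/
def initLaw (m d : ℕ) (ρ : Measure ℝ) : Measure (Weights m d × (Fin m → ℝ)) :=
  (Measure.pi fun _ : Fin m => Measure.pi fun _ : Fin d =>
    gaussianReal 0 (2 / (m : NNReal))).prod (Measure.pi fun _ : Fin m => ρ)

/-- Unit inputs, labels bounded by `B`, and any two distinct data points (of the same device or
not) have their lines `φ`-separated. -/
structure GoodData {d n K : ℕ} (B φ : ℝ) (x : Fin K → Fin n → EuclideanSpace ℝ (Fin d))
    (y : Fin K → Fin n → ℝ) : Prop where
  norm_eq_one : ∀ i j, ‖x i j‖ = 1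
  label_le : ∀ i j, |y i j| ≤ B
  separated : ∀ i j i' j', (i, j) ≠ (i', j') →
    φ ≤ ‖x i j - x i' j'‖ ∧ φ ≤ ‖x i j + x i' j'‖

/-- The step size `d n² log T / (m φ T)`. -/
def stepSize (n d m T : ℕ) (φ : ℝ) : ℝ :=
  (d * n ^ 2 * Real.log T) / (m * φ * T)

/-- The additive term of the loss bound (relative to the initial loss), every `O(·)` having
the constant `C`. -/
def driftTerm (C : ℝ) (n d m τ : ℕ) (φ η : ℝ) : ℝ :=
  Real.exp (C * ((n : ℝ) ^ 6 /
      ((d : ℝ) ^ (1 / 2 : ℝ) * φ ^ (7 / 2 : ℝ) * (m : ℝ) ^ (1 / 2 : ℝ)))) *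
    (C * ((m : ℝ) ^ (7 / 2 : ℝ) * n ^ 4 * τ ^ 3 * η ^ 3 /
          (φ ^ (5 / 2 : ℝ) * (d : ℝ) ^ (7 / 2 : ℝ))
        + (m : ℝ) ^ (3 / 2 : ℝ) * n ^ 2 * τ * η /
          (φ ^ (5 / 2 : ℝ) * (d : ℝ) ^ (3 / 2 : ℝ))))

end LocalGD

end

noncomputable section

namespace LocalGD

/-! ### The Frobenius norm -/

/-! The proof is a tangent-kernel argument. Let `u` be the vector of residuals at all `K * n`
samples and `J` the Jacobian of the outputs at the initial activation patterns. If `J` has smallest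
singular value `l` and norm at most `μ`, gradient descent contracts `‖u‖` geometrically as long as
the patterns that are really used differ little from the initial ones. One step decreases `‖u‖` by
at least a multiple of `l` times the length of the step (`inexact_step`), so the path length
telescopes to at most `5 * ‖u(0)‖ / l`. This keeps the averaged iterates in a small ball, where few
neurons change sign, and the induction closes. Local steps only add an error: between
synchronizations each device moves by at most a multiple of `τ * η * μ * ‖u‖`, which the lower bound
on `T` makes negligible. Hence `GoodInit.convergence` gives pure linear decay; the additive term of
the theorem is used only through its nonnegativity.

The value of `l` comes from a reflection argument (`le_integral_sq_norm_neuronGrad`). For a Gaussian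
`w`, suppose that only the pre-activation at the sample `p` is close to zero. Reflecting `w` in the
hyperplane orthogonal to `x p` then switches that one activation and no other, so the gradient of
the neuron changes by exactly `u p • x p`, and its squared norm at `w` or at the reflected point is
at least `u p ^ 2 / 4`. The reflection preserves the law, the events for different `p` and their
reflections are disjoint, and separation gives each of them probability of order `φ / N`, `N` being
the number of samples. The expected kernel is therefore bounded below by a multiple of `φ / N`.
Hoeffding's inequality on every kernel entry transfers this to the sampled network
(`GoodSample.coercive`).

Sign changes are controlled by `GoodSample.sum_flips_le`: a neuron that changes sign either starts
within `δ` of its boundary or has moved by at least `δ`, and eighth moments of the output weights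
prevent the few such neurons from carrying much weight. `flips_small` chooses `δ` and the truncation
level so that the result is below the coercivity. -/

/-- A weight matrix as a vector of a Euclidean space. -/
def vec {m d : ℕ} (W : Weights m d) : EuclideanSpace ℝ (Fin m × Fin d) :=
  WithLp.toLp 2 fun p => W p.1 p.2

lemma frobNorm_eq_norm_vec {m d : ℕ} (W : Weights m d) : frobNorm W = ‖vec W‖ := by
  simp [frobNorm, EuclideanSpace.norm_eq, vec, Fintype.sum_prod_type]

lemma vec_add {m d : ℕ} (V W : Weights m d) : vec (V + W) = vec V + vec W := by
  ext; simp [vec]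

lemma vec_sub {m d : ℕ} (V W : Weights m d) : vec (V - W) = vec V - vec W := by
  ext; simp [vec]

lemma vec_smul {m d : ℕ} (c : ℝ) (W : Weights m d) : vec (c • W) = c • vec W := by
  ext; simp [vec]

lemma frobNorm_nonneg {m d : ℕ} (W : Weights m d) : 0 ≤ frobNorm W := Real.sqrt_nonneg _

lemma sq_frobNorm {m d : ℕ} (W : Weights m d) : frobNorm W ^ 2 = ∑ r, ∑ k, W r k ^ 2 :=
  Real.sq_sqrt (by positivity)

lemma frobNorm_add_le {m d : ℕ} (V W : Weights m d) :
    frobNorm (V + W) ≤ frobNorm V + frobNorm W := by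
  simpa only [frobNorm_eq_norm_vec, vec_add] using norm_add_le _ _

lemma frobNorm_sub_le {m d : ℕ} (V W : Weights m d) :
    frobNorm (V - W) ≤ frobNorm V + frobNorm W := by
  simpa only [frobNorm_eq_norm_vec, vec_sub] using norm_sub_le _ _

lemma frobNorm_smul {m d : ℕ} (c : ℝ) (W : Weights m d) :
    frobNorm (c • W) = |c| * frobNorm W := by
  simp [frobNorm_eq_norm_vec, vec_smul, norm_smul]

lemma frobNorm_self_sub {m d : ℕ} (W : Weights m d) : frobNorm (W - W) = 0 := by
  simp [frobNorm]

lemma frobNorm_sub_comm {m d : ℕ} (V W : Weights m d) :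
    frobNorm (V - W) = frobNorm (W - V) := by
  simpa only [frobNorm_eq_norm_vec, vec_sub] using norm_sub_rev _ _

lemma frobNorm_sub_le_add {m d : ℕ} (U V W : Weights m d) :
    frobNorm (U - W) ≤ frobNorm (U - V) + frobNorm (V - W) := by
  simpa using frobNorm_add_le (U - V) (V - W)

lemma vec_average {m d K : ℕ} (V : Fin K → Weights m d) :
    vec (average V) = (1 / (K : ℝ)) • ∑ i, vec (V i) := by
  ext p
  simp [vec, average]

lemma frobNorm_average_sub_le {m d K : ℕ} (hK : 1 ≤ K) (V : Fin K → Weights m d)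
    (W : Weights m d) {b : ℝ} (h : ∀ i, frobNorm (V i - W) ≤ b) :
    frobNorm (average V - W) ≤ b := by
  have hK' : (0 : ℝ) < K := by exact_mod_cast hK
  have e : vec (average V) - vec W = (1 / (K : ℝ)) • ∑ i, (vec (V i) - vec W) := by
    rw [vec_average, Finset.sum_sub_distrib, smul_sub]
    simp [smul_smul, ← Nat.cast_smul_eq_nsmul ℝ, hK'.ne']
  rw [frobNorm_eq_norm_vec, vec_sub, e, norm_smul]
  have h1 : ‖∑ i, (vec (V i) - vec W)‖ ≤ K * b := by
    refine (norm_sum_le _ _).trans ?_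
    have : ∑ i : Fin K, ‖vec (V i) - vec W‖ ≤ ∑ _i : Fin K, b := by
      refine Finset.sum_le_sum fun i _ => ?_
      simpa only [frobNorm_eq_norm_vec, vec_sub] using h i
    simpa using this
  rw [Real.norm_of_nonneg (by positivity)]
  calc 1 / (K : ℝ) * ‖∑ i, (vec (V i) - vec W)‖ ≤ 1 / (K : ℝ) * (K * b) := by gcongr
    _ = b := by field_simp

/-! ### Forward and backward passes with prescribed activation patterns -/

/-- Back-propagation of the output vector `u` through activation patterns `g`. -/
def backprop {m d : ℕ} {P : Type*} [Fintype P] (a : Fin m → ℝ) (x : P → EuclideanSpace ℝ (Fin d))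
    (g : Fin m → P → ℝ) (u : P → ℝ) : Weights m d :=
  fun r k => (1 / Real.sqrt d) * ∑ p, u p * a r * g r p * x p k

/-- The activation pattern of the weights `W` on the inputs `x`. -/
def pattern {m d : ℕ} {P : Type*} (x : P → EuclideanSpace ℝ (Fin d)) (W : Weights m d)
    (r : Fin m) (p : P) : ℝ :=
  reluDeriv (preact W (x p) r)

lemma sum_sq_coord {d : ℕ} (x : EuclideanSpace ℝ (Fin d)) : ∑ k, x k ^ 2 = ‖x‖ ^ 2 := by
  rw [EuclideanSpace.real_norm_sq_eq]

lemma sq_preact_le {m d : ℕ} (W : Weights m d) {x : EuclideanSpace ℝ (Fin d)} (hx : ‖x‖ = 1)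
    (r : Fin m) : preact W x r ^ 2 ≤ ∑ k, W r k ^ 2 := by
  have := Finset.sum_mul_sq_le_sq_mul_sq Finset.univ (fun k => W r k) (fun k => x k)
  rw [sum_sq_coord, hx] at this
  simpa [preact] using this

lemma sum_sq_preact_le {m d : ℕ} (W : Weights m d) {x : EuclideanSpace ℝ (Fin d)}
    (hx : ‖x‖ = 1) : ∑ r, preact W x r ^ 2 ≤ frobNorm W ^ 2 := by
  rw [sq_frobNorm]
  exact Finset.sum_le_sum fun r _ => sq_preact_le W hx r

lemma preact_sub {m d : ℕ} (V W : Weights m d) (x : EuclideanSpace ℝ (Fin d)) (r : Fin m) :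
    preact (V - W) x r = preact V x r - preact W x r := by
  simp [preact, sub_mul, Finset.sum_sub_distrib]

lemma sq_inv_sqrt_nat (d : ℕ) : (1 / Real.sqrt d) ^ 2 = 1 / (d : ℝ) := by
  rw [div_pow, Real.sq_sqrt (Nat.cast_nonneg d), one_pow]

lemma backprop_add {m d : ℕ} {P : Type*} [Fintype P] (a : Fin m → ℝ)
    (x : P → EuclideanSpace ℝ (Fin d)) (g : Fin m → P → ℝ) (u v : P → ℝ) :
    backprop a x g (u + v) = backprop a x g u + backprop a x g v := by
  ext r k
  simp only [backprop, Pi.add_apply, add_mul, Finset.sum_add_distrib, mul_add]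

lemma backprop_add_pattern {m d : ℕ} {P : Type*} [Fintype P] (a : Fin m → ℝ)
    (x : P → EuclideanSpace ℝ (Fin d)) (g h : Fin m → P → ℝ) (u : P → ℝ) :
    backprop a x (g + h) u = backprop a x g u + backprop a x h u := by
  ext r k
  simp only [backprop, Pi.add_apply, add_mul, mul_add, Finset.sum_add_distrib]

/-- Adjunction between the forward and the backward pass. -/
lemma sum_mul_backprop {m d : ℕ} {P : Type*} [Fintype P] (a : Fin m → ℝ)
    (x : P → EuclideanSpace ℝ (Fin d)) (g : Fin m → P → ℝ) (u : P → ℝ) (D : Weights m d) :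
    ∑ r, ∑ k, D r k * backprop a x g u r k =
      ∑ p, u p * ((1 / Real.sqrt d) * ∑ r, a r * (g r p * preact D (x p) r)) := by
  simp only [backprop, preact, Finset.mul_sum]
  conv_rhs => rw [Finset.sum_comm]
  refine Finset.sum_congr rfl fun r _ => ?_
  conv_rhs => rw [Finset.sum_comm]
  refine Finset.sum_congr rfl fun k _ => ?_
  refine Finset.sum_congr rfl fun p _ => ?_
  ring

/-- Triangle inequality, then Cauchy–Schwarz. No near-orthogonality of the inputs is used; the price
is the factor `Fintype.card P`. -/
lemma sum_sq_sum_smul_le {d : ℕ} {P : Type*} [Fintype P] {x : P → EuclideanSpace ℝ (Fin d)}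
    (hx : ∀ p, ‖x p‖ = 1) (c : P → ℝ) :
    ∑ k, (∑ p, c p * x p k) ^ 2 ≤ Fintype.card P * ∑ p, c p ^ 2 := by
  have h1 : ∑ k, (∑ p, c p * x p k) ^ 2 = ‖∑ p, c p • x p‖ ^ 2 := by
    rw [← sum_sq_coord]
    simp
  have h2 : ‖∑ p, c p • x p‖ ≤ ∑ p, |c p| := by
    refine (norm_sum_le _ _).trans (Finset.sum_le_sum fun p _ => ?_)
    rw [norm_smul, hx, mul_one, Real.norm_eq_abs]
  rw [h1]
  calc ‖∑ p, c p • x p‖ ^ 2 ≤ (∑ p, |c p|) ^ 2 := by gcongr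
    _ ≤ Fintype.card P * ∑ p, |c p| ^ 2 := by
      simpa using sq_sum_le_card_mul_sum_sq (s := Finset.univ) (f := fun p => |c p|)
    _ = _ := by simp

/-- Each neuron is estimated separately, so only the output weight carried by the pattern at each
sample matters. The pattern is arbitrary: an activation pattern gives the bound `μ`, a difference of
two patterns gives the bound `κ`. -/
lemma sq_frobNorm_backprop_le {m d : ℕ} {P : Type*} [Fintype P] (a : Fin m → ℝ)
    {x : P → EuclideanSpace ℝ (Fin d)} (hx : ∀ p, ‖x p‖ = 1) (g : Fin m → P → ℝ) {q : ℝ}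
    (hq : ∀ p, (1 / (d : ℝ)) * ∑ r, a r ^ 2 * g r p ^ 2 ≤ q) (u : P → ℝ) :
    frobNorm (backprop a x g u) ^ 2 ≤ Fintype.card P * q * ∑ p, u p ^ 2 := by
  rw [sq_frobNorm]
  have h1 : ∀ r, ∑ k, backprop a x g u r k ^ 2 ≤
      (1 / (d : ℝ)) * (Fintype.card P * ∑ p, (u p * a r * g r p) ^ 2) := by
    intro r
    simp only [backprop, mul_pow, sq_inv_sqrt_nat, ← Finset.mul_sum]
    refine mul_le_mul_of_nonneg_left ?_ (by positivity)
    simpa [mul_pow] using sum_sq_sum_smul_le hx fun p => u p * a r * g r p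
  calc ∑ r, ∑ k, backprop a x g u r k ^ 2
      ≤ ∑ r, (1 / (d : ℝ)) * (Fintype.card P * ∑ p, (u p * a r * g r p) ^ 2) :=
        Finset.sum_le_sum fun r _ => h1 r
    _ = Fintype.card P * ∑ p, ((1 / (d : ℝ)) * ∑ r, a r ^ 2 * g r p ^ 2) * u p ^ 2 := by
        simp only [Finset.mul_sum, Finset.sum_mul]
        rw [Finset.sum_comm]
        refine Finset.sum_congr rfl fun p _ => Finset.sum_congr rfl fun r _ => ?_
        ring
    _ ≤ Fintype.card P * ∑ p, q * u p ^ 2 := by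
        gcongr with p
        exact hq p
    _ = _ := by rw [← Finset.mul_sum, mul_assoc]

/-- A linear readout whose `r`-th input is at most `s r * |⟨D_r, x⟩|`. -/
lemma sq_readout_le {m d : ℕ} (a s c : Fin m → ℝ) {x : EuclideanSpace ℝ (Fin d)} (hx : ‖x‖ = 1)
    (D : Weights m d) {q : ℝ} (hq : (1 / (d : ℝ)) * ∑ r, a r ^ 2 * s r ^ 2 ≤ q)
    (hc : ∀ r, |c r| ≤ |s r * preact D x r|) :
    ((1 / Real.sqrt d) * ∑ r, a r * c r) ^ 2 ≤ q * frobNorm D ^ 2 := by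
  have h1 : |∑ r, a r * c r| ≤ ∑ r, |a r * s r| * |preact D x r| := by
    refine (Finset.abs_sum_le_sum_abs _ _).trans (Finset.sum_le_sum fun r _ => ?_)
    rw [abs_mul, abs_mul, mul_assoc, ← abs_mul (s r)]
    exact mul_le_mul_of_nonneg_left (hc r) (abs_nonneg _)
  have h2 : (∑ r, a r * c r) ^ 2 ≤ (∑ r, a r ^ 2 * s r ^ 2) * ∑ r, preact D x r ^ 2 := by
    rw [← sq_abs (∑ r, a r * c r)]
    refine (pow_le_pow_left₀ (abs_nonneg _) h1 2).trans ?_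
    refine (Finset.sum_mul_sq_le_sq_mul_sq _ _ _).trans (le_of_eq ?_)
    simp [mul_pow]
  rw [mul_pow, sq_inv_sqrt_nat]
  calc 1 / (d : ℝ) * (∑ r, a r * c r) ^ 2
      ≤ 1 / (d : ℝ) * ((∑ r, a r ^ 2 * s r ^ 2) * ∑ r, preact D x r ^ 2) := by gcongr
    _ = (1 / (d : ℝ) * ∑ r, a r ^ 2 * s r ^ 2) * ∑ r, preact D x r ^ 2 := by ring
    _ ≤ q * frobNorm D ^ 2 := by
      gcongr
      · exact le_trans (by positivity) hq
      · exact sum_sq_preact_le D hx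

/-! ### ReLU and the network -/

lemma relu_eq (z : ℝ) : relu z = reluDeriv z * z := by
  unfold relu reluDeriv
  split_ifs with h
  · simp [h]
  · simp [le_of_not_ge h]

lemma reluDeriv_eq_zero_or_one (z : ℝ) : reluDeriv z = 0 ∨ reluDeriv z = 1 := by
  unfold reluDeriv; split_ifs <;> simp

lemma abs_relu_sub_le (a b : ℝ) : |relu b - relu a| ≤ |b - a| :=
  abs_max_sub_max_le_abs b a 0

lemma reluDeriv_sq_le_one (z : ℝ) : reluDeriv z ^ 2 ≤ 1 := by
  rcases reluDeriv_eq_zero_or_one z with h | h <;> simp [h]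

/-- When `a`, `b` and `z` share an activation, ReLU is linear between `a` and `b` with the right
slope and the error vanishes. Otherwise the error is at most `|b - a|`, and the square root is at
least one. Its square is a sum of two flip indicators, the form that `sq_readout_le` accepts as
weight. -/
lemma abs_relu_linearization_le (a b z : ℝ) :
    |relu b - relu a - reluDeriv z * (b - a)| ≤
      |Real.sqrt ((reluDeriv a - reluDeriv z) ^ 2 + (reluDeriv b - reluDeriv z) ^ 2) *
        (b - a)| := by
  by_cases h : reluDeriv a = reluDeriv z ∧ reluDeriv b = reluDeriv z
  · rw [relu_eq, relu_eq, h.1, h.2]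
    rw [show reluDeriv z * b - reluDeriv z * a - reluDeriv z * (b - a) = 0 by ring, abs_zero]
    exact abs_nonneg _
  · have h1 : 1 ≤ (reluDeriv a - reluDeriv z) ^ 2 + (reluDeriv b - reluDeriv z) ^ 2 := by
      rcases reluDeriv_eq_zero_or_one a with ha | ha <;>
      rcases reluDeriv_eq_zero_or_one b with hb | hb <;>
      rcases reluDeriv_eq_zero_or_one z with hz | hz <;> simp [ha, hb, hz] at h ⊢
    have h2 : |relu b - relu a - reluDeriv z * (b - a)| ≤ |b - a| := by
      rcases reluDeriv_eq_zero_or_one z with hz | hz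
      · simpa [hz] using abs_relu_sub_le a b
      · rw [hz, one_mul]
        unfold relu
        rcases le_total a 0 with ha | ha <;> rcases le_total b 0 with hb | hb <;>
        rcases le_total a b with hab | hab <;>
        simp only [max_eq_left, max_eq_right, ha, hb] <;>
        rw [abs_le] <;> constructor <;>
        cases abs_cases (b - a) <;> linarith
    rw [abs_mul]
    refine h2.trans (le_mul_of_one_le_left (abs_nonneg _) ?_)
    rw [abs_of_nonneg (Real.sqrt_nonneg _)]
    exact Real.one_le_sqrt.2 h1

lemma sq_network_sub_le {m d : ℕ} (a : Fin m → ℝ) (V W : Weights m d)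
    {x : EuclideanSpace ℝ (Fin d)} (hx : ‖x‖ = 1) :
    (network a V x - network a W x) ^ 2 ≤
      ((1 / (d : ℝ)) * ∑ r, a r ^ 2) * frobNorm (V - W) ^ 2 := by
  have e : network a V x - network a W x =
      (1 / Real.sqrt d) * ∑ r, a r * (relu (preact V x r) - relu (preact W x r)) := by
    simp [network, mul_sub, Finset.sum_sub_distrib]
  rw [e]
  refine sq_readout_le a 1 _ hx _ (by simp) fun r => ?_
  simpa [preact_sub] using abs_relu_sub_le (preact W x r) (preact V x r)

/-! ### One inexact gradient step in an inner product space -/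

/-- One step of an inexact gradient descent on a residual `u`: `p` is the back-propagated residual,
`-h • (p + z)` the step, `u'` the new residual, `e` the linearization error. -/
lemma inexact_step {E Y : Type*} [NormedAddCommGroup E] [InnerProductSpace ℝ E]
    [NormedAddCommGroup Y] [InnerProductSpace ℝ Y] {p z D : E} {u u' e : Y} {h l μ κ : ℝ}
    (hh : 0 ≤ h) (hl : 0 < l) (hD : D = -(h • (p + z)))
    (hinner : inner ℝ u (u' - u - e) = inner ℝ p D)
    (hz : ‖z‖ ≤ ‖p‖ / 4) (he : ‖e‖ ≤ κ * ‖D‖) (hκ : κ ≤ l / 5)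
    (hp : l * ‖u‖ ≤ ‖p‖) (hu : ‖u' - u‖ ≤ μ * ‖D‖) (hμ : h * μ ^ 2 ≤ 1 / 4) :
    ‖u'‖ ^ 2 ≤ ‖u‖ ^ 2 - h / 2 * ‖p‖ ^ 2 ∧ ‖D‖ ≤ 5 / 4 * h * ‖p‖ ∧
      l * ‖D‖ ≤ 5 * (‖u‖ - ‖u'‖) := by
  have hDn : ‖D‖ ≤ 5 / 4 * h * ‖p‖ := by
    rw [hD, norm_neg, norm_smul, Real.norm_of_nonneg hh]
    have := norm_add_le p z
    nlinarith
  -- Budget in units of `h * ‖p‖ ^ 2`: the exact gradient direction with error `z` gives `-3/4`, the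
  -- linearization error costs `1/4`, and the quadratic term, at most `1/2`, uses half of the
  -- doubled remainder.
  have h1 : inner ℝ p D ≤ -(3 / 4 * h * ‖p‖ ^ 2) := by
    rw [hD, inner_neg_right, inner_smul_right, inner_add_right, real_inner_self_eq_norm_sq]
    have h2 := abs_le.1 (abs_real_inner_le_norm p z)
    have h3 : ‖p‖ * ‖z‖ ≤ ‖p‖ * (‖p‖ / 4) := by gcongr
    have h4 : 3 / 4 * ‖p‖ ^ 2 ≤ ‖p‖ ^ 2 + inner ℝ p z := by nlinarith [h2.1]
    nlinarith [mul_le_mul_of_nonneg_left h4 hh]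
  have h2 : inner ℝ u e ≤ 1 / 4 * h * ‖p‖ ^ 2 := by
    have h3 : ‖e‖ ≤ l / 5 * (5 / 4 * h * ‖p‖) :=
      he.trans (mul_le_mul hκ hDn (norm_nonneg _) (by positivity))
    calc inner ℝ u e ≤ ‖u‖ * ‖e‖ := real_inner_le_norm u e
      _ ≤ ‖u‖ * (l / 5 * (5 / 4 * h * ‖p‖)) := by gcongr
      _ = (l * ‖u‖) * (1 / 4 * h * ‖p‖) := by ring
      _ ≤ ‖p‖ * (1 / 4 * h * ‖p‖) := by gcongr
      _ = _ := by ring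
  have h3 : inner ℝ u (u' - u) ≤ -(h / 2 * ‖p‖ ^ 2) := by
    have : inner ℝ u (u' - u) = inner ℝ u (u' - u - e) + inner ℝ u e := by
      rw [← inner_add_right]; congr 1; abel
    rw [this, hinner]
    linarith
  have h4 : ‖u' - u‖ ^ 2 ≤ h / 2 * ‖p‖ ^ 2 := by
    calc ‖u' - u‖ ^ 2 ≤ (μ * ‖D‖) ^ 2 := by gcongr
      _ = μ ^ 2 * ‖D‖ ^ 2 := by ring
      _ ≤ μ ^ 2 * (5 / 4 * h * ‖p‖) ^ 2 := by gcongr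
      _ = (h * μ ^ 2) * (25 / 16 * h * ‖p‖ ^ 2) := by ring
      _ ≤ 1 / 4 * (25 / 16 * h * ‖p‖ ^ 2) := by gcongr
      _ ≤ h / 2 * ‖p‖ ^ 2 := by nlinarith [mul_nonneg hh (sq_nonneg ‖p‖)]
  have h5 : ‖u'‖ ^ 2 ≤ ‖u‖ ^ 2 - h / 2 * ‖p‖ ^ 2 := by
    have : u' = u + (u' - u) := by abel
    rw [this, norm_add_sq_real]
    linarith
  refine ⟨h5, hDn, ?_⟩
  have h6 : ‖u'‖ ≤ ‖u‖ := by
    refine le_of_sq_le_sq ?_ (norm_nonneg _)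
    nlinarith [mul_nonneg hh (sq_nonneg ‖p‖)]
  -- The decrease of the square factors as `(‖u‖ - ‖u'‖) * (‖u‖ + ‖u'‖)`; dividing by `‖u‖` turns it
  -- into a bound that telescopes. If `u = 0`, the bound on `‖u'‖ ^ 2` forces the step to vanish.
  rcases (norm_nonneg u).eq_or_lt with h0 | h0
  · have h7 : ‖u'‖ = 0 := le_antisymm (h6.trans h0.ge) (norm_nonneg _)
    have h8 : h / 2 * ‖p‖ ^ 2 ≤ 0 := by
      rw [h7, ← h0] at h5; linarith
    have h9 : (h * ‖p‖) ^ 2 = 0 := by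
      have : (h * ‖p‖) ^ 2 = 2 * h * (h / 2 * ‖p‖ ^ 2) := by ring
      refine le_antisymm ?_ (sq_nonneg _)
      rw [this]
      exact mul_nonpos_of_nonneg_of_nonpos (by positivity) h8
    have h10 : h * ‖p‖ = 0 := by simpa using h9
    rw [h7, ← h0]
    nlinarith [norm_nonneg D]
  · have h7 : (l * ‖D‖) * ‖u‖ ≤ 5 * (‖u‖ - ‖u'‖) * ‖u‖ := by
      calc (l * ‖D‖) * ‖u‖ = ‖D‖ * (l * ‖u‖) := by ring
        _ ≤ (5 / 4 * h * ‖p‖) * ‖p‖ := by gcongr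
        _ = 5 / 2 * (h / 2 * ‖p‖ ^ 2) := by ring
        _ ≤ 5 / 2 * (‖u‖ ^ 2 - ‖u'‖ ^ 2) := by linarith
        _ = 5 / 2 * (‖u‖ - ‖u'‖) * (‖u‖ + ‖u'‖) := by ring
        _ ≤ 5 / 2 * (‖u‖ - ‖u'‖) * (‖u‖ + ‖u‖) := by
          gcongr
        _ = _ := by ring
    exact le_of_mul_le_mul_right h7 h0

/-! ### Deterministic convergence of Local GD near a good initialization -/

section Deterministic

variable {m d n K : ℕ}

/-- All inputs, of all devices, as one family. -/
def inputs (x : Fin K → Fin n → EuclideanSpace ℝ (Fin d)) :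
    Fin K × Fin n → EuclideanSpace ℝ (Fin d) := fun p => x p.1 p.2

/-- The residuals at the samples of device `i`, computed with the weights `W i`. -/
def mixedResidual (a : Fin m → ℝ) (x : Fin K → Fin n → EuclideanSpace ℝ (Fin d))
    (y : Fin K → Fin n → ℝ) (W : Fin K → Weights m d) : EuclideanSpace ℝ (Fin K × Fin n) :=
  WithLp.toLp 2 fun p => network a (W p.1) (x p.1 p.2) - y p.1 p.2

/-- The residuals at all samples. -/
def residual (a : Fin m → ℝ) (x : Fin K → Fin n → EuclideanSpace ℝ (Fin d))
    (y : Fin K → Fin n → ℝ) (W : Weights m d) : EuclideanSpace ℝ (Fin K × Fin n) :=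
  mixedResidual a x y fun _ => W

/-- The activation patterns, device `i` using the weights `W i`. -/
def mixedPattern (x : Fin K → Fin n → EuclideanSpace ℝ (Fin d)) (W : Fin K → Weights m d)
    (r : Fin m) (p : Fin K × Fin n) : ℝ :=
  reluDeriv (preact (W p.1) (x p.1 p.2) r)

lemma globalLoss_eq (a : Fin m → ℝ) (x : Fin K → Fin n → EuclideanSpace ℝ (Fin d))
    (y : Fin K → Fin n → ℝ) (W : Weights m d) :
    globalLoss a x y W = (1 / (K : ℝ)) * (1 / 2) * ‖residual a x y W‖ ^ 2 := by
  rw [EuclideanSpace.real_norm_sq_eq]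
  simp [globalLoss, localLoss, residual, mixedResidual, Fintype.sum_prod_type, Finset.mul_sum,
    mul_assoc]

lemma sum_localGrad (a : Fin m → ℝ) (x : Fin K → Fin n → EuclideanSpace ℝ (Fin d))
    (y : Fin K → Fin n → ℝ) (W : Fin K → Weights m d) :
    ∑ i, localGrad a (x i) (y i) (W i) =
      backprop a (inputs x) (mixedPattern x W) (mixedResidual a x y W) := by
  ext r k
  simp [localGrad, backprop, inputs, mixedPattern, mixedResidual, Fintype.sum_prod_type,
    Finset.mul_sum]

lemma localGrad_eq (a : Fin m → ℝ) (x : Fin n → EuclideanSpace ℝ (Fin d)) (y : Fin n → ℝ)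
    (W : Weights m d) :
    localGrad a x y W = backprop a x (pattern x W) (fun j => network a W (x j) - y j) := by
  ext r k
  simp [localGrad, backprop, pattern]

/-- What the convergence proof needs of the initialization `(W0, a)`, in a ball of radius `R`
around `W0`: `μ` bounds the operator norm of the Jacobian, `l` its smallest singular value at `W0`,
and `κ` the effect of the neurons that change sign within the ball. -/
structure GoodInit (a : Fin m → ℝ) (x : Fin K → Fin n → EuclideanSpace ℝ (Fin d))
    (y : Fin K → Fin n → ℝ) (W0 : Weights m d) (l μ κ R : ℝ) : Prop where
  norm_eq_one : ∀ i j, ‖x i j‖ = 1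
  l_pos : 0 < l
  l_le : l ≤ μ
  κ_nonneg : 0 ≤ κ
  κ_le : κ ≤ l / 16
  upper : (K * n : ℝ) * ((1 / (d : ℝ)) * ∑ r, a r ^ 2) ≤ μ ^ 2
  coercive : ∀ u : Fin K × Fin n → ℝ,
    l ^ 2 * ∑ p, u p ^ 2 ≤ frobNorm (backprop a (inputs x) (pattern (inputs x) W0) u) ^ 2
  flips : ∀ W : Weights m d, frobNorm (W - W0) ≤ R → ∀ i j,
    (K * n : ℝ) * ((1 / (d : ℝ)) *
      ∑ r, a r ^ 2 * (reluDeriv (preact W (x i j) r) - reluDeriv (preact W0 (x i j) r)) ^ 2) ≤ κ ^ 2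
  radius : 8 * ‖residual a x y W0‖ ≤ l * R

variable {a : Fin m → ℝ} {x : Fin K → Fin n → EuclideanSpace ℝ (Fin d)} {y : Fin K → Fin n → ℝ}
  {W0 : Weights m d} {l μ κ R : ℝ}

lemma GoodInit.μ_pos (h : GoodInit a x y W0 l μ κ R) : 0 < μ := h.l_pos.trans_le h.l_le

/-- ReLU is 1-Lipschitz, so no activation pattern enters and the bound holds outside the ball too.
Each device may use its own weights, as needed to compare stale local residuals with those at the
average. -/
lemma GoodInit.norm_mixedResidual_sub_le (h : GoodInit a x y W0 l μ κ R)
    (V W : Fin K → Weights m d) {b : ℝ} (hb : 0 ≤ b) (hVW : ∀ i, frobNorm (V i - W i) ≤ b) :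
    ‖mixedResidual a x y V - mixedResidual a x y W‖ ≤ μ * b := by
  refine le_of_sq_le_sq ?_ (mul_nonneg h.μ_pos.le hb)
  rw [EuclideanSpace.real_norm_sq_eq]
  have h1 : ∀ p : Fin K × Fin n, (mixedResidual a x y V - mixedResidual a x y W) p ^ 2 ≤
      ((1 / (d : ℝ)) * ∑ r, a r ^ 2) * b ^ 2 := by
    intro p
    have e : (mixedResidual a x y V - mixedResidual a x y W) p =
        network a (V p.1) (x p.1 p.2) - network a (W p.1) (x p.1 p.2) := by
      simp [mixedResidual]
    rw [e]
    refine (sq_network_sub_le a _ _ (h.norm_eq_one _ _)).trans ?_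
    have := frobNorm_nonneg (V p.1 - W p.1)
    have := hVW p.1
    gcongr
  refine (Finset.sum_le_sum fun p _ => h1 p).trans ?_
  rw [Finset.sum_const, nsmul_eq_mul]
  simp only [Finset.card_univ, Fintype.card_prod, Fintype.card_fin, Nat.cast_mul]
  rw [← mul_assoc, mul_pow]
  have := h.upper
  gcongr

lemma GoodInit.norm_residual_sub_le (h : GoodInit a x y W0 l μ κ R) (V W : Weights m d) :
    ‖residual a x y V - residual a x y W‖ ≤ μ * frobNorm (V - W) :=
  h.norm_mixedResidual_sub_le _ _ (frobNorm_nonneg _) fun _ => le_rfl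

lemma GoodInit.frobNorm_localGrad_le (h : GoodInit a x y W0 l μ κ R) (i : Fin K)
    (W : Weights m d) :
    frobNorm (localGrad a (x i) (y i) W) ≤ μ * ‖residual a x y W‖ := by
  refine le_of_sq_le_sq ?_ (mul_nonneg h.μ_pos.le (norm_nonneg _))
  have hA : 0 ≤ (1 / (d : ℝ)) * ∑ r, a r ^ 2 := by positivity
  have h1 := sq_frobNorm_backprop_le a (h.norm_eq_one i) (pattern (x i) W)
    (q := (1 / (d : ℝ)) * ∑ r, a r ^ 2) (fun p => by
      gcongr with r
      exact mul_le_of_le_one_right (sq_nonneg _) (reluDeriv_sq_le_one _))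
    (fun j => network a W (x i j) - y i j)
  rw [← localGrad_eq, Fintype.card_fin] at h1
  refine h1.trans ?_
  rw [mul_pow]
  have hK : (1 : ℝ) ≤ K := by exact_mod_cast Fin.pos i
  gcongr
  · refine le_trans ?_ h.upper
    gcongr
    exact le_mul_of_one_le_left (Nat.cast_nonneg _) hK
  · rw [EuclideanSpace.real_norm_sq_eq, Fintype.sum_prod_type]
    refine le_trans (le_of_eq ?_) (Finset.single_le_sum (f := fun i => ∑ j,
      (residual a x y W) (i, j) ^ 2) (fun i _ => by positivity) (Finset.mem_univ i))
    simp [residual, mixedResidual]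

lemma GoodInit.frobNorm_backprop_init_le (h : GoodInit a x y W0 l μ κ R)
    (u : EuclideanSpace ℝ (Fin K × Fin n)) :
    frobNorm (backprop a (inputs x) (pattern (inputs x) W0) u) ≤ μ * ‖u‖ := by
  refine le_of_sq_le_sq ?_ (mul_nonneg h.μ_pos.le (norm_nonneg _))
  have h1 := sq_frobNorm_backprop_le a (x := inputs x) (fun p => h.norm_eq_one p.1 p.2)
    (pattern (inputs x) W0)
    (q := (1 / (d : ℝ)) * ∑ r, a r ^ 2) (fun p => by
      gcongr with r
      exact mul_le_of_le_one_right (sq_nonneg _) (reluDeriv_sq_le_one _)) u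
  refine h1.trans ?_
  rw [mul_pow, EuclideanSpace.real_norm_sq_eq]
  have := h.upper
  simp only [Fintype.card_prod, Fintype.card_fin, Nat.cast_mul]
  gcongr

/-- The difference of patterns is supported on the flipped neurons; the factor `K * n` built into
`flips` pays for the number of samples in `sq_frobNorm_backprop_le`. -/
lemma GoodInit.frobNorm_backprop_flip_le (h : GoodInit a x y W0 l μ κ R)
    {W : Fin K → Weights m d} (hW : ∀ i, frobNorm (W i - W0) ≤ R)
    (u : EuclideanSpace ℝ (Fin K × Fin n)) :
    frobNorm (backprop a (inputs x) (mixedPattern x W - pattern (inputs x) W0) u) ≤ κ * ‖u‖ := by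
  rcases Nat.eq_zero_or_pos (K * n) with h0 | h0
  · have : IsEmpty (Fin K × Fin n) := by
      rw [← Fintype.card_eq_zero_iff]; simpa using h0
    have : backprop a (inputs x) (mixedPattern x W - pattern (inputs x) W0) u = 0 := by
      ext; simp [backprop]
    simp [this, frobNorm, mul_nonneg h.κ_nonneg (norm_nonneg u)]
  have h0' : (0 : ℝ) < K * n := by exact_mod_cast h0
  refine le_of_sq_le_sq ?_ (mul_nonneg h.κ_nonneg (norm_nonneg _))
  have h1 := sq_frobNorm_backprop_le a (x := inputs x) (fun p => h.norm_eq_one p.1 p.2)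
    (mixedPattern x W - pattern (inputs x) W0) (q := κ ^ 2 / (K * n)) (fun p => by
      rw [le_div_iff₀' h0']
      exact h.flips (W p.1) (hW p.1) p.1 p.2) u
  refine h1.trans ?_
  rw [mul_pow, EuclideanSpace.real_norm_sq_eq]
  simp only [Fintype.card_prod, Fintype.card_fin, Nat.cast_mul]
  rw [mul_div_cancel₀ _ h0'.ne']

/-- The change of the residual, linearized with the activation patterns of `W0`. -/
def linearizedChange (a : Fin m → ℝ) (x : Fin K → Fin n → EuclideanSpace ℝ (Fin d))
    (W0 D : Weights m d) : EuclideanSpace ℝ (Fin K × Fin n) :=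
  WithLp.toLp 2 fun p => (1 / Real.sqrt d) *
    ∑ r, a r * (pattern (inputs x) W0 r p * preact D (inputs x p) r)

/-- The linearization always uses the patterns of `W0`, so flips at both endpoints count. Each costs
`κ ^ 2`, and the total `2 * κ ^ 2` is loosened to `(2 * κ) ^ 2`. -/
lemma GoodInit.norm_linearization_error_le (h : GoodInit a x y W0 l μ κ R) {V W : Weights m d}
    (hV : frobNorm (V - W0) ≤ R) (hW : frobNorm (W - W0) ≤ R) :
    ‖residual a x y W - residual a x y V - linearizedChange a x W0 (W - V)‖ ≤
      2 * κ * frobNorm (W - V) := by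
  have hκ := h.κ_nonneg
  have hf := frobNorm_nonneg (W - V)
  refine le_of_sq_le_sq ?_ (by positivity)
  rw [EuclideanSpace.real_norm_sq_eq]
  rcases Nat.eq_zero_or_pos (K * n) with h0 | h0
  · have : IsEmpty (Fin K × Fin n) := by
      rw [← Fintype.card_eq_zero_iff]; simpa using h0
    simp only [Finset.univ_eq_empty, Finset.sum_empty]
    positivity
  have h0' : (0 : ℝ) < K * n := by exact_mod_cast h0
  have key : ∀ p : Fin K × Fin n,
      (residual a x y W - residual a x y V - linearizedChange a x W0 (W - V)) p ^ 2 ≤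
        (2 * κ ^ 2 / (K * n)) * frobNorm (W - V) ^ 2 := by
    intro p
    set s : Fin m → ℝ := fun r => Real.sqrt
      ((reluDeriv (preact V (x p.1 p.2) r) - reluDeriv (preact W0 (x p.1 p.2) r)) ^ 2 +
       (reluDeriv (preact W (x p.1 p.2) r) - reluDeriv (preact W0 (x p.1 p.2) r)) ^ 2) with hs
    have e : (residual a x y W - residual a x y V - linearizedChange a x W0 (W - V)) p =
        (1 / Real.sqrt d) * ∑ r, a r * (relu (preact W (x p.1 p.2) r) -
          relu (preact V (x p.1 p.2) r) - reluDeriv (preact W0 (x p.1 p.2) r) *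
            (preact W (x p.1 p.2) r - preact V (x p.1 p.2) r)) := by
      simp only [residual, mixedResidual, linearizedChange, network, pattern, inputs, preact_sub,
        PiLp.sub_apply, mul_sub, Finset.sum_sub_distrib]
      ring
    rw [e]
    refine sq_readout_le a s _ (h.norm_eq_one p.1 p.2) _ ?_ fun r => ?_
    · have e2 : ∀ r, s r ^ 2 =
        (reluDeriv (preact V (x p.1 p.2) r) - reluDeriv (preact W0 (x p.1 p.2) r)) ^ 2 +
       (reluDeriv (preact W (x p.1 p.2) r) - reluDeriv (preact W0 (x p.1 p.2) r)) ^ 2 :=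
        fun r => Real.sq_sqrt (by positivity)
      simp only [e2, mul_add, Finset.sum_add_distrib]
      rw [le_div_iff₀' h0', mul_add]
      have h1 := h.flips V hV p.1 p.2
      have h2 := h.flips W hW p.1 p.2
      linarith
    · rw [preact_sub]
      exact abs_relu_linearization_le _ _ _
  refine (Finset.sum_le_sum fun p _ => key p).trans ?_
  rw [Finset.sum_const, nsmul_eq_mul]
  simp only [Finset.card_univ, Fintype.card_prod, Fintype.card_fin, Nat.cast_mul]
  rw [← mul_assoc, mul_div_cancel₀ _ h0'.ne', mul_pow]
  gcongr
  nlinarith [sq_nonneg κ]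

/-- One averaged step of Local GD, all devices being close to their average `W`. -/
lemma GoodInit.averaged_step (h : GoodInit a x y W0 l μ κ R) (hK : 1 ≤ K) {η b : ℝ} (hη : 0 ≤ η)
    (hημ : η * μ ^ 2 ≤ 1 / 8) {Ws : Fin K → Weights m d} {W : Weights m d}
    (hWs : ∀ i, frobNorm (Ws i - W0) ≤ R)
    (hdrift : ∀ i, frobNorm (Ws i - W) ≤ b * ‖residual a x y W‖) (hb : 0 ≤ b)
    (hbl : b * μ ^ 2 ≤ l / 8)
    (hmove : l * frobNorm (W - W0) ≤ 5 * (‖residual a x y W0‖ - ‖residual a x y W‖))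
    {W' : Weights m d}
    (hW' : W' = W - (η / K) • ∑ i, localGrad a (x i) (y i) (Ws i)) :
    ‖residual a x y W'‖ ^ 2 ≤ (1 - η * l ^ 2 / (2 * K)) * ‖residual a x y W‖ ^ 2 ∧
      l * frobNorm (W' - W0) ≤ 5 * (‖residual a x y W0‖ - ‖residual a x y W'‖) := by
  have hK1 : (1 : ℝ) ≤ K := by exact_mod_cast hK
  have hl := h.l_pos
  have hμ := h.μ_pos
  set u := residual a x y W with hu
  set û := mixedResidual a x y Ws with hû
  set p := backprop a (inputs x) (pattern (inputs x) W0) u with hp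
  -- The error of the averaged gradient has two sources: residuals taken at drifted local weights,
  -- and activation patterns that differ from the initial ones.
  set z := backprop a (inputs x) (pattern (inputs x) W0) (û - u) +
    backprop a (inputs x) (mixedPattern x Ws - pattern (inputs x) W0) û with hzdef
  have hsum : ∑ i, localGrad a (x i) (y i) (Ws i) = p + z := by
    rw [sum_localGrad, hp, hzdef, ← add_assoc, ← backprop_add]
    have e1 : u.ofLp + (û.ofLp - u.ofLp) = û.ofLp := add_sub_cancel _ _
    rw [e1, ← backprop_add_pattern, add_sub_cancel]
  set D := W' - W with hDdef
  have hD : D = -((η / K) • (p + z)) := by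
    rw [hDdef, hW', hsum]; abel
  have hpl : l * ‖u‖ ≤ frobNorm p := by
    refine le_of_sq_le_sq ?_ (frobNorm_nonneg _)
    rw [mul_pow, EuclideanSpace.real_norm_sq_eq]
    exact h.coercive u
  have hdiff : ‖û - u‖ ≤ μ * (b * ‖u‖) :=
    h.norm_mixedResidual_sub_le Ws (fun _ => W) (by positivity) hdrift
  have hbμ : μ * b ≤ 1 / 8 := by
    have : b * μ * μ ≤ 1 / 8 * μ := by nlinarith [h.l_le]
    have := le_of_mul_le_mul_right this hμ
    linarith
  have hû' : ‖û‖ ≤ 9 / 8 * ‖u‖ := by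
    have : ‖û‖ ≤ ‖û - u‖ + ‖u‖ := by simpa using norm_add_le (û - u) u
    nlinarith [norm_nonneg u]
  have hz : frobNorm z ≤ frobNorm p / 4 := by
    have h1 := h.frobNorm_backprop_init_le (û - u)
    have h2 := h.frobNorm_backprop_flip_le hWs û
    have h3 : frobNorm z ≤ μ * ‖û - u‖ + κ * ‖û‖ :=
      (frobNorm_add_le _ _).trans (add_le_add h1 h2)
    have h4 : μ * ‖û - u‖ ≤ l / 8 * ‖u‖ := by
      calc μ * ‖û - u‖ ≤ μ * (μ * (b * ‖u‖)) := by gcongr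
        _ = (b * μ ^ 2) * ‖u‖ := by ring
        _ ≤ _ := by gcongr
    have h5 : κ * ‖û‖ ≤ l / 16 * (9 / 8 * ‖u‖) :=
      mul_le_mul h.κ_le hû' (norm_nonneg _) (by positivity)
    nlinarith [norm_nonneg u]
  have hinner : inner ℝ u (linearizedChange a x W0 D) = inner ℝ (vec p) (vec D) := by
    have h1 := sum_mul_backprop a (inputs x) (pattern (inputs x) W0) u D
    rw [PiLp.inner_apply, PiLp.inner_apply, Fintype.sum_prod_type (f := fun q : Fin m × Fin d => _)]
    simp only [vec, linearizedChange, RCLike.inner_apply, conj_trivial]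
    rw [← hp] at h1
    rw [h1]
    exact Finset.sum_congr rfl fun q _ => mul_comm _ _
  have hηK : η / K ≤ η := div_le_self hη hK1
  have hηK0 : 0 ≤ η / K := by positivity
  have hWball : frobNorm (W - W0) ≤ R := by
    refine le_of_mul_le_mul_left ?_ hl
    have := h.radius
    have := norm_nonneg (residual a x y W0)
    have := norm_nonneg u
    linarith
  have hDn : frobNorm D ≤ 5 / 4 * (η / K) * frobNorm p := by
    rw [hD, ← neg_smul, frobNorm_smul, abs_neg, abs_of_nonneg hηK0]
    have := frobNorm_add_le p z
    nlinarith
  -- The linearization estimate requires the new point to lie in the ball already. This crude bound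
  -- on one step suffices: together with the travelled distance it uses at most `6` of the `8` units
  -- in `radius`.
  have hDball : l * frobNorm D ≤ ‖u‖ := by
    calc l * frobNorm D ≤ μ * (5 / 4 * η * (μ * ‖u‖)) := by
          have := h.l_le
          have := frobNorm_nonneg D
          have := frobNorm_nonneg p
          gcongr
          refine hDn.trans ?_
          gcongr
          exact h.frobNorm_backprop_init_le u
      _ = 5 / 4 * (η * μ ^ 2) * ‖u‖ := by ring
      _ ≤ 1 * ‖u‖ := by gcongr; linarith
      _ = ‖u‖ := one_mul _
  have htri : frobNorm (W' - W0) ≤ frobNorm D + frobNorm (W - W0) :=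
    frobNorm_sub_le_add W' W W0
  have hW'ball : frobNorm (W' - W0) ≤ R := by
    refine le_of_mul_le_mul_left ?_ hl
    have := h.radius
    have := norm_nonneg (residual a x y W0)
    have := mul_le_mul_of_nonneg_left htri hl.le
    have := norm_nonneg u
    have : ‖u‖ ≤ ‖residual a x y W0‖ := by
      have := mul_nonneg hl.le (frobNorm_nonneg (W - W0))
      linarith
    linarith
  have hlin := h.norm_linearization_error_le hWball hW'ball
  have hstep := inexact_step (p := vec p) (z := vec z) (D := vec D) (u := u)
    (u' := residual a x y W')
    (e := residual a x y W' - u - linearizedChange a x W0 D) (h := η / K) (l := l) (μ := μ)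
    (κ := 2 * κ) hηK0 hl
    (by rw [← vec_add, ← vec_smul, hD, ← neg_smul, vec_smul, vec_smul, neg_smul])
    (by rw [sub_sub_cancel, hinner])
    (by simpa only [frobNorm_eq_norm_vec] using hz)
    (by simpa only [frobNorm_eq_norm_vec] using hlin)
    (by linarith [h.κ_le]) (by simpa only [frobNorm_eq_norm_vec] using hpl)
    (by simpa only [frobNorm_eq_norm_vec] using h.norm_residual_sub_le W' W)
    (by nlinarith [sq_nonneg μ])
  simp only [← frobNorm_eq_norm_vec] at hstep
  obtain ⟨h1, -, h3⟩ := hstep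
  constructor
  · refine h1.trans ?_
    have : (l * ‖u‖) ^ 2 ≤ frobNorm p ^ 2 := by gcongr
    have := mul_le_mul_of_nonneg_left this (by positivity : 0 ≤ η / K / 2)
    calc ‖u‖ ^ 2 - η / K / 2 * frobNorm p ^ 2 ≤ ‖u‖ ^ 2 - η / K / 2 * (l * ‖u‖) ^ 2 := by linarith
      _ = _ := by field_simp
  · have := mul_le_mul_of_nonneg_left htri hl.le
    linarith

/-! ### Averaged dynamics and drift between synchronizations -/

lemma frobNorm_zero : frobNorm (0 : Weights m d) = 0 := by
  simp [frobNorm]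

lemma average_const {V : Weights m d} (hK : 1 ≤ K) : average (fun _ : Fin K => V) = V := by
  have : (K : ℝ) ≠ 0 := by positivity
  ext r k
  simp [average, this]

lemma average_step (a : Fin m → ℝ) (x : Fin K → Fin n → EuclideanSpace ℝ (Fin d))
    (y : Fin K → Fin n → ℝ) (η : ℝ) (W : Fin K → Weights m d) :
    average (fun i => W i - η • localGrad a (x i) (y i) (W i)) =
      average W - (η / K) • ∑ i, localGrad a (x i) (y i) (W i) := by
  ext r k
  simp [average, Finset.sum_sub_distrib, Finset.mul_sum, mul_sub]
  ring_nf

/-- Synchronizing does not change the average, so the same recursion holds at every time, whether or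
not `τ` divides `t + 1`. -/
lemma avgIterate_succ (hK : 1 ≤ K) (a : Fin m → ℝ)
    (x : Fin K → Fin n → EuclideanSpace ℝ (Fin d))
    (y : Fin K → Fin n → ℝ) (η : ℝ) (τ : ℕ) (W0 : Weights m d) (t : ℕ) :
    avgIterate a x y η τ W0 (t + 1) = avgIterate a x y η τ W0 t -
      (η / K) • ∑ i, localGrad a (x i) (y i) (localIterate a x y η τ W0 t i) := by
  rw [avgIterate, avgIterate, ← average_step, localIterate]
  split_ifs
  · rw [average_const hK]
  · rfl

/-- The state of Local GD at time `t`: `V` are the weights at the last synchronization. -/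
structure LocalGDState (a : Fin m → ℝ) (x : Fin K → Fin n → EuclideanSpace ℝ (Fin d))
    (y : Fin K → Fin n → ℝ) (W0 : Weights m d) (η : ℝ) (τ : ℕ) (l μ : ℝ) (t : ℕ)
    (V : Weights m d) : Prop where
  drift : ∀ i, frobNorm (localIterate a x y η τ W0 t i - V) ≤
    (t % τ : ℕ) * (2 * η * μ * ‖residual a x y V‖)
  move : l * frobNorm (avgIterate a x y η τ W0 t - W0) ≤
    5 * (‖residual a x y W0‖ - ‖residual a x y (avgIterate a x y η τ W0 t)‖)
  decay : ‖residual a x y (avgIterate a x y η τ W0 t)‖ ^ 2 ≤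
    (1 - η * l ^ 2 / (2 * K)) ^ t * ‖residual a x y W0‖ ^ 2

/-- The drift since the last synchronization changes residuals by a small fraction of `‖residual
V‖`, so the residuals at `V`, at the average and at the local weights are comparable. This
re-expresses the drift relative to the current average; the `8` is `2` for passing through `V`, `2`
from the drift rate and `2` from `‖residual V‖ ≤ 2 * ‖residual w‖`. -/
lemma GoodInit.state_bounds (h : GoodInit a x y W0 l μ κ R) (hK : 1 ≤ K) {η : ℝ} {τ : ℕ}
    (hτ : 1 ≤ τ) (hη : 0 ≤ η) (hημ : 8 * τ * η * μ ^ 2 * μ ≤ l / 8) {t : ℕ} {V : Weights m d}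
    (hs : LocalGDState a x y W0 η τ l μ t V) :
    (∀ i, frobNorm (localIterate a x y η τ W0 t i - avgIterate a x y η τ W0 t) ≤
      8 * τ * η * μ * ‖residual a x y (avgIterate a x y η τ W0 t)‖) ∧
    (∀ i, frobNorm (localIterate a x y η τ W0 t i - W0) ≤ R) ∧
    frobNorm (avgIterate a x y η τ W0 t - W0) ≤ R ∧
    (∀ i, ‖residual a x y (localIterate a x y η τ W0 t i)‖ ≤ 2 * ‖residual a x y V‖) := by
  have hl := h.l_pos
  have hμ := h.μ_pos
  have hτ' : (1 : ℝ) ≤ τ := by exact_mod_cast hτ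
  have hsmall : 8 * τ * η * μ ^ 2 ≤ 1 / 8 := by
    have : 8 * τ * η * μ ^ 2 * μ ≤ 1 / 8 * μ := by linarith [h.l_le]
    exact le_of_mul_le_mul_right this hμ
  set w := avgIterate a x y η τ W0 t with hw
  set D := (t % τ : ℕ) * (2 * η * μ * ‖residual a x y V‖) with hDdef
  have hv0 := norm_nonneg (residual a x y V)
  have hD : D ≤ τ * (2 * η * μ * ‖residual a x y V‖) := by
    rw [hDdef]
    gcongr
    exact (Nat.mod_lt t hτ).le
  have hD2 : μ * D ≤ 1 / 32 * ‖residual a x y V‖ := by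
    calc μ * D ≤ μ * (τ * (2 * η * μ * ‖residual a x y V‖)) := by gcongr
      _ = 1 / 4 * (8 * τ * η * μ ^ 2) * ‖residual a x y V‖ := by ring
      _ ≤ 1 / 4 * (1 / 8) * ‖residual a x y V‖ := by gcongr
      _ = _ := by ring
  have hwV : frobNorm (w - V) ≤ D := frobNorm_average_sub_le hK _ _ hs.drift
  have hV : ‖residual a x y V‖ ≤ 2 * ‖residual a x y w‖ := by
    have h1 := h.norm_residual_sub_le w V
    have h2 := norm_sub_norm_le (residual a x y V) (residual a x y w)
    rw [norm_sub_rev] at h2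
    have h3 : μ * frobNorm (w - V) ≤ μ * D := by gcongr
    linarith
  have hdrift : ∀ i, frobNorm (localIterate a x y η τ W0 t i - w) ≤
      8 * τ * η * μ * ‖residual a x y w‖ := by
    intro i
    have h1 := frobNorm_sub_le_add (localIterate a x y η τ W0 t i) V w
    have h2 := hs.drift i
    rw [frobNorm_sub_comm V w] at h1
    calc frobNorm (localIterate a x y η τ W0 t i - w) ≤ 2 * D := by linarith
      _ ≤ 2 * (τ * (2 * η * μ * (2 * ‖residual a x y w‖))) := by
        refine mul_le_mul_of_nonneg_left (hD.trans ?_) (by norm_num)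
        gcongr
      _ = _ := by ring
  have hmove := hs.move
  rw [← hw] at hmove
  have hrad := h.radius
  have hw0 := norm_nonneg (residual a x y w)
  have hww : ‖residual a x y w‖ ≤ ‖residual a x y W0‖ := by
    have := mul_nonneg hl.le (frobNorm_nonneg (w - W0))
    linarith
  refine ⟨hdrift, fun i => ?_, ?_, fun i => ?_⟩
  · refine le_of_mul_le_mul_left ?_ hl
    have h1 := mul_le_mul_of_nonneg_left
      (frobNorm_sub_le_add (localIterate a x y η τ W0 t i) w W0) hl.le
    have h2 : l * frobNorm (localIterate a x y η τ W0 t i - w) ≤ 1 / 8 * ‖residual a x y w‖ := by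
      calc _ ≤ μ * (8 * τ * η * μ * ‖residual a x y w‖) := by
            refine mul_le_mul h.l_le (hdrift i) (frobNorm_nonneg _) hμ.le
        _ = (8 * τ * η * μ ^ 2) * ‖residual a x y w‖ := by ring
        _ ≤ _ := by gcongr
    linarith
  · refine le_of_mul_le_mul_left ?_ hl
    linarith [norm_nonneg (residual a x y W0)]
  · have h1 := h.norm_residual_sub_le (localIterate a x y η τ W0 t i) V
    have h2 := norm_sub_norm_le (residual a x y (localIterate a x y η τ W0 t i)) (residual a x y V)
    have h3 := mul_le_mul_of_nonneg_left (hs.drift i) hμ.le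
    linarith

/-- Induction on time in which `V` is replaced by the new average at a synchronization and kept
otherwise. A local gradient is at most `μ * (2 * ‖residual V‖)`, which is the increment of the drift
bound. -/
lemma GoodInit.exists_state (h : GoodInit a x y W0 l μ κ R) (hK : 1 ≤ K) {η : ℝ} {τ : ℕ}
    (hτ : 1 ≤ τ) (hη : 0 ≤ η) (hημ : 8 * τ * η * μ ^ 2 * μ ≤ l / 8) (t : ℕ) :
    ∃ V, LocalGDState a x y W0 η τ l μ t V := by
  have hl := h.l_pos
  have hμ := h.μ_pos
  have hτ' : (1 : ℝ) ≤ τ := by exact_mod_cast hτ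
  have hK' : (1 : ℝ) ≤ K := by exact_mod_cast hK
  have hsmall : 8 * τ * η * μ ^ 2 ≤ 1 / 8 := by
    have : 8 * τ * η * μ ^ 2 * μ ≤ 1 / 8 * μ := by linarith [h.l_le]
    exact le_of_mul_le_mul_right this hμ
  have hsmall' : η * μ ^ 2 ≤ 1 / 8 := by
    refine le_trans ?_ hsmall
    rw [show 8 * τ * η * μ ^ 2 = (8 * τ) * (η * μ ^ 2) by ring]
    exact le_mul_of_one_le_left (by positivity) (by linarith)
  induction t with
  | zero =>
    refine ⟨W0, fun i => ?_, ?_, ?_⟩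
    · simp [localIterate, frobNorm_zero]
    · simp [avgIterate, localIterate, average_const hK, frobNorm_zero]
    · simp [avgIterate, localIterate, average_const hK]
  | succ t ih =>
    obtain ⟨V, hs⟩ := ih
    obtain ⟨hb1, hb2, -, hb4⟩ := h.state_bounds hK hτ hη hημ hs
    obtain ⟨hc, hm⟩ := h.averaged_step hK hη hsmall' hb2 hb1 (by positivity)
      (by linarith) hs.move (avgIterate_succ hK a x y η τ W0 t)
    have hρ : 0 ≤ 1 - η * l ^ 2 / (2 * K) := by
      have h1 : η * l ^ 2 ≤ η * μ ^ 2 := by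
        have := h.l_le
        gcongr
      have h2 : η * l ^ 2 / (2 * K) ≤ η * l ^ 2 := div_le_self (by positivity) (by linarith)
      linarith
    have hdec : ‖residual a x y (avgIterate a x y η τ W0 (t + 1))‖ ^ 2 ≤
        (1 - η * l ^ 2 / (2 * K)) ^ (t + 1) * ‖residual a x y W0‖ ^ 2 := by
      refine hc.trans ?_
      rw [pow_succ' (1 - η * l ^ 2 / (2 * (K : ℝ))), mul_assoc]
      exact mul_le_mul_of_nonneg_left hs.decay hρ
    by_cases hd : τ ∣ t + 1
    · refine ⟨avgIterate a x y η τ W0 (t + 1), fun i => ?_, hm, hdec⟩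
      have e : localIterate a x y η τ W0 (t + 1) i = avgIterate a x y η τ W0 (t + 1) := by
        rw [avgIterate, localIterate]
        simp only [if_pos hd]
        rw [average_const hK]
      rw [e, frobNorm_self_sub]
      positivity
    · refine ⟨V, fun i => ?_, hm, hdec⟩
      have e : localIterate a x y η τ W0 (t + 1) i = localIterate a x y η τ W0 t i -
          η • localGrad a (x i) (y i) (localIterate a x y η τ W0 t i) := by
        rw [localIterate]
        simp only [if_neg hd]
      have hmod : (t + 1) % τ = t % τ + 1 := by
        have h1 := Nat.mod_lt t hτ
        rcases Nat.lt_or_ge (t % τ + 1) τ with h2 | h2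
        · rw [Nat.add_mod, Nat.mod_eq_of_lt (a := 1) (by omega), Nat.mod_eq_of_lt h2]
        · exfalso
          apply hd
          have h3 : t % τ + 1 = τ := by omega
          rw [← Nat.div_add_mod t τ, add_assoc, h3]
          exact ⟨t / τ + 1, by ring⟩
      rw [e, hmod, sub_right_comm]
      refine (frobNorm_sub_le _ _).trans ?_
      rw [frobNorm_smul, abs_of_nonneg hη]
      have h1 := h.frobNorm_localGrad_le i (localIterate a x y η τ W0 t i)
      have h2 : frobNorm (localGrad a (x i) (y i) (localIterate a x y η τ W0 t i)) ≤
          μ * (2 * ‖residual a x y V‖) := h1.trans (mul_le_mul_of_nonneg_left (hb4 i) hμ.le)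
      have h3 := mul_le_mul_of_nonneg_left h2 hη
      have h4 := hs.drift i
      push_cast
      linarith

/-- Deterministic convergence of Local GD from a good initialization. -/
theorem GoodInit.convergence (h : GoodInit a x y W0 l μ κ R) (hK : 1 ≤ K) {η : ℝ} {τ : ℕ}
    (hτ : 1 ≤ τ) (hη : 0 ≤ η) (hημ : 8 * τ * η * μ ^ 2 * μ ≤ l / 8) (t : ℕ) :
    frobNorm (avgIterate a x y η τ W0 t - W0) ≤ R ∧
    (∀ i, frobNorm (localIterate a x y η τ W0 t i - W0) ≤ R) ∧
    globalLoss a x y (avgIterate a x y η τ W0 t) ≤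
      (1 - η * l ^ 2 / (2 * K)) ^ t * globalLoss a x y W0 := by
  obtain ⟨V, hs⟩ := h.exists_state hK hτ hη hημ t
  obtain ⟨-, h2, h3, -⟩ := h.state_bounds hK hτ hη hημ hs
  refine ⟨h3, h2, ?_⟩
  rw [globalLoss_eq, globalLoss_eq]
  have := mul_le_mul_of_nonneg_left hs.decay (by positivity : 0 ≤ 1 / (K : ℝ) * (1 / 2))
  linarith

end Deterministic

/-! ### Small balls of the Gaussian law -/

lemma gaussianPDFReal_le (x : ℝ) : gaussianPDFReal 0 1 x ≤ 2 / 5 := by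
  have h1 : (5 / 2 : ℝ) ≤ Real.sqrt (2 * Real.pi * (1 : NNReal)) := by
    apply Real.le_sqrt_of_sq_le
    have := Real.pi_gt_d2
    push_cast
    norm_num
    linarith
  rw [gaussianPDFReal]
  have h2 : Real.exp (-(x - 0) ^ 2 / (2 * (1 : NNReal))) ≤ 1 := by
    rw [Real.exp_le_one_iff]
    have : (0 : ℝ) ≤ (x - 0) ^ 2 / (2 * (1 : NNReal)) := by positivity
    rw [neg_div]; linarith
  calc (Real.sqrt (2 * Real.pi * (1 : NNReal)))⁻¹ * _
      ≤ (5 / 2 : ℝ)⁻¹ * 1 := by gcongr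
    _ = 2 / 5 := by norm_num

lemma le_gaussianPDFReal {x : ℝ} (hx : |x| ≤ 1) : 19 / 100 ≤ gaussianPDFReal 0 1 x := by
  have h1 : Real.sqrt (2 * Real.pi * (1 : NNReal)) ≤ 50 / 19 := by
    apply Real.sqrt_le_iff.2
    have := Real.pi_lt_d2
    push_cast
    constructor
    · norm_num
    · norm_num
      linarith
  have h0 : 0 < Real.sqrt (2 * Real.pi * (1 : NNReal)) := by
    have := Real.pi_pos
    simp only [NNReal.coe_one, mul_one]
    positivity
  rw [gaussianPDFReal]
  have h2 : 1 / 2 ≤ Real.exp (-(x - 0) ^ 2 / (2 * (1 : NNReal))) := by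
    have h3 := Real.add_one_le_exp (-(x - 0) ^ 2 / (2 * (1 : NNReal)))
    have h4 : x ^ 2 ≤ 1 := by rw [← sq_abs]; exact pow_le_one₀ (abs_nonneg _) hx
    simp only [NNReal.coe_one, mul_one, sub_zero] at h3 ⊢
    linarith
  calc (19 / 100 : ℝ) = (50 / 19 : ℝ)⁻¹ * (1 / 2) := by norm_num
    _ ≤ _ := by gcongr

lemma gaussianReal_real_Icc_le {a b : ℝ} (hab : a ≤ b) :
    (gaussianReal 0 1).real (Set.Icc a b) ≤ 2 / 5 * (b - a) := by
  rw [measureReal_def, gaussianReal_apply_eq_integral 0 one_ne_zero]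
  refine ENNReal.toReal_le_of_le_ofReal (by linarith) (ENNReal.ofReal_le_ofReal ?_)
  calc ∫ x in Set.Icc a b, gaussianPDFReal 0 1 x ≤ ∫ _x in Set.Icc a b, (2 / 5 : ℝ) := by
        refine setIntegral_mono_on (integrable_gaussianPDFReal 0 1).integrableOn
          (by simp) measurableSet_Icc fun x _ => gaussianPDFReal_le x
    _ = 2 / 5 * (b - a) := by
        rw [setIntegral_const, Real.volume_real_Icc_of_le hab, smul_eq_mul, mul_comm]

lemma le_gaussianReal_real_Ioc {a : ℝ} (ha : 0 ≤ a) (ha1 : a ≤ 1) :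
    19 / 100 * a ≤ (gaussianReal 0 1).real (Set.Ioc 0 a) := by
  rw [measureReal_def, gaussianReal_apply_eq_integral 0 one_ne_zero,
    ENNReal.toReal_ofReal (setIntegral_nonneg measurableSet_Ioc
      fun x _ => gaussianPDFReal_nonneg 0 1 x)]
  calc 19 / 100 * a = ∫ _x in Set.Ioc 0 a, (19 / 100 : ℝ) := by
        rw [setIntegral_const, Real.volume_real_Ioc_of_le ha, smul_eq_mul, mul_comm, sub_zero]
    _ ≤ _ := by
        refine setIntegral_mono_on (by simp) (integrable_gaussianPDFReal 0 1).integrableOn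
          measurableSet_Ioc fun x hx => le_gaussianPDFReal ?_
        rw [abs_of_pos hx.1]; exact hx.2.trans ha1

/-! ### Reflecting the weights of one neuron -/

section Reflection

variable {E : Type*} [NormedAddCommGroup E] [InnerProductSpace ℝ E] {P : Type*} [Fintype P]

lemma inner_reflection {x : E} (hx : ‖x‖ = 1) (y w : E) :
    inner ℝ y ((ℝ ∙ x)ᗮ.reflection w) = inner ℝ y w - 2 * inner ℝ x w * inner ℝ y x := by
  rw [Submodule.reflection_orthogonal_apply, Submodule.reflection_singleton_apply, hx]
  simp only [RCLike.ofReal_one, one_pow, div_one, neg_sub, inner_sub_right, two_smul,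
    inner_add_right, inner_smul_right]
  ring

/-- Only the pre-activation of `x p` is small at `w`, and it is positive. -/
def onlySmall (x : P → E) (γ : ℝ) (p : P) : Set E :=
  {w | inner ℝ (x p) w ∈ Set.Ioc 0 γ ∧ ∀ p', p' ≠ p → 3 * γ < |inner ℝ (x p') w|}

/-- The back-propagated vector of a single neuron with weights `w`. -/
def neuronGrad (x : P → E) (u : P → ℝ) (w : E) : E :=
  ∑ p, (u p * reluDeriv (inner ℝ (x p) w)) • x p

lemma norm_neuronGrad_le {x : P → E} (hx : ∀ p, ‖x p‖ = 1) (u : P → ℝ) (w : E) :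
    ‖neuronGrad x u w‖ ≤ ∑ p, |u p| := by
  refine (norm_sum_le _ _).trans (Finset.sum_le_sum fun p _ => ?_)
  rw [norm_smul, hx, mul_one, Real.norm_eq_abs, abs_mul]
  refine mul_le_of_le_one_right (abs_nonneg _) ?_
  rcases reluDeriv_eq_zero_or_one (inner ℝ (x p) w) with h | h <;> simp [h]

/-- A displacement of at most `2 * γ` cannot carry `a` across zero; this is why `onlySmall` demands
the margin `3 * γ`. -/
lemma reluDeriv_sub_eq {a b c γ : ℝ} (hc : c ∈ Set.Ioc 0 γ) (hb : |b| ≤ 1) (ha : 3 * γ < |a|) :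
    reluDeriv (a - 2 * c * b) = reluDeriv a := by
  have h1 : |2 * c * b| ≤ 2 * γ := by
    rw [abs_mul, abs_of_pos (by linarith [hc.1] : 0 < 2 * c)]
    nlinarith [hc.1, hc.2, abs_nonneg b]
  have h2 := abs_le.1 h1
  have h3 := hc.1.trans_le hc.2
  unfold reluDeriv
  rcases abs_cases a with ⟨h4, h5⟩ | ⟨h4, h5⟩
  · rw [if_pos (by linarith), if_pos h5]
  · rw [if_neg (by linarith), if_neg (by linarith)]

/-- The reflection negates the pre-activation at `p` and moves any other by at most `2 * γ`. Exactly
one activation switches, which isolates the coefficient `u p`. -/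
lemma neuronGrad_sub_reflection [DecidableEq P] {x : P → E} (hx : ∀ p, ‖x p‖ = 1) (u : P → ℝ)
    {γ : ℝ} {p : P} {w : E} (hw : w ∈ onlySmall x γ p) :
    neuronGrad x u w - neuronGrad x u ((ℝ ∙ x p)ᗮ.reflection w) = u p • x p := by
  rw [neuronGrad, neuronGrad, ← Finset.sum_sub_distrib, Finset.sum_eq_single p]
  · rw [inner_reflection (hx p), real_inner_self_eq_norm_sq, hx p, ← sub_smul]
    congr 1
    have h1 := hw.1.1
    have h2 : reluDeriv (inner ℝ (x p) w) = 1 := if_pos h1.le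
    have h3 : reluDeriv (inner ℝ (x p) w - 2 * inner ℝ (x p) w * 1 ^ 2) = 0 :=
      if_neg (by linarith)
    rw [h2, h3]; ring
  · intro q _ hq
    rw [inner_reflection (hx p), reluDeriv_sub_eq hw.1 _ (hw.2 q hq), sub_self]
    simpa [hx] using abs_real_inner_le_norm (x q) (x p)
  · simp

/-- Both memberships force `S p`: the pre-activation at `p` is at most `γ` in absolute value and
every other one exceeds `γ`, the margin `3 * γ` losing `2 * γ` under reflection. At most one `p`
satisfies this, and for that `p` the sign of the pre-activation tells the two memberships apart. -/
lemma sum_indicator_onlySmall_le_one {x : P → E} (hx : ∀ p, ‖x p‖ = 1) {γ : ℝ} (w : E) :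
    ∑ p, ((onlySmall x γ p).indicator (fun _ => (1 : ℝ)) w +
      (onlySmall x γ p).indicator (fun _ => (1 : ℝ)) ((ℝ ∙ x p)ᗮ.reflection w)) ≤ 1 := by
  classical
  set S : P → Prop := fun p => |inner ℝ (x p) w| ≤ γ ∧ ∀ p', p' ≠ p → γ < |inner ℝ (x p') w|
  have hS1 : ∀ p, w ∈ onlySmall x γ p → S p := by
    intro p hw
    have h0 := hw.1.1.trans_le hw.1.2
    refine ⟨?_, fun p' hp' => ?_⟩
    · rw [abs_of_pos hw.1.1]; exact hw.1.2
    · linarith [hw.2 p' hp']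
  have hS2 : ∀ p, (ℝ ∙ x p)ᗮ.reflection w ∈ onlySmall x γ p → inner ℝ (x p) w < 0 ∧ S p := by
    intro p hw
    have e : inner ℝ (x p) ((ℝ ∙ x p)ᗮ.reflection w) = - inner ℝ (x p) w := by
      rw [inner_reflection (hx p), real_inner_self_eq_norm_sq, hx p]; ring
    have h1 := hw.1
    rw [e] at h1
    have hneg : inner ℝ (x p) w < 0 := by linarith [h1.1]
    refine ⟨hneg, ?_, fun p' hp' => ?_⟩
    · rw [abs_of_neg hneg]; exact h1.2
    · have h2 := hw.2 p' hp'
      rw [inner_reflection (hx p)] at h2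
      have hb : |inner ℝ (x p') (x p)| ≤ 1 := by
        simpa [hx] using abs_real_inner_le_norm (x p') (x p)
      have h3 : |2 * inner ℝ (x p) w * inner ℝ (x p') (x p)| ≤ 2 * γ := by
        rw [abs_mul, abs_mul, abs_of_neg hneg, abs_two]
        nlinarith [h1.1, h1.2, abs_nonneg (inner ℝ (x p') (x p))]
      have h4 := abs_sub (inner ℝ (x p') w) (2 * inner ℝ (x p) w * inner ℝ (x p') (x p))
      linarith
  have hterm : ∀ p, ((onlySmall x γ p).indicator (fun _ => (1 : ℝ)) w +
      (onlySmall x γ p).indicator (fun _ => (1 : ℝ)) ((ℝ ∙ x p)ᗮ.reflection w)) ≤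
      if S p then 1 else 0 := by
    intro p
    by_cases h1 : w ∈ onlySmall x γ p
    · have h2 : (ℝ ∙ x p)ᗮ.reflection w ∉ onlySmall x γ p := fun h2 =>
        absurd (hS2 p h2).1 (not_lt.2 h1.1.1.le)
      rw [Set.indicator_of_mem h1, Set.indicator_of_notMem h2, if_pos (hS1 p h1)]
      norm_num
    · by_cases h2 : (ℝ ∙ x p)ᗮ.reflection w ∈ onlySmall x γ p
      · rw [Set.indicator_of_notMem h1, Set.indicator_of_mem h2, if_pos (hS2 p h2).2]
        norm_num
      · rw [Set.indicator_of_notMem h1, Set.indicator_of_notMem h2]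
        split_ifs <;> norm_num
  refine (Finset.sum_le_sum fun p _ => hterm p).trans ?_
  by_cases hex : ∃ p, S p
  · obtain ⟨p, hp⟩ := hex
    rw [Finset.sum_eq_single p]
    · rw [if_pos hp]
    · intro q _ hq
      rw [if_neg]
      intro hq'
      exact absurd (hp.2 q hq) (not_lt.2 hq'.1)
    · simp
  · push Not at hex
    simp [hex]

end Reflection

/-! ### Separated inputs under the standard Gaussian law -/

section StdGaussian

variable {E : Type*} [NormedAddCommGroup E] [InnerProductSpace ℝ E] [FiniteDimensional ℝ E]
  [MeasurableSpace E] [BorelSpace E]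

lemma stdGaussian_map_inner {x : E} (hx : ‖x‖ = 1) :
    (stdGaussian E).map (fun w => inner ℝ x w) = gaussianReal 0 1 := by
  have h := IsGaussian.map_eq_gaussianReal (μ := stdGaussian E) (innerSL ℝ x)
  have h2 : (innerSL ℝ x : E → ℝ) = fun w => inner ℝ x w := by ext; simp
  rw [variance_dual_stdGaussian, integral_strongDual_stdGaussian, innerSL_apply_norm, hx, h2] at h
  simpa using h

lemma indepFun_inner_stdGaussian {x z : E} (hxz : inner ℝ x z = 0) :
    IndepFun (fun w => inner ℝ x w) (fun w => inner ℝ z w) (stdGaussian E) := by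
  refine HasGaussianLaw.indepFun_of_covariance_eq_zero ?_ ?_
  · have : HasGaussianLaw (fun w : E => w) (stdGaussian E) :=
      ⟨by rw [Measure.map_id']; infer_instance⟩
    exact this.map_fun ((innerSL ℝ x).prod (innerSL ℝ z))
  · rw [← covarianceBilin_apply_eq_cov IsGaussian.memLp_two_id, covarianceBilin_stdGaussian]
    exact hxz

/-- Two pre-activations whose inputs are well separated are unlikely to be both small. -/
lemma stdGaussian_real_both_small_le {x y : E} (hx : ‖x‖ = 1) (hy : ‖y‖ = 1) {φ γ : ℝ}
    (hφ : 0 < φ) (hφ1 : φ ≤ ‖y - x‖) (hφ2 : φ ≤ ‖y + x‖) (hγ : 0 ≤ γ) :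
    (stdGaussian E).real {w | inner ℝ x w ∈ Set.Ioc 0 γ ∧ |inner ℝ y w| ≤ 3 * γ} ≤
      2 * γ ^ 2 / φ := by
  set t : ℝ := inner ℝ x y with ht
  have hsub : ‖y - x‖ ^ 2 = 2 - 2 * t := by
    rw [norm_sub_sq_real, hx, hy, real_inner_comm, ← ht]; ring
  have hadd : ‖y + x‖ ^ 2 = 2 + 2 * t := by
    rw [norm_add_sq_real, hx, hy, real_inner_comm, ← ht]; ring
  have h1 : φ ^ 2 ≤ 2 - 2 * t := by rw [← hsub]; gcongr
  have h2 : φ ^ 2 ≤ 2 + 2 * t := by rw [← hadd]; gcongr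
  set z₀ : E := y - t • x with hz₀
  have hz₀n : ‖z₀‖ ^ 2 = 1 - t ^ 2 := by
    rw [hz₀, norm_sub_sq_real, hy, norm_smul, hx, inner_smul_right, real_inner_comm, ← ht,
      Real.norm_eq_abs, mul_one, sq_abs]
    ring
  -- In `1 - t ^ 2 = (1 - |t|) * (1 + |t|)` one factor is at least `φ ^ 2 / 2` by separation and the
  -- other at least `1`. Both signs of separation are needed because `t` may have either sign.
  have hs2 : φ ^ 2 / 2 ≤ ‖z₀‖ ^ 2 := by
    rw [hz₀n]
    rcases le_total 0 t with h | h <;> nlinarith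
  set s := ‖z₀‖ with hs
  have hs0 : 7 / 10 * φ ≤ s := by
    refine le_of_sq_le_sq ?_ (norm_nonneg _)
    nlinarith
  have hspos : 0 < s := by linarith
  set z : E := s⁻¹ • z₀ with hz
  have hzn : ‖z‖ = 1 := by
    rw [hz, norm_smul, ← hs, norm_inv, Real.norm_of_nonneg hspos.le, inv_mul_cancel₀ hspos.ne']
  have hxz : inner ℝ x z = 0 := by
    rw [hz, inner_smul_right, hz₀, inner_sub_right, inner_smul_right, real_inner_self_eq_norm_sq,
      hx, ← ht]
    ring
  have hyw : ∀ w, inner ℝ y w = t * inner ℝ x w + s * inner ℝ z w := by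
    intro w
    have : y = t • x + s • z := by
      rw [hz, smul_smul, mul_inv_cancel₀ hspos.ne', one_smul, hz₀]; abel
    conv_lhs => rw [this]
    rw [inner_add_left, inner_smul_left, inner_smul_left]; simp
  have habs : |t| ≤ 1 := by
    rw [ht]
    simpa [hx, hy] using abs_real_inner_le_norm x y
  have hsubset : {w : E | inner ℝ x w ∈ Set.Ioc 0 γ ∧ |inner ℝ y w| ≤ 3 * γ} ⊆
      (fun w => inner ℝ x w) ⁻¹' Set.Icc 0 γ ∩
        (fun w => inner ℝ z w) ⁻¹' Set.Icc (-(4 * γ / s)) (4 * γ / s) := by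
    rintro w ⟨hw1, hw2⟩
    refine ⟨⟨hw1.1.le, hw1.2⟩, ?_⟩
    rw [Set.mem_preimage, Set.mem_Icc, ← abs_le]
    rw [le_div_iff₀ hspos]
    have h3 : s * inner ℝ z w = inner ℝ y w - t * inner ℝ x w := by rw [hyw w]; ring
    have h4 : |inner ℝ z w| * s = |s * inner ℝ z w| := by
      rw [abs_mul, abs_of_pos hspos, mul_comm]
    have h5 : |t * inner ℝ x w| ≤ 1 * γ := by
      rw [abs_mul]
      have : |inner ℝ x w| ≤ γ := by rw [abs_of_pos hw1.1]; exact hw1.2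
      gcongr
    rw [h4, h3]
    refine (abs_sub _ _).trans ?_
    linarith
  refine (measureReal_mono hsubset).trans ?_
  have hind := (indepFun_inner_stdGaussian hxz).measure_inter_preimage_eq_mul
    (Set.Icc 0 γ) (Set.Icc (-(4 * γ / s)) (4 * γ / s)) measurableSet_Icc measurableSet_Icc
  have hmx : ∀ v : E, Measurable fun w : E => inner ℝ v w := fun v => by fun_prop
  rw [measureReal_def, hind, ENNReal.toReal_mul, ← measureReal_def, ← measureReal_def,
    ← map_measureReal_apply (hmx x) measurableSet_Icc,
    ← map_measureReal_apply (hmx z) measurableSet_Icc,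
    stdGaussian_map_inner hx, stdGaussian_map_inner hzn]
  have h3 := gaussianReal_real_Icc_le hγ
  have h4 := gaussianReal_real_Icc_le (a := -(4 * γ / s)) (b := 4 * γ / s)
    (by linarith [show 0 ≤ 4 * γ / s by positivity])
  have h5 : 4 * γ / s ≤ 4 * γ / (7 / 10 * φ) := by gcongr
  calc _ ≤ (2 / 5 * (γ - 0)) * (2 / 5 * (4 * γ / s - -(4 * γ / s))) :=
        mul_le_mul h3 h4 measureReal_nonneg (by positivity)
    _ = 8 / 25 * γ * (4 * γ / s) := by ring
    _ ≤ 8 / 25 * γ * (4 * γ / (7 / 10 * φ)) := by gcongr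
    _ = (64 / 35) * (γ ^ 2 / φ) := by field_simp; ring
    _ ≤ 2 * (γ ^ 2 / φ) := by gcongr; norm_num
    _ = _ := by ring

/-! ### Coercivity of the expected tangent kernel -/

variable {P : Type*} [Fintype P]

lemma measurableSet_onlySmall (x : P → E) (γ : ℝ) (p : P) :
    MeasurableSet (onlySmall x γ p) := by
  have h : onlySmall x γ p = (fun w => inner ℝ (x p) w) ⁻¹' Set.Ioc 0 γ ∩
      ⋂ p', ⋂ (_ : p' ≠ p), (fun w => |inner ℝ (x p') w|) ⁻¹' Set.Ioi (3 * γ) := by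
    ext w; simp [onlySmall]
  rw [h]
  have h1 : ∀ v : E, Measurable fun w : E => inner ℝ v w := fun v => by fun_prop
  refine (h1 _ measurableSet_Ioc).inter ?_
  refine MeasurableSet.iInter fun p' => MeasurableSet.iInter fun _ => ?_
  exact (h1 _).abs measurableSet_Ioi

/-- The slab at `p` has probability of order `γ`, whereas a second small pre-activation has
probability of order only `γ ^ 2 / φ`. Taking `γ` to be a small multiple of `φ / N` makes the union
bound over the other samples affordable. -/
lemma le_stdGaussian_real_onlySmall {x : P → E} (hx : ∀ p, ‖x p‖ = 1) {φ : ℝ} (hφ : 0 < φ)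
    (hφ2 : φ ≤ 2)
    (hsep : ∀ p p', p ≠ p' → φ ≤ ‖x p - x p'‖ ∧ φ ≤ ‖x p + x p'‖) (p : P) :
    φ / (256 * Fintype.card P) ≤
      (stdGaussian E).real (onlySmall x (φ / (32 * Fintype.card P)) p) := by
  classical
  have hN : (1 : ℝ) ≤ Fintype.card P := by
    exact_mod_cast Fintype.card_pos_iff.2 ⟨p⟩
  set N : ℝ := (Fintype.card P : ℝ) with hNdef
  set γ := φ / (32 * N) with hγ
  have hγ0 : 0 ≤ γ := by positivity
  have hγ1 : γ ≤ 1 := by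
    rw [hγ, div_le_one (by positivity)]; linarith
  set S := (fun w : E => inner ℝ (x p) w) ⁻¹' Set.Ioc 0 γ with hS
  set U : P → Set E := fun p' =>
    {w | inner ℝ (x p) w ∈ Set.Ioc 0 γ ∧ |inner ℝ (x p') w| ≤ 3 * γ} with hU
  have hm : Measurable fun w : E => inner ℝ (x p) w := by fun_prop
  have hcover : S ⊆ onlySmall x γ p ∪ ⋃ p' ∈ Finset.univ.erase p, U p' := by
    intro w hw
    by_cases h : w ∈ onlySmall x γ p
    · exact Or.inl h
    · right
      simp only [onlySmall, Set.mem_ofPred_eq, not_and, not_forall] at h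
      obtain ⟨p', hp', hlt⟩ := h hw
      simp only [Set.mem_iUnion, Finset.mem_erase, Finset.mem_univ, and_true]
      exact ⟨p', hp', hw, not_lt.1 hlt⟩
  have h1 : (stdGaussian E).real S ≤ (stdGaussian E).real (onlySmall x γ p) +
      ∑ p' ∈ Finset.univ.erase p, (stdGaussian E).real (U p') :=
    ((measureReal_mono hcover).trans (measureReal_union_le _ _)).trans
      (add_le_add le_rfl (measureReal_biUnion_finset_le _ _))
  have h2 : 19 / 100 * γ ≤ (stdGaussian E).real S := by
    rw [hS, ← map_measureReal_apply hm measurableSet_Ioc, stdGaussian_map_inner (hx p)]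
    exact le_gaussianReal_real_Ioc hγ0 hγ1
  have h3 : ∑ p' ∈ Finset.univ.erase p, (stdGaussian E).real (U p') ≤ N * (2 * γ ^ 2 / φ) := by
    calc _ ≤ ∑ p' ∈ Finset.univ.erase p, 2 * γ ^ 2 / φ := by
          refine Finset.sum_le_sum fun p' hp' => ?_
          have hne := (Finset.mem_erase.1 hp').1
          exact stdGaussian_real_both_small_le (hx p) (hx p') hφ (hsep _ _ hne).1
            (hsep _ _ hne).2 hγ0
      _ ≤ ∑ _p' : P, 2 * γ ^ 2 / φ :=
          Finset.sum_le_sum_of_subset_of_nonneg (Finset.erase_subset _ _)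
            fun _ _ _ => by positivity
      _ = _ := by simp [hNdef]
  -- With the constant `32` in `γ`, the loss is `γ / 16` and `19/100 - 1/16 ≥ 1/8`.
  have h4 : N * (2 * γ ^ 2 / φ) = γ / 16 := by
    rw [hγ]; field_simp; norm_num
  have h5 : φ / (256 * N) = γ / 8 := by
    rw [hγ]; field_simp; norm_num
  linarith

lemma measurable_reluDeriv : Measurable reluDeriv :=
  Measurable.ite measurableSet_Ici measurable_const measurable_const

lemma measurable_neuronGrad (x : P → E) (u : P → ℝ) : Measurable (neuronGrad x u) := by
  refine Finset.measurable_sum _ fun p _ => ?_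
  refine Measurable.smul_const ?_ _
  exact (measurable_reluDeriv.comp (by fun_prop)).const_mul _

/-- On `onlySmall x γ p` the gradients at `w` and at its reflection differ by `u p • x p`, so their
squared norms add up to at least `u p ^ 2 / 2`. Summing over `p` loses nothing, since the events and
their reflections are disjoint. -/
theorem le_integral_sq_norm_neuronGrad {x : P → E} (hx : ∀ p, ‖x p‖ = 1) {φ : ℝ} (hφ : 0 < φ)
    (hφ2 : φ ≤ 2)
    (hsep : ∀ p p', p ≠ p' → φ ≤ ‖x p - x p'‖ ∧ φ ≤ ‖x p + x p'‖) (u : P → ℝ) :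
    φ / (512 * Fintype.card P) * ∑ p, u p ^ 2 ≤
      ∫ w, ‖neuronGrad x u w‖ ^ 2 ∂(stdGaussian E) := by
  classical
  set γ := φ / (32 * Fintype.card P) with hγ
  set F : E → ℝ := fun w => ‖neuronGrad x u w‖ ^ 2 with hF
  set I : P → E → ℝ := fun p => (onlySmall x γ p).indicator fun _ => (1 : ℝ) with hI
  set Rf : P → E → E := fun p => (ℝ ∙ x p)ᗮ.reflection with hRf
  have hRm : ∀ p, Measurable (Rf p) := fun p => (ℝ ∙ x p)ᗮ.reflection.continuous.measurable
  have hFm : Measurable F := (measurable_neuronGrad x u).norm.pow_const 2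
  have hIm : ∀ p, Measurable (I p) := fun p =>
    measurable_const.indicator (measurableSet_onlySmall x γ p)
  have hI0 : ∀ p w, 0 ≤ I p w := fun p w => Set.indicator_nonneg (fun _ _ => zero_le_one) w
  have hI1 : ∀ p w, I p w ≤ 1 := fun p w => Set.indicator_le_self' (fun _ _ => zero_le_one) w
  have hF0 : ∀ w, 0 ≤ F w := fun w => sq_nonneg _
  have hFb : ∀ w, F w ≤ (∑ p, |u p|) ^ 2 := fun w => by
    simp only [hF]
    gcongr
    exact norm_neuronGrad_le hx u w
  have hFint : Integrable F (stdGaussian E) :=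
    Integrable.of_bound hFm.aestronglyMeasurable _ (Filter.Eventually.of_forall fun w => by
      rw [Real.norm_of_nonneg (hF0 w)]; exact hFb w)
  have hint : ∀ (G H : E → ℝ), Measurable G → Measurable H → (∀ w, 0 ≤ G w ∧ G w ≤ 1) →
      (∀ w, 0 ≤ H w ∧ H w ≤ (∑ p, |u p|) ^ 2) →
      Integrable (fun w => G w * H w) (stdGaussian E) := by
    intro G H hG hH hG1 hH1
    refine Integrable.of_bound (hG.mul hH).aestronglyMeasurable ((∑ p, |u p|) ^ 2)
      (Filter.Eventually.of_forall fun w => ?_)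
    rw [Real.norm_of_nonneg (mul_nonneg (hG1 w).1 (hH1 w).1)]
    calc G w * H w ≤ 1 * (∑ p, |u p|) ^ 2 :=
          mul_le_mul (hG1 w).2 (hH1 w).2 (hH1 w).1 zero_le_one
      _ = _ := one_mul _
  have hi1 : ∀ p, Integrable (fun w => I p w * F w) (stdGaussian E) := fun p =>
    hint _ _ (hIm p) hFm (fun w => ⟨hI0 p w, hI1 p w⟩) fun w => ⟨hF0 w, hFb w⟩
  have hi2 : ∀ p, Integrable (fun w => I p (Rf p w) * F w) (stdGaussian E) := fun p =>
    hint _ _ ((hIm p).comp (hRm p)) hFm (fun w => ⟨hI0 p _, hI1 p _⟩) fun w => ⟨hF0 w, hFb w⟩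
  have hi3 : ∀ p, Integrable (fun w => I p w * F (Rf p w)) (stdGaussian E) := fun p =>
    hint _ _ (hIm p) (hFm.comp (hRm p)) (fun w => ⟨hI0 p w, hI1 p w⟩) fun w => ⟨hF0 _, hFb _⟩
  -- The reflection is an isometric involution, hence it preserves the Gaussian law and can be moved
  -- from one factor to the other.
  have hswap : ∀ p, ∫ w, I p (Rf p w) * F w ∂(stdGaussian E) =
      ∫ w, I p w * F (Rf p w) ∂(stdGaussian E) := by
    intro p
    have hmap : (stdGaussian E).map (Rf p) = stdGaussian E :=
      stdGaussian_map (ℝ ∙ x p)ᗮ.reflection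
    conv_rhs => rw [← hmap]
    have hm : AEStronglyMeasurable (fun w => I p w * F (Rf p w)) ((stdGaussian E).map (Rf p)) :=
      ((hIm p).mul (hFm.comp (hRm p))).aestronglyMeasurable
    rw [integral_map (hRm p).aemeasurable hm]
    refine integral_congr_ae (Filter.Eventually.of_forall fun w => ?_)
    simp [hRf]
  have hlower : ∀ p, u p ^ 2 / 2 * (φ / (256 * Fintype.card P)) ≤
      ∫ w, I p w * F w ∂(stdGaussian E) + ∫ w, I p (Rf p w) * F w ∂(stdGaussian E) := by
    intro p
    rw [hswap, ← integral_add (hi1 p) (hi3 p)]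
    calc u p ^ 2 / 2 * (φ / (256 * Fintype.card P))
        ≤ u p ^ 2 / 2 * (stdGaussian E).real (onlySmall x γ p) := by
          gcongr
          exact le_stdGaussian_real_onlySmall hx hφ hφ2 hsep p
      _ = ∫ w, u p ^ 2 / 2 * I p w ∂(stdGaussian E) := by
          rw [integral_const_mul, integral_indicator_const _ (measurableSet_onlySmall x γ p)]
          simp
      _ ≤ _ := by
          refine integral_mono ?_ ((hi1 p).add (hi3 p)) fun w => ?_
          · refine Integrable.const_mul ?_ _
            exact (integrable_const _).indicator (measurableSet_onlySmall x γ p)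
          · by_cases hw : w ∈ onlySmall x γ p
            · have h1 := neuronGrad_sub_reflection hx u hw
              have h2 : ‖u p • x p‖ ^ 2 = u p ^ 2 := by rw [norm_smul, hx, mul_one]; simp
              have h3 : u p ^ 2 ≤ 2 * (F w + F (Rf p w)) := by
                rw [← h2, ← h1]
                have h4 := norm_sub_le (neuronGrad x u w) (neuronGrad x u (Rf p w))
                calc _ ≤ (‖neuronGrad x u w‖ + ‖neuronGrad x u (Rf p w)‖) ^ 2 := by
                      gcongr
                  _ ≤ _ := by
                      simp only [hF]
                      nlinarith [sq_nonneg (‖neuronGrad x u w‖ - ‖neuronGrad x u (Rf p w)‖)]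
              simp only [hI, Set.indicator_of_mem hw]
              linarith
            · simp [hI, Set.indicator_of_notMem hw]
  calc φ / (512 * Fintype.card P) * ∑ p, u p ^ 2
      = ∑ p, u p ^ 2 / 2 * (φ / (256 * Fintype.card P)) := by
        rw [Finset.mul_sum]
        refine Finset.sum_congr rfl fun p _ => ?_
        rw [show (512 : ℝ) = 2 * 256 by norm_num, mul_assoc, div_mul_eq_div_div_swap]
        ring
    _ ≤ ∑ p, (∫ w, I p w * F w ∂(stdGaussian E) + ∫ w, I p (Rf p w) * F w ∂(stdGaussian E)) :=
        Finset.sum_le_sum fun p _ => hlower p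
    _ = ∫ w, ∑ p, (I p w * F w + I p (Rf p w) * F w) ∂(stdGaussian E) := by
        rw [integral_finsetSum Finset.univ
          (f := fun p w => I p w * F w + I p (Rf p w) * F w) fun p _ => (hi1 p).add (hi2 p)]
        exact Finset.sum_congr rfl fun p _ => (integral_add (hi1 p) (hi2 p)).symm
    _ ≤ ∫ w, F w ∂(stdGaussian E) := by
        refine integral_mono (integrable_finsetSum _ fun p _ => (hi1 p).add (hi2 p)) hFint
          fun w => ?_
        simp only [← add_mul, ← Finset.sum_mul]
        exact mul_le_of_le_one_left (hF0 w) (sum_indicator_onlySmall_le_one hx w)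

end StdGaussian

/-! ### Sums of independent neurons -/

section IID

variable {α : Type*} [MeasurableSpace α] {μ : Measure α} {ρ : Measure ℝ}
  [IsProbabilityMeasure μ] [IsProbabilityMeasure ρ] {m : ℕ}

/-- Hidden rows and output weights are drawn as two separate families. Regrouping them by neuron
exhibits the sum as one of i.i.d. terms. -/
lemma real_prod_pi_sum (g : α × ℝ → ℝ) (hg : Measurable g) (A : ℝ) :
    ((Measure.pi fun _ : Fin m => μ).prod (Measure.pi fun _ : Fin m => ρ)).real
      {p | A ≤ ∑ r, g (p.1 r, p.2 r)} =
    (Measure.pi fun _ : Fin m => μ.prod ρ).real {ω | A ≤ ∑ r, g (ω r)} := by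
  have hmp := measurePreserving_arrowProdEquivProdArrow α ℝ (Fin m) (fun _ => μ) (fun _ => ρ)
  have hS : MeasurableSet {p : (Fin m → α) × (Fin m → ℝ) | A ≤ ∑ r, g (p.1 r, p.2 r)} :=
    measurableSet_le measurable_const (Finset.measurable_sum _ fun r _ => hg.comp (by fun_prop))
  rw [← hmp.measureReal_preimage hS.nullMeasurableSet]
  rfl

lemma iIndepFun_pi_prod (g : α × ℝ → ℝ) (hg : Measurable g) :
    iIndepFun (fun (r : Fin m) (ω : Fin m → α × ℝ) => g (ω r))
      (Measure.pi fun _ : Fin m => μ.prod ρ) :=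
  iIndepFun_pi (X := fun _ => g) fun _ => hg.aemeasurable

/-- Chernoff bound for a sum of functions of independent neurons. -/
lemma chernoff_prod_pi (g : α × ℝ → ℝ) (hg : Measurable g) (A : ℝ) {s B : ℝ} (hs : 0 ≤ s)
    (hint : Integrable (fun z => Real.exp (s * g z)) (μ.prod ρ))
    (hB : ∫ z, Real.exp (s * g z) ∂(μ.prod ρ) ≤ Real.exp B) :
    ((Measure.pi fun _ : Fin m => μ).prod (Measure.pi fun _ : Fin m => ρ)).real
      {p | A ≤ ∑ r, g (p.1 r, p.2 r)} ≤ Real.exp (-s * A + m * B) := by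
  rw [real_prod_pi_sum g hg]
  set ν := Measure.pi fun _ : Fin m => μ.prod ρ
  have hind := iIndepFun_pi_prod (μ := μ) (ρ := ρ) (m := m) g hg
  have hm : ∀ r : Fin m, Measurable fun ω : Fin m → α × ℝ => g (ω r) := fun r =>
    hg.comp (measurable_pi_apply r)
  have hmp : ∀ r : Fin m, MeasurePreserving (Function.eval r) ν (μ.prod ρ) := fun r =>
    measurePreserving_eval _ r
  have hint' : ∀ r ∈ Finset.univ, Integrable (fun ω : Fin m → α × ℝ => Real.exp (s * g (ω r))) ν :=
    fun r _ => (hmp r).integrable_comp_of_integrable hint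
  have h1 := measure_ge_le_exp_mul_mgf (X := ∑ r, fun ω : Fin m → α × ℝ => g (ω r)) A hs
    (hind.integrable_exp_mul_sum hm hint')
  rw [hind.mgf_sum hm] at h1
  have h2 : ∀ r : Fin m, mgf (fun ω : Fin m → α × ℝ => g (ω r)) ν s ≤ Real.exp B := by
    intro r
    have h3 := integral_map (hmp r).measurable.aemeasurable
      (f := fun z => Real.exp (s * g z)) (by rw [(hmp r).map_eq]; exact hint.aestronglyMeasurable)
    rw [(hmp r).map_eq] at h3
    exact h3.symm.le.trans hB
  simp only [Finset.sum_apply] at h1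
  refine h1.trans ?_
  rw [Real.exp_add]
  gcongr
  calc ∏ r, mgf (fun ω : Fin m → α × ℝ => g (ω r)) ν s ≤ ∏ _r : Fin m, Real.exp B :=
        Finset.prod_le_prod (fun r _ => mgf_nonneg) fun r _ => h2 r
    _ = Real.exp (m * B) := by simp [← Real.exp_nat_mul]

/-- Hoeffding's inequality for a sum of functions of independent neurons. -/
lemma hoeffding_prod_pi (hm : 0 < m) (g : α × ℝ → ℝ) (hg : Measurable g)
    (hg01 : ∀ z, g z ∈ Set.Icc (0 : ℝ) 1) {L : ℝ} (hL : 0 ≤ L) :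
    ((Measure.pi fun _ : Fin m => μ).prod (Measure.pi fun _ : Fin m => ρ)).real
      {p | m * ∫ z, g z ∂(μ.prod ρ) + Real.sqrt m * L ≤ ∑ r, g (p.1 r, p.2 r)} ≤
      Real.exp (-(2 * L ^ 2)) := by
  rw [real_prod_pi_sum g hg]
  set ν := Measure.pi fun _ : Fin m => μ.prod ρ
  set I := ∫ z, g z ∂(μ.prod ρ) with hI
  have hm' : (0 : ℝ) < m := by exact_mod_cast hm
  have hind := iIndepFun_pi_prod (μ := μ) (ρ := ρ) (m := m) (fun z => g z - I) (hg.sub_const _)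
  have hmp : ∀ r : Fin m, MeasurePreserving (Function.eval r) ν (μ.prod ρ) := fun r =>
    measurePreserving_eval _ r
  have hsub : ∀ r ∈ (Finset.univ : Finset (Fin m)),
      HasSubgaussianMGF (fun ω : Fin m → α × ℝ => g (ω r) - I) ((‖(1 : ℝ) - 0‖₊ / 2) ^ 2) ν := by
    intro r _
    have h1 : HasSubgaussianMGF (fun z => g z - I) ((‖(1 : ℝ) - 0‖₊ / 2) ^ 2)
        (ν.map (Function.eval r)) := by
      rw [(hmp r).map_eq]
      exact hasSubgaussianMGF_of_mem_Icc hg.aemeasurable (Filter.Eventually.of_forall hg01)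
    exact h1.of_map (hmp r).measurable.aemeasurable
  have h2 := HasSubgaussianMGF.measure_sum_ge_le_of_iIndepFun hind hsub
    (ε := Real.sqrt m * L) (by positivity)
  have e1 : {ω : Fin m → α × ℝ | m * I + Real.sqrt m * L ≤ ∑ r, g (ω r)} =
      {ω | Real.sqrt m * L ≤ ∑ r, (g (ω r) - I)} := by
    ext ω
    simp only [Set.mem_ofPred_eq, Finset.sum_sub_distrib, Finset.sum_const, Finset.card_univ,
      Fintype.card_fin, nsmul_eq_mul]
    constructor <;> intro h <;> linarith
  rw [e1]
  refine h2.trans (le_of_eq ?_)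
  congr 1
  simp only [sub_zero, nnnorm_one, Finset.sum_const, Finset.card_univ, Fintype.card_fin,
    nsmul_eq_mul, NNReal.coe_mul, NNReal.coe_natCast, NNReal.coe_pow, NNReal.coe_div,
    NNReal.coe_one, NNReal.coe_ofNat, mul_pow, Real.sq_sqrt hm'.le]
  field_simp

/-- Hoeffding's inequality, lower tail. -/
lemma hoeffding_prod_pi_lower (hm : 0 < m) (g : α × ℝ → ℝ) (hg : Measurable g)
    (hg01 : ∀ z, g z ∈ Set.Icc (0 : ℝ) 1) {L : ℝ} (hL : 0 ≤ L) :
    ((Measure.pi fun _ : Fin m => μ).prod (Measure.pi fun _ : Fin m => ρ)).real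
      {p | ∑ r, g (p.1 r, p.2 r) ≤ m * ∫ z, g z ∂(μ.prod ρ) - Real.sqrt m * L} ≤
      Real.exp (-(2 * L ^ 2)) := by
  have hint : Integrable g (μ.prod ρ) :=
    Integrable.of_mem_Icc 0 1 hg.aemeasurable (Filter.Eventually.of_forall hg01)
  have h := hoeffding_prod_pi (μ := μ) (ρ := ρ) hm (fun z => 1 - g z) (measurable_const.sub hg)
    (fun z => ⟨by linarith [(hg01 z).2], by linarith [(hg01 z).1]⟩) hL
  rw [integral_sub (integrable_const _) hint] at h
  refine le_trans (le_of_eq ?_) h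
  congr 1
  ext p
  simp only [Set.mem_ofPred_eq, Finset.sum_sub_distrib, Finset.sum_const, Finset.card_univ,
    Fintype.card_fin, nsmul_eq_mul, integral_const, probReal_univ, smul_eq_mul]
  constructor <;> intro h <;> linarith

end IID

/-! ### The law of the output weights -/

/-- What the proof uses of the law of the output weights. -/
structure OutputLaw (ρ : Measure ℝ) : Prop where
  isProb : IsProbabilityMeasure ρ
  subgaussian : HasSubgaussianMGF (fun a : ℝ => a) 1 ρ
  not_small : 1 / 2 ≤ ρ.real {a | 1 / 2 ≤ |a|}

instance : IsProbabilityMeasure rademacher := by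
  constructor
  simp [rademacher, ENNReal.inv_two_add_inv_two]

lemma outputLaw_rademacher : OutputLaw rademacher where
  isProb := inferInstance
  subgaussian := by
    have hi : ∀ f : ℝ → ℝ, Integrable f rademacher := by
      intro f
      refine Integrable.add_measure ?_ ?_ <;>
      exact (integrable_dirac (by simp)).smul_measure (by simp)
    refine ⟨fun t => hi _, fun t => ?_⟩
    have hi' : ∀ f : ℝ → ℝ, ∀ b : ℝ, Integrable f ((2⁻¹ : ENNReal) • Measure.dirac b) := fun f b =>
      (integrable_dirac (by simp)).smul_measure (by simp)
    rw [mgf, rademacher, integral_add_measure (hi' _ _) (hi' _ _), integral_smul_measure,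
      integral_smul_measure, integral_dirac, integral_dirac]
    have := Real.cosh_le_exp_half_sq t
    rw [Real.cosh_eq] at this
    simp only [ENNReal.toReal_inv, ENNReal.toReal_ofNat, smul_eq_mul, mul_one, mul_neg,
      NNReal.coe_one, one_mul]
    linarith
  not_small := by
    have hm : MeasurableSet {a : ℝ | 1 / 2 ≤ |a|} :=
      measurableSet_le measurable_const (by fun_prop)
    have h : {a : ℝ | 1 / 2 ≤ |a|}ᶜ ⊆ ({1, -1} : Set ℝ)ᶜ := by
      intro a ha hb
      rcases hb with rfl | rfl <;> norm_num at ha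
    have h1 : rademacher {a : ℝ | 1 / 2 ≤ |a|} = 1 := by
      rw [rademacher, Measure.add_apply, Measure.smul_apply, Measure.smul_apply,
        Measure.dirac_apply' _ hm, Measure.dirac_apply' _ hm]
      rw [Set.indicator_of_mem (by norm_num), Set.indicator_of_mem (by norm_num)]
      simp [ENNReal.inv_two_add_inv_two]
    rw [measureReal_def, h1]
    norm_num

lemma outputLaw_gaussianReal : OutputLaw (gaussianReal 0 1) where
  isProb := inferInstance
  subgaussian := by
    refine ⟨fun t => integrable_exp_mul_gaussianReal t, fun t => ?_⟩
    rw [mgf_fun_id_gaussianReal]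
    simp
  not_small := by
    have hm : MeasurableSet {a : ℝ | 1 / 2 ≤ |a|} :=
      measurableSet_le measurable_const (by fun_prop)
    have h1 : (gaussianReal 0 1).real {a : ℝ | 1 / 2 ≤ |a|}ᶜ ≤ 2 / 5 * (1 / 2 - -(1 / 2)) := by
      refine (measureReal_mono ?_).trans (gaussianReal_real_Icc_le (by norm_num))
      intro a ha
      simp only [Set.mem_compl_iff, Set.mem_ofPred_eq, not_le] at ha
      exact ⟨(abs_lt.1 ha).1.le, (abs_lt.1 ha).2.le⟩
    rw [probReal_compl_eq_one_sub hm] at h1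
    linarith

namespace OutputLaw

variable {ρ : Measure ℝ}

/-- The eighth power is one term of the exponential series, with `40320 = 8!`. Eighth moments are
what the tail `a ^ 8 / A ^ 3` in `GoodSample.sum_flips_le` needs. -/
lemma pow_eight_le (a : ℝ) : a ^ 8 ≤ 40320 * (Real.exp (1 * a) + Real.exp (-1 * a)) := by
  have h1 := Real.pow_div_factorial_le_exp (x := |a|) (abs_nonneg a) 8
  have h2 : |a| ^ 8 = a ^ 8 := by
    rw [show 8 = 2 * 4 by norm_num, pow_mul, sq_abs, ← pow_mul]
  have h3 : Real.exp |a| ≤ Real.exp (1 * a) + Real.exp (-1 * a) := by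
    simp only [one_mul, neg_one_mul]
    rcases abs_cases a with ⟨h1, -⟩ | ⟨h1, -⟩ <;> rw [h1] <;>
    linarith [Real.exp_nonneg a, Real.exp_nonneg (-a)]
  rw [h2, div_le_iff₀ (by positivity)] at h1
  norm_num [Nat.factorial] at h1
  linarith

lemma integral_pow_eight_le (h : OutputLaw ρ) {f : ℝ → ℝ} (hf0 : ∀ a, 0 ≤ f a)
    (hf : ∀ a, f a ≤ a ^ 8) : ∫ a, f a ∂ρ ≤ 161280 := by
  have hi1 := h.subgaussian.integrable_exp_mul 1
  have hi2 := h.subgaussian.integrable_exp_mul (-1)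
  have h1 := h.subgaussian.mgf_le 1
  have h2 := h.subgaussian.mgf_le (-1)
  rw [mgf] at h1 h2
  have h3 : Real.exp (1 / 2) ≤ 2 := by
    have h4 : Real.exp (1 / 2) ^ 2 ≤ 2 ^ 2 := by
      rw [← Real.exp_nat_mul]
      norm_num
      linarith [Real.exp_one_lt_d9]
    exact le_of_sq_le_sq h4 (by norm_num)
  calc ∫ a, f a ∂ρ ≤ ∫ a, 40320 * (Real.exp (1 * a) + Real.exp (-1 * a)) ∂ρ :=
        integral_mono_of_nonneg (Filter.Eventually.of_forall hf0) ((hi1.add hi2).const_mul _)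
          (Filter.Eventually.of_forall fun a => (hf a).trans (pow_eight_le a))
    _ = 40320 * (∫ a, Real.exp (1 * a) ∂ρ + ∫ a, Real.exp (-1 * a) ∂ρ) := by
        rw [integral_const_mul, integral_add hi1 hi2]
    _ ≤ 40320 * (2 + 2) := by
        norm_num at h1 h2
        norm_num
        linarith
    _ = _ := by norm_num

lemma real_abs_gt_le (h : OutputLaw ρ) {L : ℝ} (hL : 0 ≤ L) :
    ρ.real {a | L < |a|} ≤ 2 * Real.exp (-(L ^ 2 / 2)) := by
  have := h.isProb
  have h1 := h.subgaussian.measure_ge_le hL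
  have h2 := h.subgaussian.neg.measure_ge_le hL
  have h3 : {a : ℝ | L < |a|} ⊆ {a | L ≤ a} ∪ {a | L ≤ (-fun a : ℝ => a) a} := by
    intro a ha
    have ha' : L < |a| := ha
    rcases lt_abs.1 ha' with h | h
    · exact Or.inl h.le
    · exact Or.inr h.le
  refine ((measureReal_mono h3).trans (measureReal_union_le _ _)).trans ?_
  have e : -L ^ 2 / (2 * ((1 : NNReal) : ℝ)) = -(L ^ 2 / 2) := by simp; ring
  rw [e] at h1 h2
  linarith

end OutputLaw

/-! ### The law of the rows of the hidden layer -/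

/-- The law of one row of `W(0)`. -/
def rowLaw (m d : ℕ) : Measure (Fin d → ℝ) :=
  Measure.pi fun _ : Fin d => gaussianReal 0 (2 / (m : NNReal))

instance (m d : ℕ) : IsProbabilityMeasure (rowLaw m d) := by
  unfold rowLaw; infer_instance

lemma initLaw_eq (m d : ℕ) (ρ : Measure ℝ) : initLaw m d ρ =
    (Measure.pi fun _ : Fin m => rowLaw m d).prod (Measure.pi fun _ : Fin m => ρ) := rfl

/-- A scaled standard Gaussian vector as a row. -/
def scaledRow (m d : ℕ) (w : EuclideanSpace ℝ (Fin d)) : Fin d → ℝ :=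
  fun k => Real.sqrt (2 / m) * w k

lemma measurable_scaledRow (m d : ℕ) : Measurable (scaledRow m d) := by
  unfold scaledRow; fun_prop

lemma rowLaw_eq_map (m d : ℕ) :
    rowLaw m d = (stdGaussian (EuclideanSpace ℝ (Fin d))).map (scaledRow m d) := by
  have h1 : gaussianReal 0 (2 / (m : NNReal)) =
      (gaussianReal 0 1).map (fun z => Real.sqrt (2 / m) * z) := by
    rw [gaussianReal_map_const_mul]
    congr 1
    · simp
    · apply NNReal.eq
      simp only [NNReal.coe_div, NNReal.coe_ofNat, NNReal.coe_natCast, mul_one,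
        NNReal.coe_mk]
      rw [Real.sq_sqrt (by positivity)]
  rw [rowLaw, ← map_pi_eq_stdGaussian, Measure.map_map (measurable_scaledRow m d) (by fun_prop)]
  rw [h1, ← Measure.pi_map_pi (fun _ => by fun_prop)]
  rfl

/-- The pre-activation of one neuron. -/
def dotRow {d : ℕ} (x : EuclideanSpace ℝ (Fin d)) (w : Fin d → ℝ) : ℝ := ∑ k, w k * x k

lemma measurable_dotRow {d : ℕ} (x : EuclideanSpace ℝ (Fin d)) : Measurable (dotRow x) := by
  unfold dotRow; fun_prop

lemma dotRow_scaledRow {m d : ℕ} (x w : EuclideanSpace ℝ (Fin d)) :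
    dotRow x (scaledRow m d w) = Real.sqrt (2 / m) * inner ℝ x w := by
  simp [dotRow, scaledRow, PiLp.inner_apply, Finset.mul_sum, mul_assoc]

lemma reluDeriv_mul {c z : ℝ} (hc : 0 < c) : reluDeriv (c * z) = reluDeriv z := by
  simp [reluDeriv, hc]

lemma map_dotRow_rowLaw {m d : ℕ} {x : EuclideanSpace ℝ (Fin d)} (hx : ‖x‖ = 1) :
    (rowLaw m d).map (dotRow x) =
      (gaussianReal 0 1).map (fun z => Real.sqrt (2 / m) * z) := by
  rw [rowLaw_eq_map, Measure.map_map (measurable_dotRow x) (measurable_scaledRow m d),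
    ← stdGaussian_map_inner hx, Measure.map_map (by fun_prop) (by fun_prop)]
  congr 1
  ext w
  exact dotRow_scaledRow x w

lemma rowLaw_real_small_le {m d : ℕ} (hm : 0 < m) {x : EuclideanSpace ℝ (Fin d)} (hx : ‖x‖ = 1)
    {δ : ℝ} (hδ : 0 ≤ δ) :
    (rowLaw m d).real {w | |dotRow x w| ≤ δ} ≤ δ * Real.sqrt m := by
  have hm' : (0 : ℝ) < m := by exact_mod_cast hm
  have hs : 0 < Real.sqrt (2 / m) := by positivity
  have hset : {w | |dotRow x w| ≤ δ} = dotRow x ⁻¹' {z | |z| ≤ δ} := rfl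
  have hms : MeasurableSet {z : ℝ | |z| ≤ δ} := measurableSet_le (by fun_prop) measurable_const
  have hsub : (fun z => Real.sqrt (2 / m) * z) ⁻¹' {z | |z| ≤ δ} =
      Set.Icc (-(δ / Real.sqrt (2 / m))) (δ / Real.sqrt (2 / m)) := by
    ext z
    rw [Set.mem_preimage, Set.mem_Icc, ← abs_le, le_div_iff₀ hs, Set.mem_ofPred_eq, abs_mul,
      abs_of_pos hs, mul_comm]
  rw [hset, ← map_measureReal_apply (measurable_dotRow x) hms, map_dotRow_rowLaw hx,
    map_measureReal_apply (by fun_prop) hms, hsub]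
  have h0 : 0 ≤ δ / Real.sqrt (2 / m) := by positivity
  refine (gaussianReal_real_Icc_le (by linarith)).trans ?_
  have h1 : 1 ≤ Real.sqrt (2 / m) * Real.sqrt m := by
    rw [← Real.sqrt_mul (by positivity), div_mul_cancel₀ _ hm'.ne']
    exact Real.one_le_sqrt.2 (by norm_num)
  have h2 : δ / Real.sqrt (2 / m) ≤ δ * Real.sqrt m := by
    rw [div_le_iff₀ hs]
    nlinarith
  linarith

/-- The exact value is `(1 - 2 * b) ^ (-1/2)`. It is at most `1 / (1 - 2 * b)`, hence at most `1 + 4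
* b` in the given range. -/
lemma integral_exp_sq_gaussianReal {b : ℝ} (hb0 : 0 ≤ b) (hb : b ≤ 1 / 4) :
    Integrable (fun z : ℝ => Real.exp (b * z ^ 2)) (gaussianReal 0 1) ∧
      ∫ z, Real.exp (b * z ^ 2) ∂(gaussianReal 0 1) ≤ Real.exp (4 * b) := by
  have e : ∀ z : ℝ, gaussianPDFReal 0 1 z * Real.exp (b * z ^ 2) =
      (Real.sqrt (2 * Real.pi))⁻¹ * Real.exp (-(1 / 2 - b) * z ^ 2) := by
    intro z
    rw [gaussianPDFReal, mul_assoc, ← Real.exp_add]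
    simp only [NNReal.coe_one, mul_one, sub_zero]
    congr 2
    ring
  have hpos : 0 < 1 / 2 - b := by linarith
  constructor
  · rw [gaussianReal_of_var_ne_zero 0 one_ne_zero,
      integrable_withDensity_iff_integrable_smul₀' (by fun_prop)
        (Filter.Eventually.of_forall fun z => gaussianPDF_lt_top)]
    simp only [toReal_gaussianPDF, smul_eq_mul, e]
    exact (integrable_exp_neg_mul_sq hpos).const_mul _
  · rw [integral_gaussianReal_eq_integral_smul one_ne_zero]
    simp only [smul_eq_mul, e]
    rw [integral_const_mul, integral_gaussian, ← Real.sqrt_inv,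
      ← Real.sqrt_mul (by positivity)]
    have hy : (2 * Real.pi)⁻¹ * (Real.pi / (1 / 2 - b)) = 1 / (1 - 2 * b) := by
      have := Real.pi_pos
      have h2 : (1 - 2 * b) ≠ 0 := by linarith
      field_simp
    rw [hy]
    have h1 : 1 / (1 - 2 * b) ≤ 1 + 4 * b := by
      rw [div_le_iff₀ (by linarith)]
      nlinarith
    have h2 : Real.sqrt (1 / (1 - 2 * b)) ≤ 1 / (1 - 2 * b) := by
      have h3 : 0 ≤ 1 - 2 * b := by linarith
      refine Real.sqrt_le_iff.2 ⟨by positivity, ?_⟩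
      have : 1 ≤ 1 / (1 - 2 * b) := by
        rw [le_div_iff₀ (by linarith)]; linarith
      nlinarith
    linarith [Real.add_one_le_exp (4 * b)]

lemma measurable_relu : Measurable relu := measurable_id.max measurable_const

lemma sq_relu_le (z : ℝ) : relu z ^ 2 ≤ z ^ 2 := by
  rw [relu_eq, mul_pow]
  exact mul_le_of_le_one_left (sq_nonneg _) (reluDeriv_sq_le_one z)

/-- The moment generating function of the output of a single neuron. -/
lemma neuron_mgf_le {m d : ℕ} (hm : 0 < m) {ρ : Measure ℝ} (hρ : OutputLaw ρ)
    {x : EuclideanSpace ℝ (Fin d)} (hx : ‖x‖ = 1) {s : ℝ} (hs : s ^ 2 / m ≤ 1 / 4) :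
    Integrable (fun z : (Fin d → ℝ) × ℝ => Real.exp (s * (z.2 * relu (dotRow x z.1))))
      ((rowLaw m d).prod ρ) ∧
    ∫ z, Real.exp (s * (z.2 * relu (dotRow x z.1))) ∂((rowLaw m d).prod ρ) ≤
      Real.exp (4 * (s ^ 2 / m)) := by
  have := hρ.isProb
  have hm' : (0 : ℝ) < m := by exact_mod_cast hm
  have hmeas : Measurable fun z : (Fin d → ℝ) × ℝ =>
      Real.exp (s * (z.2 * relu (dotRow x z.1))) :=
    ((measurable_snd.mul (measurable_relu.comp
      ((measurable_dotRow x).comp measurable_fst))).const_mul s).exp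
  -- Conditionally on the row, the sub-Gaussian output weight is integrated first. What remains is
  -- the exponential of a squared Gaussian of variance `2 / m`.
  have hinner : ∀ w : Fin d → ℝ,
      Integrable (fun a : ℝ => Real.exp (s * (a * relu (dotRow x w)))) ρ ∧
      ∫ a, Real.exp (s * (a * relu (dotRow x w))) ∂ρ ≤
        Real.exp (s ^ 2 / 2 * dotRow x w ^ 2) := by
    intro w
    have e : ∀ a : ℝ, s * (a * relu (dotRow x w)) = (s * relu (dotRow x w)) * a := fun a => by ring
    simp only [e]
    refine ⟨hρ.subgaussian.integrable_exp_mul _, ?_⟩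
    refine (hρ.subgaussian.mgf_le (s * relu (dotRow x w))).trans ?_
    rw [Real.exp_le_exp]
    have := mul_le_mul_of_nonneg_left (sq_relu_le (dotRow x w)) (sq_nonneg s)
    simp only [NNReal.coe_one, one_mul]
    linarith [mul_pow s (relu (dotRow x w)) 2]
  obtain ⟨hgi, hgb⟩ := integral_exp_sq_gaussianReal (b := s ^ 2 / m) (by positivity) hs
  have hcomp : ∀ z : ℝ, Real.exp (s ^ 2 / 2 * (Real.sqrt (2 / m) * z) ^ 2) =
      Real.exp (s ^ 2 / m * z ^ 2) := by
    intro z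
    rw [mul_pow, Real.sq_sqrt (by positivity)]
    congr 1
    field_simp
  have hsm : AEStronglyMeasurable (fun z : ℝ => Real.exp (s ^ 2 / 2 * z ^ 2))
      ((rowLaw m d).map (dotRow x)) := by fun_prop
  have hdom : Integrable (fun w => Real.exp (s ^ 2 / 2 * dotRow x w ^ 2)) (rowLaw m d) := by
    have h1 := hsm
    rw [map_dotRow_rowLaw hx] at h1
    have h2 : Integrable (fun z : ℝ => Real.exp (s ^ 2 / 2 * z ^ 2))
        ((rowLaw m d).map (dotRow x)) := by
      rw [map_dotRow_rowLaw hx, integrable_map_measure h1 (by fun_prop)]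
      simpa only [Function.comp_def, hcomp] using hgi
    exact (integrable_map_measure hsm (measurable_dotRow x).aemeasurable).1 h2
  have hdomval : ∫ w, Real.exp (s ^ 2 / 2 * dotRow x w ^ 2) ∂(rowLaw m d) ≤
      Real.exp (4 * (s ^ 2 / m)) := by
    rw [← integral_map (measurable_dotRow x).aemeasurable hsm, map_dotRow_rowLaw hx,
      integral_map (by fun_prop) (by fun_prop)]
    simp only [hcomp]
    exact hgb
  have hint : Integrable (fun z : (Fin d → ℝ) × ℝ => Real.exp (s * (z.2 * relu (dotRow x z.1))))
      ((rowLaw m d).prod ρ) := by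
    rw [integrable_prod_iff hmeas.aestronglyMeasurable]
    refine ⟨Filter.Eventually.of_forall fun w => (hinner w).1, ?_⟩
    refine hdom.mono' (hmeas.norm.stronglyMeasurable.integral_prod_right').aestronglyMeasurable
      (Filter.Eventually.of_forall fun w => ?_)
    simp only [Real.norm_of_nonneg (Real.exp_nonneg _)]
    rw [Real.norm_of_nonneg (integral_nonneg fun _ => Real.exp_nonneg _)]
    exact (hinner w).2
  refine ⟨hint, ?_⟩
  rw [integral_prod _ hint]
  refine (integral_mono_of_nonneg (Filter.Eventually.of_forall fun w =>
    integral_nonneg fun _ => Real.exp_nonneg _) hdom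
    (Filter.Eventually.of_forall fun w => (hinner w).2)).trans hdomval

/-! ### The good event -/

section GoodEvent

variable {m d : ℕ} {P : Type*} [Fintype P]

/-- A neuron with non-negligible output weight that is active on both `x` and `x'`. -/
def coActive (x x' : EuclideanSpace ℝ (Fin d)) (z : (Fin d → ℝ) × ℝ) : ℝ :=
  {a : ℝ | 1 / 2 ≤ |a|}.indicator (fun _ => (1 : ℝ)) z.2 *
    (reluDeriv (dotRow x z.1) * reluDeriv (dotRow x' z.1))

/-- A neuron whose pre-activation on `x` is at most `δ`. -/
def nearBoundary (x : EuclideanSpace ℝ (Fin d)) (δ : ℝ) (z : (Fin d → ℝ) × ℝ) : ℝ :=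
  {w | |dotRow x w| ≤ δ}.indicator (fun _ => (1 : ℝ)) z.1

/-- The eighth power of the output weight, truncated at `L` and normalized. -/
def truncatedMoment (L : ℝ) (z : (Fin d → ℝ) × ℝ) : ℝ := min (z.2 ^ 8 / L ^ 8) 1

/-- The properties of the initialization `z = (W(0), a)` that hold with high probability. -/
structure GoodSample (ρ : Measure ℝ) (x : P → EuclideanSpace ℝ (Fin d)) (L δ : ℝ)
    (z : Weights m d × (Fin m → ℝ)) : Prop where
  moment : ∑ r, z.2 r ^ 8 ≤ 161281 * m
  kernel : ∀ p p', |∑ r, coActive (x p) (x p') (z.1 r, z.2 r) -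
    m * ∫ y, coActive (x p) (x p') y ∂((rowLaw m d).prod ρ)| ≤ Real.sqrt m * L
  boundary : ∀ p, ∑ r, nearBoundary (x p) δ (z.1 r, z.2 r) ≤ m * (δ * Real.sqrt m) + Real.sqrt m * L
  output : ∀ p, |∑ r, z.2 r * relu (dotRow (x p) (z.1 r))| ≤ 6 * L

lemma reluDeriv_mem_Icc (z : ℝ) : reluDeriv z ∈ Set.Icc (0 : ℝ) 1 := by
  rcases reluDeriv_eq_zero_or_one z with h | h <;> simp [h]

lemma measurableSet_half_le_abs : MeasurableSet {a : ℝ | 1 / 2 ≤ |a|} :=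
  measurableSet_le measurable_const (by fun_prop)

lemma measurable_coActive (x x' : EuclideanSpace ℝ (Fin d)) : Measurable (coActive x x') :=
  ((measurable_const.indicator measurableSet_half_le_abs).comp measurable_snd).mul
    ((measurable_reluDeriv.comp ((measurable_dotRow x).comp measurable_fst)).mul
      (measurable_reluDeriv.comp ((measurable_dotRow x').comp measurable_fst)))

lemma indicator_one_mem_Icc {α : Type*} (s : Set α) (a : α) :
    s.indicator (fun _ => (1 : ℝ)) a ∈ Set.Icc (0 : ℝ) 1 :=
  ⟨Set.indicator_nonneg (fun _ _ => zero_le_one) a,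
    Set.indicator_le_self' (fun _ _ => zero_le_one) a⟩

lemma mul_mem_Icc {a b : ℝ} (ha : a ∈ Set.Icc (0 : ℝ) 1) (hb : b ∈ Set.Icc (0 : ℝ) 1) :
    a * b ∈ Set.Icc (0 : ℝ) 1 :=
  ⟨mul_nonneg ha.1 hb.1, mul_le_one₀ ha.2 hb.1 hb.2⟩

lemma coActive_mem_Icc (x x' : EuclideanSpace ℝ (Fin d)) (z : (Fin d → ℝ) × ℝ) :
    coActive x x' z ∈ Set.Icc (0 : ℝ) 1 :=
  mul_mem_Icc (indicator_one_mem_Icc _ _) (mul_mem_Icc (reluDeriv_mem_Icc _) (reluDeriv_mem_Icc _))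

lemma measurableSet_abs_dotRow_le (x : EuclideanSpace ℝ (Fin d)) (δ : ℝ) :
    MeasurableSet {w | |dotRow x w| ≤ δ} :=
  measurableSet_le (measurable_dotRow x).abs measurable_const

lemma measurable_nearBoundary (x : EuclideanSpace ℝ (Fin d)) (δ : ℝ) :
    Measurable (nearBoundary x δ) :=
  (measurable_const.indicator (measurableSet_abs_dotRow_le x δ)).comp measurable_fst

lemma integral_nearBoundary_le {ρ : Measure ℝ} [IsProbabilityMeasure ρ] (hm : 0 < m)
    {x : EuclideanSpace ℝ (Fin d)} (hx : ‖x‖ = 1) {δ : ℝ} (hδ : 0 ≤ δ) :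
    ∫ z, nearBoundary x δ z ∂((rowLaw m d).prod ρ) ≤ δ * Real.sqrt m := by
  have h1 : ∫ z, nearBoundary x δ z ∂((rowLaw m d).prod ρ) =
      (rowLaw m d).real {w | |dotRow x w| ≤ δ} := by
    have h2 := integral_fun_fst (μ := rowLaw m d) (ν := ρ)
      (f := {w | |dotRow x w| ≤ δ}.indicator fun _ => (1 : ℝ))
    rw [integral_indicator_const _ (measurableSet_abs_dotRow_le x δ)] at h2
    simpa [nearBoundary] using h2
  rw [h1]
  exact rowLaw_real_small_le hm hx hδ

lemma measurable_truncatedMoment (L : ℝ) :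
    Measurable (truncatedMoment L : (Fin d → ℝ) × ℝ → ℝ) := by
  unfold truncatedMoment; fun_prop

lemma truncatedMoment_mem_Icc (L : ℝ) (z : (Fin d → ℝ) × ℝ) :
    truncatedMoment L z ∈ Set.Icc (0 : ℝ) 1 := by
  refine ⟨le_min ?_ zero_le_one, min_le_right _ _⟩
  have h8 : ∀ y : ℝ, 0 ≤ y ^ 8 := fun y => (by decide : Even 8).pow_nonneg y
  exact div_nonneg (h8 _) (h8 _)

lemma integral_truncatedMoment_le {ρ : Measure ℝ} (hρ : OutputLaw ρ) {L : ℝ} (hL : 0 < L) :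
    ∫ z, truncatedMoment L z ∂((rowLaw m d).prod ρ) ≤ 161280 / L ^ 8 := by
  have := hρ.isProb
  have h8 : ∀ y : ℝ, 0 ≤ y ^ 8 := fun y => (by decide : Even 8).pow_nonneg y
  have h2 := integral_fun_snd (μ := rowLaw m d) (ν := ρ)
    (f := fun a : ℝ => min (a ^ 8 / L ^ 8) 1)
  rw [probReal_univ, one_smul] at h2
  have h3 : ∫ z, truncatedMoment L z ∂((rowLaw m d).prod ρ) = ∫ a, min (a ^ 8 / L ^ 8) 1 ∂ρ := h2
  rw [h3, le_div_iff₀ (by positivity), ← integral_mul_const]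
  refine hρ.integral_pow_eight_le (fun a => ?_) fun a => ?_
  · have := h8 a
    positivity
  · calc min (a ^ 8 / L ^ 8) 1 * L ^ 8 ≤ a ^ 8 / L ^ 8 * L ^ 8 := by
          gcongr
          exact min_le_left _ _
      _ = a ^ 8 := by field_simp

lemma real_exists_large_output_le {ρ : Measure ℝ} (hρ : OutputLaw ρ) {L : ℝ} (hL : 0 ≤ L) :
    (initLaw m d ρ).real {z | ∃ r, L < |z.2 r|} ≤ m * (2 * Real.exp (-(L ^ 2 / 2))) := by
  have := hρ.isProb
  rw [initLaw_eq]
  set ν := (Measure.pi fun _ : Fin m => rowLaw m d).prod (Measure.pi fun _ : Fin m => ρ)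
  have h1 : {z : (Fin m → Fin d → ℝ) × (Fin m → ℝ) | ∃ r, L < |z.2 r|} =
      ⋃ r, {z | L < |z.2 r|} := by ext; simp
  rw [h1]
  have h2 : ∀ r, ν.real {z | L < |z.2 r|} ≤ 2 * Real.exp (-(L ^ 2 / 2)) := by
    intro r
    have hms : MeasurableSet {a : ℝ | L < |a|} := measurableSet_lt measurable_const (by fun_prop)
    have hmp : MeasurePreserving (fun z : (Fin m → Fin d → ℝ) × (Fin m → ℝ) => z.2 r) ν ρ :=
      (measurePreserving_eval (fun _ : Fin m => ρ) r).comp measurePreserving_snd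
    have := hmp.measureReal_preimage hms.nullMeasurableSet
    exact this.le.trans (hρ.real_abs_gt_le hL)
  refine (measureReal_iUnion_fintype_le _).trans ?_
  refine (Finset.sum_le_sum fun r _ => h2 r).trans ?_
  simp

/-- Truncation makes Hoeffding's inequality applicable to unbounded output weights. As all of them
are at most `L`, nothing is actually cut off, and the fluctuation, scaled back by `L ^ 8`, is at
most `√m * L ^ 9 ≤ m`. -/
lemma sum_pow_eight_le {L : ℝ} (hL : 0 < L) (hLm : L ^ 9 ≤ Real.sqrt m)
    {z : (Fin m → Fin d → ℝ) × (Fin m → ℝ)} (h1 : ∀ r, |z.2 r| ≤ L) {I : ℝ}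
    (hI : I ≤ 161280 / L ^ 8)
    (h2 : ∑ r, truncatedMoment L (z.1 r, z.2 r) ≤ m * I + Real.sqrt m * L) :
    ∑ r, z.2 r ^ 8 ≤ 161281 * m := by
  have h3 : ∀ r, z.2 r ^ 8 = L ^ 8 * truncatedMoment L (z.1 r, z.2 r) := by
    intro r
    have h4 : z.2 r ^ 8 ≤ L ^ 8 := by
      have h5 : |z.2 r| ^ 8 = z.2 r ^ 8 := (by decide : Even 8).pow_abs _
      rw [← h5]
      exact pow_le_pow_left₀ (abs_nonneg _) (h1 r) 8
    rw [truncatedMoment, min_eq_left ((div_le_one (by positivity)).2 h4)]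
    field_simp
  have hsm : Real.sqrt m * Real.sqrt m = m := Real.mul_self_sqrt (Nat.cast_nonneg m)
  calc ∑ r, z.2 r ^ 8 = L ^ 8 * ∑ r, truncatedMoment L (z.1 r, z.2 r) := by
        rw [Finset.mul_sum]; exact Finset.sum_congr rfl fun r _ => h3 r
    _ ≤ L ^ 8 * (m * (161280 / L ^ 8) + Real.sqrt m * L) := by
        refine mul_le_mul_of_nonneg_left (h2.trans ?_) (by positivity)
        gcongr
    _ = 161280 * m + Real.sqrt m * L ^ 9 := by field_simp
    _ ≤ 161280 * m + Real.sqrt m * Real.sqrt m := by gcongr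
    _ = _ := by rw [hsm]; ring

/-- The good event fails with small probability. -/
lemma real_not_goodSample_le (hm : 0 < m) {ρ : Measure ℝ} (hρ : OutputLaw ρ)
    {x : P → EuclideanSpace ℝ (Fin d)} (hx : ∀ p, ‖x p‖ = 1) {L δ : ℝ} (hL : 0 < L) (hδ : 0 ≤ δ)
    (hLm : L ^ 9 ≤ Real.sqrt m) (hLm2 : L ^ 2 / m ≤ 1 / 4) :
    (initLaw m d ρ).real {z | ¬ GoodSample ρ x L δ z} ≤
      2 * m * Real.exp (-(L ^ 2 / 2)) + (1 + 3 * (Fintype.card P : ℝ) +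
        2 * (Fintype.card P : ℝ) ^ 2) * Real.exp (-(2 * L ^ 2)) := by
  have := hρ.isProb
  have hm' : (0 : ℝ) < m := by exact_mod_cast hm
  set N : ℝ := (Fintype.card P : ℝ) with hN
  set ε := Real.exp (-(2 * L ^ 2)) with hε
  set ν := initLaw m d ρ with hν
  set T : Set (Weights m d × (Fin m → ℝ)) := {z | ∃ r, L < |z.2 r|}
  set M : Set (Weights m d × (Fin m → ℝ)) :=
    {z | m * ∫ y, truncatedMoment L y ∂((rowLaw m d).prod ρ)
    + Real.sqrt m * L ≤ ∑ r, truncatedMoment L (z.1 r, z.2 r)}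
  set Ku : P × P → Set (Weights m d × (Fin m → ℝ)) := fun q => {z | m *
    ∫ y, coActive (x q.1) (x q.2) y ∂((rowLaw m d).prod ρ) + Real.sqrt m * L ≤
      ∑ r, coActive (x q.1) (x q.2) (z.1 r, z.2 r)}
  set Kl : P × P → Set (Weights m d × (Fin m → ℝ)) := fun q => {z |
    ∑ r, coActive (x q.1) (x q.2) (z.1 r, z.2 r) ≤ m *
    ∫ y, coActive (x q.1) (x q.2) y ∂((rowLaw m d).prod ρ) - Real.sqrt m * L}
  set S : P → Set (Weights m d × (Fin m → ℝ)) := fun p => {z | m *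
    ∫ y, nearBoundary (x p) δ y ∂((rowLaw m d).prod ρ) + Real.sqrt m * L ≤
      ∑ r, nearBoundary (x p) δ (z.1 r, z.2 r)}
  set Ou : P → Set (Weights m d × (Fin m → ℝ)) := fun p =>
    {z | 6 * L ≤ ∑ r, z.2 r * relu (dotRow (x p) (z.1 r))}
  set Ol : P → Set (Weights m d × (Fin m → ℝ)) := fun p =>
    {z | 6 * L ≤ ∑ r, -(z.2 r * relu (dotRow (x p) (z.1 r)))}
  have hT : ν.real T ≤ m * (2 * Real.exp (-(L ^ 2 / 2))) := real_exists_large_output_le hρ hL.le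
  have hM : ν.real M ≤ ε :=
    hoeffding_prod_pi hm _ (measurable_truncatedMoment L) (truncatedMoment_mem_Icc L) hL.le
  have hKu : ∀ q, ν.real (Ku q) ≤ ε := fun q =>
    hoeffding_prod_pi hm _ (measurable_coActive _ _) (coActive_mem_Icc _ _) hL.le
  have hKl : ∀ q, ν.real (Kl q) ≤ ε := fun q =>
    hoeffding_prod_pi_lower hm _ (measurable_coActive _ _) (coActive_mem_Icc _ _) hL.le
  have hS : ∀ p, ν.real (S p) ≤ ε := fun p =>
    hoeffding_prod_pi hm _ (measurable_nearBoundary _ _) (fun z => indicator_one_mem_Icc _ _) hL.le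
  have hmeas : ∀ p, Measurable fun z : (Fin d → ℝ) × ℝ => z.2 * relu (dotRow (x p) z.1) :=
    fun p => measurable_snd.mul
      (measurable_relu.comp ((measurable_dotRow (x p)).comp measurable_fst))
  -- The threshold `6 * L` with Chernoff parameter `L` gives the exponent `-6 * L ^ 2 + 4 * L ^ 2`,
  -- matching the Hoeffding events.
  have hexp : Real.exp (-L * (6 * L) + m * (4 * (L ^ 2 / m))) = ε := by
    rw [hε]; congr 1; field_simp; ring
  have hOu : ∀ p, ν.real (Ou p) ≤ ε := by
    intro p
    obtain ⟨h1, h2⟩ := neuron_mgf_le hm hρ (hx p) hLm2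
    rw [← hexp]
    exact chernoff_prod_pi _ (hmeas p) _ hL.le h1 h2
  have hOl : ∀ p, ν.real (Ol p) ≤ ε := by
    intro p
    have hs : (-L) ^ 2 / (m : ℝ) ≤ 1 / 4 := by rwa [neg_sq]
    obtain ⟨h1, h2⟩ := neuron_mgf_le hm hρ (hx p) hs
    rw [neg_sq] at h2
    simp only [neg_mul_comm] at h1 h2
    rw [← hexp]
    exact chernoff_prod_pi (fun z : (Fin d → ℝ) × ℝ => -(z.2 * relu (dotRow (x p) z.1)))
      (hmeas p).neg _ hL.le h1 h2
  have hcover : {z | ¬ GoodSample ρ x L δ z} ⊆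
      T ∪ M ∪ (⋃ q, Ku q) ∪ (⋃ q, Kl q) ∪ (⋃ p, S p) ∪ (⋃ p, Ou p) ∪ (⋃ p, Ol p) := by
    intro z hz
    by_contra hcon
    simp only [Set.mem_union, Set.mem_iUnion, not_or, not_exists] at hcon
    obtain ⟨⟨⟨⟨⟨⟨cT, cM⟩, cKu⟩, cKl⟩, cS⟩, cOu⟩, cOl⟩ := hcon
    simp only [Ku, Kl, S, Ou, Ol, Set.mem_ofPred_eq, not_le] at cKu cKl cS cOu cOl
    apply hz
    have cT' : ∀ r, |z.2 r| ≤ L := fun r => not_lt.1 fun h => cT ⟨r, h⟩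
    refine ⟨?_, fun p p' => ?_, fun p => ?_, fun p => ?_⟩
    · exact sum_pow_eight_le hL hLm cT' (integral_truncatedMoment_le hρ hL) (not_le.1 cM).le
    · have h1 := cKu (p, p')
      have h2 := cKl (p, p')
      rw [abs_le]
      constructor <;> linarith
    · refine (cS p).le.trans ?_
      gcongr
      exact integral_nearBoundary_le hm (hx p) hδ
    · have h1 := cOu p
      have h2 := cOl p
      rw [Finset.sum_neg_distrib] at h2
      rw [abs_le]
      constructor <;> linarith
  have hU : ∀ {ι : Type _} [Fintype ι] (f : ι → Set (Weights m d × (Fin m → ℝ))),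
      (∀ i, ν.real (f i) ≤ ε) → ν.real (⋃ i, f i) ≤ Fintype.card ι * ε := by
    intro ι _ f hf
    refine (measureReal_iUnion_fintype_le f).trans ((Finset.sum_le_sum fun i _ => hf i).trans ?_)
    simp
  have hprob : IsProbabilityMeasure ν := by rw [hν, initLaw_eq]; infer_instance
  have h1 := hU Ku hKu
  have h2 := hU Kl hKl
  have h3 := hU S hS
  have h4 := hU Ou hOu
  have h5 := hU Ol hOl
  rw [Fintype.card_prod, Nat.cast_mul, ← hN] at h1 h2
  rw [← hN] at h3 h4 h5
  refine (measureReal_mono hcover).trans ?_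
  refine (measureReal_union_le _ _).trans ?_
  have g1 := measureReal_union_le (μ := ν) (T ∪ M ∪ (⋃ q, Ku q) ∪ (⋃ q, Kl q) ∪ (⋃ p, S p))
    (⋃ p, Ou p)
  have g2 := measureReal_union_le (μ := ν) (T ∪ M ∪ (⋃ q, Ku q) ∪ (⋃ q, Kl q)) (⋃ p, S p)
  have g3 := measureReal_union_le (μ := ν) (T ∪ M ∪ (⋃ q, Ku q)) (⋃ q, Kl q)
  have g4 := measureReal_union_le (μ := ν) (T ∪ M) (⋃ q, Ku q)
  have g5 := measureReal_union_le (μ := ν) T M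
  nlinarith

/-! ### Consequences of the good event -/

lemma sum_sq_le_of_moment {a : Fin m → ℝ} (h : ∑ r, a r ^ 8 ≤ 161281 * m) :
    ∑ r, a r ^ 2 ≤ 161282 * m := by
  have h1 : ∀ y : ℝ, y ^ 2 ≤ 1 + y ^ 8 := by
    intro y
    have : 0 ≤ y ^ 2 := sq_nonneg y
    have e : y ^ 8 = (y ^ 2) ^ 4 := by ring
    rw [e]
    nlinarith [sq_nonneg ((y ^ 2) ^ 2 - 1 / 2), sq_nonneg (y ^ 2 - 1)]
  calc ∑ r, a r ^ 2 ≤ ∑ r, (1 + a r ^ 8) := Finset.sum_le_sum fun r _ => h1 _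
    _ = m + ∑ r, a r ^ 8 := by simp [Finset.sum_add_distrib]
    _ ≤ _ := by linarith

/-- Neurons that change sign carry little output weight. -/
lemma GoodSample.sum_flips_le {Q : Type*} {ρ : Measure ℝ} {x : Q → EuclideanSpace ℝ (Fin d)}
    {L δ : ℝ}
    {z : Weights m d × (Fin m → ℝ)} (h : GoodSample ρ x L δ z) (hx : ∀ p, ‖x p‖ = 1)
    (hδ : 0 < δ) {A R : ℝ} (hA : 0 < A) {W : Weights m d} (hW : frobNorm (W - z.1) ≤ R) (p : Q) :
    ∑ r, z.2 r ^ 2 * (reluDeriv (preact W (x p) r) - reluDeriv (preact z.1 (x p) r)) ^ 2 ≤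
      A * (m * (δ * Real.sqrt m) + Real.sqrt m * L + R ^ 2 / δ ^ 2) + 161281 * m / A ^ 3 := by
  set D := W - z.1 with hD
  have hterm : ∀ r, z.2 r ^ 2 *
      (reluDeriv (preact W (x p) r) - reluDeriv (preact z.1 (x p) r)) ^ 2 ≤
      A * (nearBoundary (x p) δ (z.1 r, z.2 r) + preact D (x p) r ^ 2 / δ ^ 2) +
        z.2 r ^ 8 / A ^ 3 := by
    intro r
    have h8 : 0 ≤ z.2 r ^ 8 := (by decide : Even 8).pow_nonneg _
    have hn0 : 0 ≤ nearBoundary (x p) δ (z.1 r, z.2 r) := (indicator_one_mem_Icc _ _).1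
    by_cases hflip : reluDeriv (preact W (x p) r) = reluDeriv (preact z.1 (x p) r)
    · rw [hflip, sub_self]
      simp only [ne_eq, OfNat.ofNat_ne_zero, not_false_eq_true, zero_pow, mul_zero]
      positivity
    have hsq : (reluDeriv (preact W (x p) r) - reluDeriv (preact z.1 (x p) r)) ^ 2 ≤ 1 := by
      rcases reluDeriv_eq_zero_or_one (preact W (x p) r) with h1 | h1 <;>
      rcases reluDeriv_eq_zero_or_one (preact z.1 (x p) r) with h2 | h2 <;> simp [h1, h2]
    -- A sign change starting more than `δ` from zero requires a displacement larger than `δ`.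
    -- Chebyshev's inequality counts those neurons through `R ^ 2 / δ ^ 2`.
    have hone : 1 ≤ nearBoundary (x p) δ (z.1 r, z.2 r) + preact D (x p) r ^ 2 / δ ^ 2 := by
      by_cases hnear : |dotRow (x p) (z.1 r)| ≤ δ
      · have : nearBoundary (x p) δ (z.1 r, z.2 r) = 1 := by
          rw [nearBoundary]
          exact Set.indicator_of_mem (s := {w | |dotRow (x p) w| ≤ δ}) hnear _
        rw [this]
        have : 0 ≤ preact D (x p) r ^ 2 / δ ^ 2 := by positivity
        linarith
      · have h1 : δ ≤ |preact D (x p) r| := by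
          have h2 : preact D (x p) r = preact W (x p) r - preact z.1 (x p) r := preact_sub _ _ _ _
          have h3 : δ < |preact z.1 (x p) r| := not_le.1 hnear
          rw [h2]
          unfold reluDeriv at hflip
          rcases le_or_gt 0 (preact W (x p) r) with hp | hp <;>
          rcases le_or_gt 0 (preact z.1 (x p) r) with hq | hq
          · simp [hp, hq] at hflip
          · rw [abs_of_neg hq] at h3
            exact (by linarith : δ ≤ preact W (x p) r - preact z.1 (x p) r).trans (le_abs_self _)
          · rw [abs_of_nonneg hq] at h3
            exact (by linarith : δ ≤ -(preact W (x p) r - preact z.1 (x p) r)).trans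
              (neg_le_abs _)
          · simp [not_le.2 hp, not_le.2 hq] at hflip
        have h2 : 1 ≤ preact D (x p) r ^ 2 / δ ^ 2 := by
          rw [le_div_iff₀ (by positivity), one_mul, ← sq_abs (preact D (x p) r)]
          gcongr
        linarith
    -- Output weights with square above `A` are charged to the eighth moment, so Gaussian output
    -- weights cost no extra logarithm here.
    have hpow : z.2 r ^ 2 ≤ A + z.2 r ^ 8 / A ^ 3 := by
      rcases le_total (z.2 r ^ 2) A with h1 | h1
      · have : 0 ≤ z.2 r ^ 8 / A ^ 3 := by positivity
        linarith
      · have h2 : z.2 r ^ 2 ≤ z.2 r ^ 8 / A ^ 3 := by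
          rw [le_div_iff₀ (by positivity)]
          calc z.2 r ^ 2 * A ^ 3 ≤ z.2 r ^ 2 * (z.2 r ^ 2) ^ 3 := by gcongr
            _ = _ := by ring
        linarith
    calc _ ≤ z.2 r ^ 2 * 1 := by gcongr
      _ ≤ A * 1 + z.2 r ^ 8 / A ^ 3 := by linarith
      _ ≤ _ := by gcongr
  refine (Finset.sum_le_sum fun r _ => hterm r).trans ?_
  rw [Finset.sum_add_distrib, ← Finset.mul_sum, Finset.sum_add_distrib, ← Finset.sum_div,
    ← Finset.sum_div]
  have h1 := h.boundary p
  have h2 := h.moment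
  have h3 : ∑ r, preact D (x p) r ^ 2 ≤ R ^ 2 :=
    (sum_sq_preact_le D (hx p)).trans (pow_le_pow_left₀ (frobNorm_nonneg _) hW 2)
  gcongr

lemma reluDeriv_inner_eq (x : EuclideanSpace ℝ (Fin d)) (w : Fin d → ℝ) :
    reluDeriv (inner ℝ x (WithLp.toLp 2 w)) = reluDeriv (dotRow x w) := by
  congr 1

/-- The squared norm of the gradient of a single neuron, as a quadratic form. -/
lemma sq_norm_neuronGrad_eq (x : P → EuclideanSpace ℝ (Fin d)) (u : P → ℝ) (w : Fin d → ℝ) :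
    ‖neuronGrad x u (WithLp.toLp 2 w)‖ ^ 2 = ∑ p, ∑ p', u p * u p' * inner ℝ (x p) (x p') *
      (reluDeriv (dotRow (x p) w) * reluDeriv (dotRow (x p') w)) := by
  rw [← real_inner_self_eq_norm_sq, neuronGrad, sum_inner]
  refine Finset.sum_congr rfl fun p _ => ?_
  rw [inner_sum]
  refine Finset.sum_congr rfl fun p' _ => ?_
  rw [real_inner_smul_left, real_inner_smul_right, reluDeriv_inner_eq, reluDeriv_inner_eq]
  ring

lemma sq_frobNorm_backprop_eq (a : Fin m → ℝ) (x : P → EuclideanSpace ℝ (Fin d))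
    (W : Weights m d) (u : P → ℝ) :
    frobNorm (backprop a x (pattern x W) u) ^ 2 =
      (1 / (d : ℝ)) * ∑ r, a r ^ 2 * ‖neuronGrad x u (WithLp.toLp 2 (W r))‖ ^ 2 := by
  rw [sq_frobNorm, Finset.mul_sum]
  refine Finset.sum_congr rfl fun r _ => ?_
  rw [← sum_sq_coord, Finset.mul_sum, Finset.mul_sum]
  refine Finset.sum_congr rfl fun k _ => ?_
  rw [backprop, mul_pow, sq_inv_sqrt_nat, ← mul_pow, neuronGrad]
  congr 2
  simp only [WithLp.ofLp_sum, WithLp.ofLp_smul, Finset.sum_apply, Pi.smul_apply,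
    smul_eq_mul, reluDeriv_inner_eq, Finset.mul_sum]
  refine Finset.sum_congr rfl fun p _ => ?_
  rw [pattern, show preact W (x p) r = dotRow (x p) (W r) from rfl]
  ring

/-- The output weight is independent of the row and is non-negligible with probability at least
`1/2`, which halves the constant. Activations are invariant under positive scaling, so the variance
`2 / m` may be replaced by `1`. -/
lemma le_integral_coActive_form {ρ : Measure ℝ} (hρ : OutputLaw ρ) (hm : 0 < m)
    {x : P → EuclideanSpace ℝ (Fin d)} (hx : ∀ p, ‖x p‖ = 1) {φ : ℝ} (hφ : 0 < φ) (hφ2 : φ ≤ 2)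
    (hsep : ∀ p p', p ≠ p' → φ ≤ ‖x p - x p'‖ ∧ φ ≤ ‖x p + x p'‖) (u : P → ℝ) :
    φ / (1024 * Fintype.card P) * ∑ p, u p ^ 2 ≤
      ∑ p, ∑ p', u p * u p' * inner ℝ (x p) (x p') *
        ∫ y, coActive (x p) (x p') y ∂((rowLaw m d).prod ρ) := by
  have := hρ.isProb
  have hm' : (0 : ℝ) < m := by exact_mod_cast hm
  have hs : 0 < Real.sqrt (2 / m) := by positivity
  set q := ρ.real {a | 1 / 2 ≤ |a|} with hq
  have h1 : ∀ p p', ∫ y, coActive (x p) (x p') y ∂((rowLaw m d).prod ρ) =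
      q * ∫ w, reluDeriv (dotRow (x p) w) * reluDeriv (dotRow (x p') w) ∂(rowLaw m d) := by
    intro p p'
    have h2 := integral_prod_mul (μ := rowLaw m d) (ν := ρ)
      (fun w => reluDeriv (dotRow (x p) w) * reluDeriv (dotRow (x p') w))
      ({a : ℝ | 1 / 2 ≤ |a|}.indicator fun _ => (1 : ℝ))
    rw [integral_indicator_const _ measurableSet_half_le_abs, smul_eq_mul, mul_one] at h2
    rw [mul_comm q, ← h2]
    exact integral_congr_ae (Filter.Eventually.of_forall fun z => mul_comm _ _)
  have hmeas : ∀ p p', Measurable fun w : Fin d → ℝ =>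
      reluDeriv (dotRow (x p) w) * reluDeriv (dotRow (x p') w) := fun p p' =>
    (measurable_reluDeriv.comp (measurable_dotRow _)).mul
      (measurable_reluDeriv.comp (measurable_dotRow _))
  have hint : ∀ p p', Integrable (fun w : Fin d → ℝ => u p * u p' * inner ℝ (x p) (x p') *
      (reluDeriv (dotRow (x p) w) * reluDeriv (dotRow (x p') w))) (rowLaw m d) := fun p p' =>
    (Integrable.of_mem_Icc 0 1 (hmeas p p').aemeasurable (Filter.Eventually.of_forall fun w =>
      mul_mem_Icc (reluDeriv_mem_Icc _) (reluDeriv_mem_Icc _))).const_mul _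
  have h3 : ∑ p, ∑ p', u p * u p' * inner ℝ (x p) (x p') *
        ∫ y, coActive (x p) (x p') y ∂((rowLaw m d).prod ρ) =
      q * ∫ w, ‖neuronGrad x u (WithLp.toLp 2 w)‖ ^ 2 ∂(rowLaw m d) := by
    simp only [sq_norm_neuronGrad_eq]
    rw [integral_finsetSum _ fun p _ => integrable_finsetSum _ fun p' _ => hint p p',
      Finset.mul_sum]
    refine Finset.sum_congr rfl fun p _ => ?_
    rw [integral_finsetSum _ fun p' _ => hint p p', Finset.mul_sum]
    refine Finset.sum_congr rfl fun p' _ => ?_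
    rw [h1, integral_const_mul]
    ring
  have h4 : ∫ w, ‖neuronGrad x u (WithLp.toLp 2 w)‖ ^ 2 ∂(rowLaw m d) =
      ∫ w, ‖neuronGrad x u w‖ ^ 2 ∂(stdGaussian (EuclideanSpace ℝ (Fin d))) := by
    have hm2 : Measurable fun w : Fin d → ℝ => ‖neuronGrad x u (WithLp.toLp 2 w)‖ ^ 2 :=
      ((measurable_neuronGrad x u).comp (by fun_prop)).norm.pow_const 2
    rw [rowLaw_eq_map, integral_map (measurable_scaledRow m d).aemeasurable
      hm2.aestronglyMeasurable]
    refine integral_congr_ae (Filter.Eventually.of_forall fun w => ?_)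
    simp only [neuronGrad, reluDeriv_inner_eq, dotRow_scaledRow, reluDeriv_mul hs]
  rw [h3, h4]
  have h5 := le_integral_sq_norm_neuronGrad hx hφ hφ2 hsep u
  have h6 : 0 ≤ φ / (512 * Fintype.card P) * ∑ p, u p ^ 2 := by positivity
  calc φ / (1024 * Fintype.card P) * ∑ p, u p ^ 2
      = 1 / 2 * (φ / (512 * Fintype.card P) * ∑ p, u p ^ 2) := by
        rw [show (1024 : ℝ) = 2 * 512 by norm_num, mul_assoc, div_mul_eq_div_div_swap]
        ring
    _ ≤ _ := mul_le_mul hρ.not_small h5 h6 measureReal_nonneg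

/-- Coercivity of the tangent kernel at the initialization. -/
lemma GoodSample.coercive {ρ : Measure ℝ} {x : P → EuclideanSpace ℝ (Fin d)} {L δ : ℝ}
    {z : Weights m d × (Fin m → ℝ)} (h : GoodSample ρ x L δ z) (hρ : OutputLaw ρ) (hm : 0 < m)
    (hx : ∀ p, ‖x p‖ = 1) {φ : ℝ} (hφ : 0 < φ) (hφ2 : φ ≤ 2)
    (hsep : ∀ p p', p ≠ p' → φ ≤ ‖x p - x p'‖ ∧ φ ≤ ‖x p + x p'‖)
    (hbig : Real.sqrt m * L * Fintype.card P ≤ m * (φ / (2048 * Fintype.card P))) (u : P → ℝ) :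
    m * φ / (8192 * (d * Fintype.card P)) * ∑ p, u p ^ 2 ≤
      frobNorm (backprop z.2 x (pattern x z.1) u) ^ 2 := by
  set N : ℝ := (Fintype.card P : ℝ) with hN
  -- The sign of `L` is not assumed; the kernel bound itself provides it as soon as there is a
  -- sample.
  have hL : 0 ≤ Real.sqrt m * L ∨ IsEmpty P := by
    rcases isEmpty_or_nonempty P with he | ⟨⟨p⟩⟩
    · exact Or.inr he
    · exact Or.inl ((abs_nonneg _).trans (h.kernel p p))
  rcases hL with hL | he
  swap
  · simp only [Finset.univ_eq_empty, Finset.sum_empty, mul_zero]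
    positivity
  rw [sq_frobNorm_backprop_eq]
  have h1 : ∀ r, 1 / 4 * ∑ p, ∑ p', u p * u p' * inner ℝ (x p) (x p') *
      coActive (x p) (x p') (z.1 r, z.2 r) ≤
      z.2 r ^ 2 * ‖neuronGrad x u (WithLp.toLp 2 (z.1 r))‖ ^ 2 := by
    intro r
    have h2 : ∑ p, ∑ p', u p * u p' * inner ℝ (x p) (x p') *
      coActive (x p) (x p') (z.1 r, z.2 r) =
      {a : ℝ | 1 / 2 ≤ |a|}.indicator (fun _ => (1 : ℝ)) (z.2 r) *
        ‖neuronGrad x u (WithLp.toLp 2 (z.1 r))‖ ^ 2 := by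
      rw [sq_norm_neuronGrad_eq, Finset.mul_sum]
      refine Finset.sum_congr rfl fun p _ => ?_
      rw [Finset.mul_sum]
      refine Finset.sum_congr rfl fun p' _ => ?_
      rw [coActive]
      ring
    rw [h2, ← mul_assoc]
    gcongr
    by_cases ha : z.2 r ∈ {a : ℝ | 1 / 2 ≤ |a|}
    · rw [Set.indicator_of_mem ha, ← sq_abs]
      have ha' : 1 / 2 ≤ |z.2 r| := ha
      nlinarith
    · rw [Set.indicator_of_notMem ha, mul_zero]
      positivity
  have h2 : ∑ r, ∑ p, ∑ p', u p * u p' * inner ℝ (x p) (x p') *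
      coActive (x p) (x p') (z.1 r, z.2 r) = ∑ p, ∑ p', u p * u p' * inner ℝ (x p) (x p') *
      ∑ r, coActive (x p) (x p') (z.1 r, z.2 r) := by
    rw [Finset.sum_comm]
    refine Finset.sum_congr rfl fun p _ => ?_
    rw [Finset.sum_comm]
    refine Finset.sum_congr rfl fun p' _ => ?_
    rw [Finset.mul_sum]
  -- An entrywise error `√m * L` costs the quadratic form a factor `N`. Bounding the entries makes
  -- the estimate uniform in `u` without a net, and `hbig` keeps the loss below half of the expected
  -- form.
  have h3 : ∑ p, ∑ p', u p * u p' * inner ℝ (x p) (x p') *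
        (m * ∫ y, coActive (x p) (x p') y ∂((rowLaw m d).prod ρ)) -
      ∑ p, ∑ p', u p * u p' * inner ℝ (x p) (x p') *
        ∑ r, coActive (x p) (x p') (z.1 r, z.2 r) ≤ Real.sqrt m * L * N * ∑ p, u p ^ 2 := by
    rw [← Finset.sum_sub_distrib]
    simp only [← Finset.sum_sub_distrib, ← mul_sub]
    calc _ ≤ ∑ p, ∑ p', |u p| * |u p'| * (Real.sqrt m * L) := by
          refine Finset.sum_le_sum fun p _ => Finset.sum_le_sum fun p' _ => ?_
          refine (le_abs_self _).trans ?_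
          rw [abs_mul, abs_mul, abs_mul, abs_sub_comm]
          have h4 : |inner ℝ (x p) (x p')| ≤ 1 := by
            simpa [hx] using abs_real_inner_le_norm (x p) (x p')
          have h5 := h.kernel p p'
          calc |u p| * |u p'| * |inner ℝ (x p) (x p')| * _
              ≤ |u p| * |u p'| * 1 * (Real.sqrt m * L) := by gcongr
            _ = _ := by ring
      _ = Real.sqrt m * L * (∑ p, |u p|) ^ 2 := by
          rw [sq, Finset.sum_mul_sum]
          simp only [Finset.mul_sum]
          refine Finset.sum_congr rfl fun p _ => Finset.sum_congr rfl fun p' _ => ?_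
          ring
      _ ≤ Real.sqrt m * L * (N * ∑ p, u p ^ 2) := by
          gcongr
          simpa [hN] using sq_sum_le_card_mul_sum_sq (s := Finset.univ) (f := fun p => |u p|)
      _ = _ := by ring
  have h4 := le_integral_coActive_form (m := m) hρ hm hx hφ hφ2 hsep u
  have h5 : ∑ p, ∑ p', u p * u p' * inner ℝ (x p) (x p') *
        (m * ∫ y, coActive (x p) (x p') y ∂((rowLaw m d).prod ρ)) =
      m * ∑ p, ∑ p', u p * u p' * inner ℝ (x p) (x p') *
        ∫ y, coActive (x p) (x p') y ∂((rowLaw m d).prod ρ) := by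
    simp only [Finset.mul_sum]
    refine Finset.sum_congr rfl fun p _ => Finset.sum_congr rfl fun p' _ => ?_
    ring
  have hU : 0 ≤ ∑ p, u p ^ 2 := by positivity
  have h6 : m * (φ / (2048 * N)) * ∑ p, u p ^ 2 ≤ ∑ r, ∑ p, ∑ p', u p * u p' *
      inner ℝ (x p) (x p') * coActive (x p) (x p') (z.1 r, z.2 r) := by
    rw [h2]
    have h7 := mul_le_mul_of_nonneg_left h4 (Nat.cast_nonneg (α := ℝ) m)
    have h8 := mul_le_mul_of_nonneg_right hbig hU
    have h9 : m * (φ / (1024 * N) * ∑ p, u p ^ 2) = 2 * (m * (φ / (2048 * N)) * ∑ p, u p ^ 2) := by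
      rw [show (2048 : ℝ) = 2 * 1024 by norm_num, mul_assoc 2 1024 N, div_mul_eq_div_div_swap]
      ring
    linarith
  calc m * φ / (8192 * (d * N)) * ∑ p, u p ^ 2
      = 1 / (d : ℝ) * (1 / 4 * (m * (φ / (2048 * N)) * ∑ p, u p ^ 2)) := by
        rw [show (8192 : ℝ) = 4 * 2048 by norm_num]
        simp only [div_eq_mul_inv, mul_inv]
        ring
    _ ≤ 1 / (d : ℝ) * (1 / 4 * ∑ r, ∑ p, ∑ p', u p * u p' *
      inner ℝ (x p) (x p') * coActive (x p) (x p') (z.1 r, z.2 r)) := by gcongr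
    _ ≤ _ := by
        rw [Finset.mul_sum (a := (1 / 4 : ℝ))]
        exact mul_le_mul_of_nonneg_left (Finset.sum_le_sum fun r _ => h1 r) (by positivity)

end GoodEvent

/-! ### Choice of the parameters -/

/-- Constant in the truncation level of the output weights. -/
def truncConst (k : ℝ) : ℝ := 2 ^ 22 * 161281 * k ^ 2

/-- Constant in the width of the activation boundary. -/
def widthConst (k : ℝ) : ℝ := 2 ^ 22 * k ^ 2 * truncConst k

/-- The lower bound on `log m` under which the convergence proof works. -/
structure LargeLog (k B L : ℝ) : Prop where
  four_le : 4 ≤ L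
  radius : 27 * widthConst k ^ 3 * 524288 * k ^ 2 * (2 * B ^ 2 + 72) ≤ L
  width : 162 * widthConst k ^ 2 ≤ L
  kernel : 8 * 2048 ^ 2 * k ^ 4 ≤ L
  drift : 9 * 64 ^ 2 * 8192 * 128 * 161282 ^ 3 * k ^ 4 ≤ L

lemma one_le_truncConst {k : ℝ} (hk : 1 ≤ k) : 1 ≤ truncConst k := by
  unfold truncConst; nlinarith

lemma one_le_widthConst {k : ℝ} (hk : 1 ≤ k) : 1 ≤ widthConst k := by
  have := one_le_truncConst hk
  unfold widthConst
  have h2 : 1 ≤ k ^ 2 := one_le_pow₀ hk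
  nlinarith

section Numeric

variable {n d m φ L k B : ℝ}

/-- The squared radius of the ball that contains the iterates. -/
def sqRadius (n d m φ L k B : ℝ) : ℝ :=
  524288 * k ^ 2 * n ^ 2 * (2 * B ^ 2 * d + 72 * L ^ 2) / (m * φ)

/-- Up to constants this asks for `n ^ 20 * L ^ 3 * (d + L ^ 2) ≤ φ ^ 4 * m`. The width condition
gives the part with `d` directly, but not the part with `L ^ 2`, which stems from the size of the
initial output. -/
lemma sqRadius_le (hn : 1 ≤ n) (hd : 1 ≤ d) (hφ : 0 < φ) (hφ2 : φ ≤ 2) (hL : 1 ≤ L) (hm0 : 0 < m)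
    (hm : n ^ 21 * L ^ 3 * d ≤ m * φ ^ 5) (hLm : L ^ 45 ≤ m) :
    sqRadius n d m φ L k B ≤ (728 * |k| * (2 * |B| + 2173)) ^ 2 * (φ ^ 3 / (n ^ 18 * L ^ 3)) := by
  have hL0 : 0 < L := by linarith
  have hn0 : 0 < n := by linarith
  have h1 : n ^ 20 * L ^ 3 * d ≤ 2 * (φ ^ 4 * m) := by
    have h2 : n ^ 20 * L ^ 3 * d ≤ n ^ 21 * L ^ 3 * d := by
      gcongr
      · norm_num
    calc _ ≤ m * φ ^ 5 := h2.trans hm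
      _ = φ * (φ ^ 4 * m) := by ring
      _ ≤ _ := by gcongr
  -- If `φ * L ^ 2 ≤ n`, the spare factor `n` of the width condition absorbs `φ * L ^ 2`. Otherwise
  -- `n` is polylogarithmic in the width, and `L ^ 45 ≤ m` suffices: `45 = 4 * 2 + 16 * 2 + 5`.
  have h2 : n ^ 20 * L ^ 5 ≤ 65536 * (φ ^ 4 * m) := by
    rcases le_or_gt (φ * L ^ 2) n with h | h
    · have h3 : φ * (n ^ 20 * L ^ 5) ≤ φ * (φ ^ 4 * m) := by
        calc φ * (n ^ 20 * L ^ 5) = n ^ 20 * L ^ 3 * (φ * L ^ 2) := by ring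
          _ ≤ n ^ 20 * L ^ 3 * n := by gcongr
          _ = n ^ 21 * L ^ 3 * 1 := by ring
          _ ≤ n ^ 21 * L ^ 3 * d := by gcongr
          _ ≤ m * φ ^ 5 := hm
          _ = _ := by ring
      have h4 := le_of_mul_le_mul_left h3 hφ
      have : 0 ≤ φ ^ 4 * m := by positivity
      linarith
    · have h3 : n ≤ 2 * L ^ 2 := h.le.trans (by gcongr)
      calc n ^ 20 * L ^ 5 = n ^ 4 * n ^ 16 * L ^ 5 := by ring
        _ ≤ (φ * L ^ 2) ^ 4 * (2 * L ^ 2) ^ 16 * L ^ 5 := by gcongr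
        _ = 65536 * (φ ^ 4 * L ^ 45) := by ring
        _ ≤ _ := by gcongr
  rw [sqRadius, mul_div_assoc', div_le_div_iff₀ (by positivity) (by positivity)]
  have h3 : n ^ 20 * L ^ 3 * (2 * B ^ 2 * d + 72 * L ^ 2) ≤
      (2 * |B| + 2173) ^ 2 * (φ ^ 4 * m) := by
    have hB : B ^ 2 = |B| ^ 2 := (sq_abs B).symm
    have hx : 0 ≤ φ ^ 4 * m := by positivity
    have hB0 := abs_nonneg B
    calc _ = 2 * B ^ 2 * (n ^ 20 * L ^ 3 * d) + 72 * (n ^ 20 * L ^ 5) := by ring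
      _ ≤ 2 * B ^ 2 * (2 * (φ ^ 4 * m)) + 72 * (65536 * (φ ^ 4 * m)) := by gcongr
      _ = (4 * |B| ^ 2 + 4718592) * (φ ^ 4 * m) := by rw [hB]; ring
      _ ≤ _ := by
        gcongr
        nlinarith
  calc 524288 * k ^ 2 * n ^ 2 * (2 * B ^ 2 * d + 72 * L ^ 2) * (n ^ 18 * L ^ 3)
      = 524288 * k ^ 2 * (n ^ 20 * L ^ 3 * (2 * B ^ 2 * d + 72 * L ^ 2)) := by ring
    _ ≤ 728 ^ 2 * k ^ 2 * ((2 * |B| + 2173) ^ 2 * (φ ^ 4 * m)) := by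
        gcongr
        norm_num
    _ = _ := by rw [← sq_abs k]; ring

/-- This is the smallness of the radius required by the `R ^ 2 / δ ^ 2` term of the flip count. The
spare power of `L` in the width condition pays for all constants. -/
lemma sqRadius_small (hn : 1 ≤ n) (hd : 1 ≤ d) (hφ : 0 < φ) (hk : 1 ≤ k)
    (hΛ : LargeLog k B L) (hm0 : 0 < m) (hm : n ^ 21 * L ^ 3 * d ≤ m * φ ^ 5) :
    27 * widthConst k ^ 3 * n ^ 9 * sqRadius n d m φ L k B ≤ φ ^ 4 := by
  have hL : 1 ≤ L := by linarith [hΛ.four_le]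
  have hw := one_le_widthConst hk
  have hw0 : 0 ≤ widthConst k := by linarith
  have hL0 : 0 < L := by linarith
  have hn0 : 0 < n := by linarith
  rw [sqRadius, mul_div_assoc', div_le_iff₀ (by positivity)]
  have h1 : 2 * B ^ 2 * d + 72 * L ^ 2 ≤ (2 * B ^ 2 + 72) * (d * L ^ 2) := by
    have h2 : 2 * B ^ 2 * d * 1 ≤ 2 * B ^ 2 * d * L ^ 2 := by
      gcongr; exact one_le_pow₀ hL
    have h3 : 72 * L ^ 2 * 1 ≤ 72 * L ^ 2 * d := by gcongr
    nlinarith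
  calc 27 * widthConst k ^ 3 * n ^ 9 * (524288 * k ^ 2 * n ^ 2 * (2 * B ^ 2 * d + 72 * L ^ 2))
      ≤ 27 * widthConst k ^ 3 * n ^ 9 *
        (524288 * k ^ 2 * n ^ 2 * ((2 * B ^ 2 + 72) * (d * L ^ 2))) := by gcongr
    _ = (27 * widthConst k ^ 3 * 524288 * k ^ 2 * (2 * B ^ 2 + 72)) * (n ^ 11 * (d * L ^ 2)) := by
        ring
    _ ≤ L * (n ^ 21 * (d * L ^ 2)) := by
        have := hΛ.radius
        gcongr
        · norm_num
    _ = n ^ 21 * L ^ 3 * d := by ring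
    _ ≤ m * φ ^ 5 := hm
    _ = _ := by ring

/-- Ensures that the kernel fluctuation stays below half of the expected coercivity, as
`GoodSample.coercive` demands. -/
lemma sqrt_mul_log_le (hn : 1 ≤ n) (hd : 1 ≤ d) (hφ : 0 < φ) (hφ2 : φ ≤ 2) (hk : 1 ≤ k)
    (hΛ : LargeLog k B L) (hm0 : 0 < m) (hm : n ^ 21 * L ^ 3 * d ≤ m * φ ^ 5) :
    Real.sqrt m * L * (k * n) ≤ m * (φ / (2048 * (k * n))) := by
  have hL0 : 0 < L := by linarith [hΛ.four_le]
  have hn0 : 0 < n := by linarith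
  have hk0 : 0 < k := by linarith
  have key : 2048 * k ^ 2 * n ^ 2 * L ≤ Real.sqrt m * φ := by
    refine le_of_sq_le_sq ?_ (by positivity)
    rw [mul_pow (Real.sqrt m), Real.sq_sqrt hm0.le]
    have h1 : (8 * (2048 ^ 2 * k ^ 4 * n ^ 4 * L ^ 2)) * φ ^ 3 ≤ (8 * (m * φ ^ 2)) * φ ^ 3 := by
      calc (8 * (2048 ^ 2 * k ^ 4 * n ^ 4 * L ^ 2)) * φ ^ 3
          = (8 * 2048 ^ 2 * k ^ 4) * (n ^ 4 * L ^ 2) * φ ^ 3 := by ring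
        _ ≤ L * (n ^ 21 * L ^ 2) * 2 ^ 3 := by
            have := hΛ.kernel
            gcongr
            · norm_num
        _ = 8 * (n ^ 21 * L ^ 3 * 1) := by ring
        _ ≤ 8 * (n ^ 21 * L ^ 3 * d) := by gcongr
        _ ≤ 8 * (m * φ ^ 5) := by gcongr
        _ = _ := by ring
    have h2 := le_of_mul_le_mul_right h1 (by positivity)
    calc (2048 * k ^ 2 * n ^ 2 * L) ^ 2 = 2048 ^ 2 * k ^ 4 * n ^ 4 * L ^ 2 := by ring
      _ ≤ m * φ ^ 2 := by linarith
  rw [mul_div_assoc', le_div_iff₀ (by positivity)]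
  calc Real.sqrt m * L * (k * n) * (2048 * (k * n))
      = Real.sqrt m * (2048 * k ^ 2 * n ^ 2 * L) := by ring
    _ ≤ Real.sqrt m * (Real.sqrt m * φ) := by gcongr
    _ = m * φ := by rw [← mul_assoc, Real.mul_self_sqrt hm0.le]

/-- The total weight of the flipped neurons is below the kernel's coercivity. -/
lemma flips_small {θ R δ : ℝ} (hn : 1 ≤ n) (hd : 1 ≤ d) (hθ : 0 < θ) (hθφ : θ ^ 3 = φ)
    (hφ2 : φ ≤ 2) (hk : 1 ≤ k) (hΛ : LargeLog k B L) (hm0 : 0 < m)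
    (hm : n ^ 21 * L ^ 3 * d ≤ m * φ ^ 5) (hR : R ^ 2 ≤ sqRadius n d m φ L k B)
    (hδ : δ = θ ^ 4 / (3 * widthConst k * n ^ 3 * Real.sqrt m)) :
    (k * n) * (1 / d * (truncConst k * n / θ * (m * (δ * Real.sqrt m) + Real.sqrt m * L +
      R ^ 2 / δ ^ 2) + 161281 * m / (truncConst k * n / θ) ^ 3)) ≤
      m * φ / (256 * 8192 * (d * (k * n))) := by
  have hL0 : 0 < L := by linarith [hΛ.four_le]
  have hn0 : 0 < n := by linarith
  have hd0 : 0 < d := by linarith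
  have hk0 : 0 < k := by linarith
  have hφ : 0 < φ := by rw [← hθφ]; positivity
  have hw := one_le_widthConst hk
  have ha := one_le_truncConst hk
  set b := widthConst k with hb
  set a := truncConst k with ha'
  have hb0 : 0 < b := by linarith
  have ha0 : 0 < a := by linarith
  have hsm : 0 < Real.sqrt m := Real.sqrt_pos.2 hm0
  have hθ2 : θ ≤ 3 / 2 := by
    by_contra hcon
    push Not at hcon
    have : (3 / 2 : ℝ) ^ 3 < θ ^ 3 := by gcongr
    rw [hθφ] at this
    norm_num at this
    linarith
  -- Each of the three contributions to the flip count, namely the expected boundary layer, its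
  -- fluctuation and the displaced neurons, gets the same share. The value of `δ` is chosen so that
  -- the first fits exactly.
  have s1 : m * (δ * Real.sqrt m) = m * (θ ^ 4 / (3 * b * n ^ 3)) := by
    rw [hδ]; field_simp
  have s2 : Real.sqrt m * L ≤ m * (θ ^ 4 / (3 * b * n ^ 3)) := by
    have key : L * (3 * b * n ^ 3) ≤ Real.sqrt m * θ ^ 4 := by
      refine le_of_sq_le_sq ?_ (by positivity)
      rw [mul_pow (Real.sqrt m), Real.sq_sqrt hm0.le]
      have h1 : (18 * (L * (3 * b * n ^ 3)) ^ 2) * θ ^ 7 ≤ (18 * (m * (θ ^ 4) ^ 2)) * θ ^ 7 := by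
        calc (18 * (L * (3 * b * n ^ 3)) ^ 2) * θ ^ 7
            = (162 * b ^ 2) * (n ^ 6 * L ^ 2) * θ ^ 7 := by ring
          _ ≤ L * (n ^ 21 * L ^ 2) * (3 / 2) ^ 7 := by
              have := hΛ.width
              gcongr
              · norm_num
          _ = (3 / 2) ^ 7 * (n ^ 21 * L ^ 3 * 1) := by ring
          _ ≤ 18 * (n ^ 21 * L ^ 3 * d) := by
              gcongr
              norm_num
          _ ≤ 18 * (m * φ ^ 5) := by gcongr
          _ = _ := by rw [← hθφ]; ring
      have h2 := le_of_mul_le_mul_right h1 (by positivity)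
      linarith
    rw [mul_div_assoc', le_div_iff₀ (by positivity)]
    calc Real.sqrt m * L * (3 * b * n ^ 3) = Real.sqrt m * (L * (3 * b * n ^ 3)) := by ring
      _ ≤ Real.sqrt m * (Real.sqrt m * θ ^ 4) := by gcongr
      _ = m * θ ^ 4 := by rw [← mul_assoc, Real.mul_self_sqrt hm0.le]
  have s3 : R ^ 2 / δ ^ 2 ≤ m * (θ ^ 4 / (3 * b * n ^ 3)) := by
    have h1 := sqRadius_small hn hd hφ hk hΛ hm0 hm
    have h2 : 27 * b ^ 3 * n ^ 9 * R ^ 2 ≤ θ ^ 12 := by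
      calc _ ≤ 27 * b ^ 3 * n ^ 9 * sqRadius n d m φ L k B := by gcongr
        _ ≤ φ ^ 4 := h1
        _ = _ := by rw [← hθφ]; ring
    have h3 : R ^ 2 / δ ^ 2 = R ^ 2 * (9 * b ^ 2 * n ^ 6 * m) / θ ^ 8 := by
      rw [hδ, div_pow, mul_pow, Real.sq_sqrt hm0.le, div_div_eq_mul_div]
      ring
    rw [h3, mul_div_assoc', div_le_div_iff₀ (by positivity) (by positivity)]
    calc R ^ 2 * (9 * b ^ 2 * n ^ 6 * m) * (3 * b * n ^ 3)
        = m * (27 * b ^ 3 * n ^ 9 * R ^ 2) := by ring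
      _ ≤ m * θ ^ 12 := by gcongr
      _ = _ := by ring
  have hsum : m * (δ * Real.sqrt m) + Real.sqrt m * L + R ^ 2 / δ ^ 2 ≤
      m * (θ ^ 4 / (b * n ^ 3)) := by
    have : m * (θ ^ 4 / (b * n ^ 3)) = 3 * (m * (θ ^ 4 / (3 * b * n ^ 3))) := by
      field_simp
    linarith
  -- With the truncation level `a * n / θ`, the count of order `θ ^ 4 / n ^ 3` and the tail of order
  -- `(θ / n) ^ 3` both become multiples of `φ = θ ^ 3`. Each takes half of the allowed total.
  have t1 : a * n / θ * (m * (θ ^ 4 / (b * n ^ 3))) = m * φ / (2 ^ 22 * k ^ 2 * n ^ 2) := by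
    rw [hb, widthConst, ← ha', ← hθφ]
    field_simp
  have t2 : 161281 * m / (a * n / θ) ^ 3 ≤ m * φ / (2 ^ 22 * k ^ 2 * n ^ 2) := by
    have h1 : 161281 * m / (a * n / θ) ^ 3 = 161281 * m * φ / (a ^ 3 * n ^ 3) := by
      rw [← hθφ]; field_simp
    rw [h1, div_le_div_iff₀ (by positivity) (by positivity)]
    have h2 : a ≤ a ^ 3 := le_self_pow₀ ha (by norm_num)
    calc 161281 * m * φ * (2 ^ 22 * k ^ 2 * n ^ 2) = m * φ * (a * n ^ 2) := by
          rw [ha', truncConst]; ring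
      _ ≤ m * φ * (a ^ 3 * n ^ 3) := by
          gcongr
          · norm_num
  calc (k * n) * (1 / d * (a * n / θ * (m * (δ * Real.sqrt m) + Real.sqrt m * L +
      R ^ 2 / δ ^ 2) + 161281 * m / (a * n / θ) ^ 3))
      ≤ (k * n) * (1 / d * (a * n / θ * (m * (θ ^ 4 / (b * n ^ 3))) +
        m * φ / (2 ^ 22 * k ^ 2 * n ^ 2))) := by gcongr
    _ = m * φ / (256 * 8192 * (d * (k * n))) := by
        rw [t1]; field_simp; norm_num

/-- The left side without `n ^ 14 * L` is `τ * η * m / d`. The hypothesis carries `lt ^ 3` and only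
`lt` is needed, so the surplus `lt ^ 2 ≥ 4/9` is divided out; at `T = 1` the step size vanishes. -/
lemma le_mul_log_of_large_time {T τ lt : ℝ} (hn : 1 ≤ n) (hd : 1 ≤ d) (hφ : 0 < φ) (hL : 1 ≤ L)
    (hT : 0 < T) (hτ : 1 ≤ τ) (hlt : 0 ≤ lt) (hlt' : lt = 0 ∨ 2 / 3 ≤ lt)
    (h : d ^ (1 / 2 : ℝ) * n ^ (33 / 2 : ℝ) * lt ^ 3 * L ^ (3 / 2 : ℝ) * τ / φ ^ 5 ≤ T) :
    n ^ 2 * τ * lt / (φ * T) * (n ^ 14 * L) ≤ 3 * φ ^ 4 := by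
  rcases hlt' with h0 | h0
  · rw [h0]; simp; positivity
  have hlt0 : 0 < lt := by linarith
  have h1 : n ^ 16 * lt ^ 3 * L * τ ≤ T * φ ^ 5 := by
    rw [div_le_iff₀ (by positivity)] at h
    refine le_trans ?_ h
    have e1 : n ^ 16 ≤ n ^ (33 / 2 : ℝ) := by
      rw [← Real.rpow_natCast]
      exact Real.rpow_le_rpow_of_exponent_le hn (by norm_num)
    have e2 : L ≤ L ^ (3 / 2 : ℝ) := by
      conv_lhs => rw [← Real.rpow_one L]
      exact Real.rpow_le_rpow_of_exponent_le hL (by norm_num)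
    have e3 : 1 ≤ d ^ (1 / 2 : ℝ) := Real.one_le_rpow hd (by norm_num)
    have hL0 : 0 < L := by linarith
    have hn0 : 0 < n := by linarith
    calc n ^ 16 * lt ^ 3 * L * τ = 1 * n ^ 16 * lt ^ 3 * L * τ := by ring
      _ ≤ _ := by gcongr
  have h2 : n ^ 2 * τ * lt / (φ * T) * (n ^ 14 * L) * lt ^ 2 ≤ φ ^ 4 := by
    have : n ^ 2 * τ * lt / (φ * T) * (n ^ 14 * L) * lt ^ 2 =
        (n ^ 16 * lt ^ 3 * L * τ) / (φ * T) := by ring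
    rw [this, div_le_iff₀ (by positivity)]
    linarith [h1, show φ ^ 4 * (φ * T) = T * φ ^ 5 by ring]
  have h3 : 4 / 9 ≤ lt ^ 2 := by nlinarith
  have h4 : 0 ≤ n ^ 2 * τ * lt / (φ * T) * (n ^ 14 * L) := by
    have : 0 < n := by linarith
    have : 0 < L := by linarith
    positivity
  nlinarith

/-- With `h = τ * η * m / d` this is the square of the drift condition `64 * τ * η * μ ^ 3 ≤ l`,
after inserting the values of `μ` and `l`. The surplus powers of `φ` are bounded by `2 ^ 7`, and `L
^ 2` absorbs the constants. -/
lemma drift_small {h : ℝ} (hn : 1 ≤ n) (hφ : 0 < φ) (hφ2 : φ ≤ 2) (hk : 1 ≤ k)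
    (hΛ : LargeLog k B L) (hh : 0 ≤ h) (hb : h * (n ^ 14 * L) ≤ 3 * φ ^ 4) :
    64 ^ 2 * h ^ 2 * 161282 ^ 3 * 8192 * (k * n) ^ 4 ≤ φ := by
  have hL0 : 0 < L := by linarith [hΛ.four_le]
  have hL1 : 1 ≤ L := by linarith [hΛ.four_le]
  have hn0 : 0 < n := by linarith
  have h1 : h * (n ^ 2 * L) ≤ 3 * φ ^ 4 := by
    refine le_trans ?_ hb
    gcongr
    · norm_num
  have h2 : (h * (n ^ 2 * L)) ^ 2 ≤ (3 * φ ^ 4) ^ 2 := by gcongr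
  have h3 : φ ^ 7 ≤ 2 ^ 7 := by gcongr
  have h4 : L ≤ L ^ 2 := le_self_pow₀ hL1 (by norm_num)
  refine le_of_mul_le_mul_right ?_ (by positivity : 0 < L ^ 2)
  calc 64 ^ 2 * h ^ 2 * 161282 ^ 3 * 8192 * (k * n) ^ 4 * L ^ 2
      = 64 ^ 2 * 161282 ^ 3 * 8192 * k ^ 4 * (h * (n ^ 2 * L)) ^ 2 := by ring
    _ ≤ 64 ^ 2 * 161282 ^ 3 * 8192 * k ^ 4 * (3 * φ ^ 4) ^ 2 := by gcongr
    _ = 64 ^ 2 * 161282 ^ 3 * 8192 * k ^ 4 * 9 * φ * φ ^ 7 := by ring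
    _ ≤ 64 ^ 2 * 161282 ^ 3 * 8192 * k ^ 4 * 9 * φ * 2 ^ 7 := by gcongr
    _ = φ * (9 * 64 ^ 2 * 8192 * 128 * 161282 ^ 3 * k ^ 4) := by ring
    _ ≤ φ * L ^ 2 := by
        gcongr
        exact hΛ.drift.trans h4

end Numeric

/-! ### Convergence with high probability -/

variable {m d n K : ℕ}

lemma GoodData.inputs_separated {B φ : ℝ} {x : Fin K → Fin n → EuclideanSpace ℝ (Fin d)}
    {y : Fin K → Fin n → ℝ} (h : GoodData B φ x y) (p p' : Fin K × Fin n) (hp : p ≠ p') :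
    φ ≤ ‖inputs x p - inputs x p'‖ ∧ φ ≤ ‖inputs x p + inputs x p'‖ :=
  h.separated p.1 p.2 p'.1 p'.2 hp

lemma GoodSample.sq_norm_residual_le {ρ : Measure ℝ} {B φ L δ : ℝ}
    {x : Fin K → Fin n → EuclideanSpace ℝ (Fin d)} {y : Fin K → Fin n → ℝ}
    {z : Weights m d × (Fin m → ℝ)} (h : GoodSample ρ (inputs x) L δ z) (hxy : GoodData B φ x y)
    (hd : 1 ≤ d) :
    ‖residual z.2 x y z.1‖ ^ 2 ≤ (K * n : ℝ) * ((2 * B ^ 2 * d + 72 * L ^ 2) / d) := by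
  have hd' : (0 : ℝ) < d := by exact_mod_cast hd
  rw [EuclideanSpace.real_norm_sq_eq]
  have h1 : ∀ p : Fin K × Fin n,
      (residual z.2 x y z.1) p ^ 2 ≤ (2 * B ^ 2 * d + 72 * L ^ 2) / d := by
    intro p
    have e : (residual z.2 x y z.1) p = (1 / Real.sqrt d) *
        (∑ r, z.2 r * relu (dotRow (inputs x p) (z.1 r))) - y p.1 p.2 := rfl
    have h2 : ((1 / Real.sqrt d) * (∑ r, z.2 r * relu (dotRow (inputs x p) (z.1 r)))) ^ 2 ≤
        1 / d * (6 * L) ^ 2 := by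
      rw [mul_pow, sq_inv_sqrt_nat, ← sq_abs (∑ r, z.2 r * relu (dotRow (inputs x p) (z.1 r)))]
      have := h.output p
      gcongr
    have h3 : y p.1 p.2 ^ 2 ≤ B ^ 2 := by
      rw [← sq_abs]
      have := hxy.label_le p.1 p.2
      gcongr
    have h4 : (2 * B ^ 2 * d + 72 * L ^ 2) / d = 2 * (1 / d * (6 * L) ^ 2) + 2 * B ^ 2 := by
      field_simp; ring
    rw [e, h4]
    nlinarith [sq_nonneg ((1 / Real.sqrt d) *
      (∑ r, z.2 r * relu (dotRow (inputs x p) (z.1 r))) + y p.1 p.2)]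
  refine (Finset.sum_le_sum fun p _ => h1 p).trans ?_
  simp

/-- On the good event, the initialization is good. -/
theorem GoodSample.exists_goodInit {ρ : Measure ℝ} (hρ : OutputLaw ρ) {B φ L θ δ : ℝ}
    {x : Fin K → Fin n → EuclideanSpace ℝ (Fin d)} {y : Fin K → Fin n → ℝ}
    {z : Weights m d × (Fin m → ℝ)} (h : GoodSample ρ (inputs x) L δ z) (hxy : GoodData B φ x y)
    (hK : 1 ≤ K) (hn : 1 ≤ n) (hd : 1 ≤ d) (hm0 : 0 < m) (hφ2 : φ ≤ 2) (hθ : 0 < θ)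
    (hθφ : θ ^ 3 = φ) (hΛ : LargeLog K B L)
    (hm : (n : ℝ) ^ 21 * L ^ 3 * d ≤ m * φ ^ 5)
    (hδ : δ = θ ^ 4 / (3 * widthConst K * n ^ 3 * Real.sqrt m)) :
    ∃ l μ κ R : ℝ, GoodInit z.2 x y z.1 l μ κ R ∧ R ^ 2 ≤ sqRadius n d m φ L K B ∧
      l ^ 2 = m * φ / (8192 * (d * (K * n))) ∧ μ ^ 2 = K * n * (161282 * m / d) := by
  have hφ : 0 < φ := by rw [← hθφ]; positivity
  have hK' : (1 : ℝ) ≤ K := by exact_mod_cast hK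
  have hn' : (1 : ℝ) ≤ n := by exact_mod_cast hn
  have hd' : (1 : ℝ) ≤ d := by exact_mod_cast hd
  have hm' : (0 : ℝ) < m := by exact_mod_cast hm0
  have hK0 : (0 : ℝ) < K := by linarith
  have hn0 : (0 : ℝ) < n := by linarith
  have hd0 : (0 : ℝ) < d := by linarith
  have hL0 : 0 < L := by linarith [hΛ.four_le]
  have hcard : (Fintype.card (Fin K × Fin n) : ℝ) = K * n := by simp
  set S := 2 * B ^ 2 * d + 72 * L ^ 2 with hS
  have hS0 : 0 < S := by positivity
  set l := Real.sqrt (m * φ / (8192 * (d * (K * n)))) with hl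
  set μ := Real.sqrt (K * n * (161282 * m / d)) with hμ
  set U := Real.sqrt (K * n * (S / d)) with hU
  have hl2 : l ^ 2 = m * φ / (8192 * (d * (K * n))) := Real.sq_sqrt (by positivity)
  have hμ2 : μ ^ 2 = K * n * (161282 * m / d) := Real.sq_sqrt (by positivity)
  have hU2 : U ^ 2 = K * n * (S / d) := Real.sq_sqrt (by positivity)
  have hl0 : 0 < l := Real.sqrt_pos.2 (by positivity)
  -- The radius is the smallest that `radius` allows when `U` bounds the initial residual; `524288 =
  -- 64 * 8192`.
  have hR2 : (8 * U / l) ^ 2 = sqRadius n d m φ L K B := by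
    rw [div_pow, mul_pow, hl2, hU2, sqRadius]
    field_simp
    rw [hS]
    ring
  have hδ0 : 0 < δ := by
    have := one_le_widthConst hK'
    rw [hδ]; positivity
  have hA0 : 0 < truncConst K * n / θ := by
    have := one_le_truncConst hK'
    positivity
  have hx : ∀ p, ‖inputs x p‖ = 1 := fun p => hxy.norm_eq_one p.1 p.2
  refine ⟨l, μ, l / 16, 8 * U / l,
    ⟨hxy.norm_eq_one, hl0, ?_, by positivity, le_rfl, ?_, ?_, ?_, ?_⟩,
    hR2.le, hl2, hμ2⟩
  · refine Real.sqrt_le_sqrt ?_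
    have e : K * n * (161282 * m / d) = m * 161282 * (K * n) / (d : ℝ) := by ring
    rw [e, div_le_div_iff₀ (by positivity) hd0]
    have h1 : (1 : ℝ) ≤ K * n := one_le_mul_of_one_le_of_one_le hK' hn'
    calc m * φ * d ≤ m * 2 * d := by gcongr
      _ ≤ m * (161282 * 8192) * d * 1 * 1 := by
        have : (0 : ℝ) ≤ m * d := by positivity
        nlinarith
      _ ≤ m * (161282 * 8192) * d * (K * n) * (K * n) := by gcongr
      _ = _ := by ring
  · rw [hμ2]
    have := sum_sq_le_of_moment h.moment
    calc (K * n : ℝ) * (1 / d * ∑ r, z.2 r ^ 2) ≤ K * n * (1 / d * (161282 * m)) := by gcongr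
      _ = _ := by ring
  · intro u
    have h1 := h.coercive hρ hm0 hx hφ hφ2 hxy.inputs_separated
      (by rw [hcard]; exact sqrt_mul_log_le hn' hd' hφ hφ2 hK' hΛ hm' hm) u
    rw [hcard] at h1
    rw [hl2]
    exact h1
  · intro W hW i j
    have h1 := h.sum_flips_le hx hδ0 hA0 hW (i, j)
    have h2 := flips_small (R := 8 * U / l) hn' hd' hθ hθφ hφ2 hK' hΛ hm' hm hR2.le hδ
    calc _ ≤ _ := by
          refine mul_le_mul_of_nonneg_left (mul_le_mul_of_nonneg_left h1 ?_) ?_ <;> positivity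
      _ ≤ _ := h2
      _ = (l / 16) ^ 2 := by rw [div_pow, hl2]; field_simp; norm_num
  · rw [mul_div_cancel₀ _ hl0.ne']
    have h1 := h.sq_norm_residual_le hxy hd
    have : ‖residual z.2 x y z.1‖ ≤ U := Real.le_sqrt_of_sq_le h1
    linarith

/-- The constant in the rate and in the failure probability. -/
def rateConst (K : ℕ) : ℝ := 1 / (16384 * (K : ℝ) ^ 2)

/-- On the good event, Local GD converges linearly and stays near its initialization. -/
theorem GoodSample.convergence {ρ : Measure ℝ} (hρ : OutputLaw ρ) {B φ L θ δ : ℝ}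
    {x : Fin K → Fin n → EuclideanSpace ℝ (Fin d)} {y : Fin K → Fin n → ℝ}
    {z : Weights m d × (Fin m → ℝ)} (h : GoodSample ρ (inputs x) L δ z) (hxy : GoodData B φ x y)
    (hK : 1 ≤ K) (hn : 1 ≤ n) (hd : 1 ≤ d) (hm0 : 0 < m) (hφ2 : φ ≤ 2) (hθ : 0 < θ)
    (hθφ : θ ^ 3 = φ) (hΛ : LargeLog K B L) (hLm : L ^ 45 ≤ m)
    (hm : (n : ℝ) ^ 21 * L ^ 3 * d ≤ m * φ ^ 5)
    (hδ : δ = θ ^ 4 / (3 * widthConst K * n ^ 3 * Real.sqrt m))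
    {T τ : ℕ} (hT : 1 ≤ T) (hτ : 1 ≤ τ)
    (hTbig : (d : ℝ) ^ (1 / 2 : ℝ) * (n : ℝ) ^ (33 / 2 : ℝ) * Real.log T ^ 3 *
            L ^ (3 / 2 : ℝ) * τ / φ ^ 5 ≤ (T : ℝ)) (t : ℕ) :
    frobNorm (avgIterate z.2 x y (stepSize n d m T φ) τ z.1 t - z.1) ≤
      728 * K * (2 * |B| + 2173) * (φ ^ (3 / 2 : ℝ) / ((n : ℝ) ^ 9 * L ^ (3 / 2 : ℝ))) ∧
    (∀ i, frobNorm (localIterate z.2 x y (stepSize n d m T φ) τ z.1 t i - z.1) ≤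
      728 * K * (2 * |B| + 2173) * (φ ^ (3 / 2 : ℝ) / ((n : ℝ) ^ 9 * L ^ (3 / 2 : ℝ)))) ∧
    globalLoss z.2 x y (avgIterate z.2 x y (stepSize n d m T φ) τ z.1 t) ≤
      (1 - rateConst K * (stepSize n d m T φ * m * φ / (d * n ^ 2))) ^ t *
        globalLoss z.2 x y z.1 := by
  obtain ⟨l, μ, κ, R, hinit, hR2, hl2, hμ2⟩ :=
    h.exists_goodInit hρ hxy hK hn hd hm0 hφ2 hθ hθφ hΛ hm hδ
  have hφ : 0 < φ := by rw [← hθφ]; positivity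
  have hK' : (1 : ℝ) ≤ K := by exact_mod_cast hK
  have hn' : (1 : ℝ) ≤ n := by exact_mod_cast hn
  have hd' : (1 : ℝ) ≤ d := by exact_mod_cast hd
  have hT' : (1 : ℝ) ≤ T := by exact_mod_cast hT
  have hτ' : (1 : ℝ) ≤ τ := by exact_mod_cast hτ
  have hm' : (0 : ℝ) < m := by exact_mod_cast hm0
  have hK0 : (0 : ℝ) < K := by linarith
  have hn0 : (0 : ℝ) < n := by linarith
  have hd0 : (0 : ℝ) < d := by linarith
  have hT0 : (0 : ℝ) < T := by linarith
  have hL0 : 0 < L := by linarith [hΛ.four_le]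
  have hL1 : 1 ≤ L := by linarith [hΛ.four_le]
  have hl := hinit.l_pos
  have hμ := hinit.μ_pos
  set η := stepSize n d m T φ with hη
  have hlog : 0 ≤ Real.log T := Real.log_nonneg hT'
  have hη0 : 0 ≤ η := by
    rw [hη, stepSize]
    positivity
  -- `T` is an integer, so `log T` is either zero or at least `log 2 > 2/3`.
  have hlog' : Real.log T = 0 ∨ 2 / 3 ≤ Real.log T := by
    rcases hT.eq_or_lt with h1 | h1
    · left; rw [← h1]; simp
    · right
      have h2 : (2 : ℝ) ≤ T := by exact_mod_cast h1
      have := Real.log_le_log (by norm_num) h2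
      linarith [Real.log_two_gt_d9]
  have hh : τ * η * m / d = n ^ 2 * τ * Real.log T / (φ * T) := by
    rw [hη, stepSize]
    field_simp
  have hdrift : 8 * τ * η * μ ^ 2 * μ ≤ l / 8 := by
    have h1 := le_mul_log_of_large_time hn' hd' hφ hL1 hT0 hτ' hlog hlog' hTbig
    rw [← hh] at h1
    have h2 := drift_small hn' hφ hφ2 hK' hΛ (by positivity) h1
    have h3 : (64 * τ * η * μ ^ 2 * μ) ^ 2 ≤ l ^ 2 := by
      have e : (64 * τ * η * μ ^ 2 * μ) ^ 2 = 64 ^ 2 * (τ * η) ^ 2 * (μ ^ 2) ^ 3 := by ring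
      rw [e, hμ2, hl2, le_div_iff₀ (by positivity)]
      calc 64 ^ 2 * (τ * η) ^ 2 * (K * n * (161282 * m / d)) ^ 3 * (8192 * (d * (K * n)))
          = (64 ^ 2 * (τ * η * m / d) ^ 2 * 161282 ^ 3 * 8192 * (K * n) ^ 4) * m := by
            field_simp
        _ ≤ φ * m := by gcongr
        _ = _ := mul_comm _ _
    have h4 := le_of_sq_le_sq h3 hl.le
    linarith
  obtain ⟨c1, c2, c3⟩ := hinit.convergence hK hτ hη0 hdrift t
  have hRle : R ≤ 728 * K * (2 * |B| + 2173) *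
      (φ ^ (3 / 2 : ℝ) / ((n : ℝ) ^ 9 * L ^ (3 / 2 : ℝ))) := by
    refine le_of_sq_le_sq (hR2.trans ((sqRadius_le hn' hd' hφ hφ2 hL1 hm' hm hLm).trans
      (le_of_eq ?_))) (by positivity)
    have e : ∀ s : ℝ, 0 < s → (s ^ (3 / 2 : ℝ)) ^ 2 = s ^ 3 := by
      intro s hs
      rw [← Real.rpow_natCast, ← Real.rpow_mul hs.le, ← Real.rpow_natCast]
      norm_num
    rw [abs_of_pos hK0, mul_pow _ (φ ^ (3 / 2 : ℝ) / _), div_pow, mul_pow ((n : ℝ) ^ 9), e φ hφ,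
      e L hL0]
    ring
  refine ⟨c1.trans hRle, fun i => (c2 i).trans hRle, c3.trans ?_⟩
  have hloss : 0 ≤ globalLoss z.2 x y z.1 := by
    rw [globalLoss_eq]; positivity
  have hρ0 : η * l ^ 2 / (2 * K) ≤ 1 := by
    have h1 : η * μ ^ 2 * μ ≤ 1 * μ := by
      have h2 : η * μ ^ 2 * μ ≤ 8 * τ * (η * μ ^ 2 * μ) :=
        le_mul_of_one_le_left (by positivity) (by linarith)
      have := hinit.l_le
      linarith
    have h2 := le_of_mul_le_mul_right h1 hμ
    have h3 : η * l ^ 2 ≤ η * μ ^ 2 := by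
      have := hinit.l_le
      gcongr
    exact (div_le_self (by positivity) (by linarith)).trans (h3.trans h2)
  -- The singular value gives the rate `η * m * φ / (d * n)` up to constants; a factor `n` is
  -- discarded to match the statement.
  have hrate : rateConst K * (η * m * φ / (d * n ^ 2)) ≤ η * l ^ 2 / (2 * K) := by
    rw [hl2, rateConst]
    have e1 : η * (m * φ / (8192 * (d * (K * n)))) / (2 * K) =
        η * m * φ * n / (16384 * K ^ 2 * (d * n ^ 2)) := by
      field_simp
      ring
    have e2 : 1 / (16384 * (K : ℝ) ^ 2) * (η * m * φ / (d * n ^ 2)) =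
        η * m * φ * 1 / (16384 * K ^ 2 * (d * n ^ 2)) := by
      field_simp
    rw [e1, e2]
    gcongr
  gcongr

lemma driftTerm_nonneg {C φ η : ℝ} (hC : 0 ≤ C) (hφ : 0 ≤ φ) (hη : 0 ≤ η) (τ : ℕ) :
    0 ≤ driftTerm C n d m τ φ η := by
  unfold driftTerm
  positivity

/-- The thresholds depend only on `k` and `B`. The power `45`, needed in `sqRadius_le`, is
eventually dominated by `exp L`, which becomes `m`. -/
lemma exists_largeLog {k : ℝ} (B : ℝ) :
    ∃ Λ : ℝ, ∀ L, Λ ≤ L → LargeLog k B L ∧ L ^ 45 ≤ Real.exp L := by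
  have h1 : ∀ᶠ L : ℝ in Filter.atTop, L ^ 45 * Real.exp (-L) < 1 :=
    (Real.tendsto_pow_mul_exp_neg_atTop_nhds_zero 45).eventually (gt_mem_nhds one_pos)
  have h2 : ∀ᶠ L : ℝ in Filter.atTop, LargeLog k B L ∧ L ^ 45 ≤ Real.exp L := by
    filter_upwards [h1, Filter.eventually_ge_atTop 4, Filter.eventually_ge_atTop _,
      Filter.eventually_ge_atTop _, Filter.eventually_ge_atTop _, Filter.eventually_ge_atTop _]
      with L a1 a2 a3 a4 a5 a6
    refine ⟨⟨a2, a3, a4, a5, a6⟩, ?_⟩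
    rw [Real.exp_neg, ← div_eq_mul_inv, div_lt_one (Real.exp_pos L)] at a1
    exact a1.le
  obtain ⟨Λ, hΛ⟩ := Filter.eventually_atTop.1 h2
  exact ⟨Λ, hΛ⟩

/-- The failure probability of the good event, in terms of `L = log m`. -/
lemma failure_probability_le {L m' N k c : ℝ} (hL : 4 ≤ L) (hm : m' = Real.exp L) (hk : 1 ≤ k)
    (hN0 : 0 ≤ N) (hN : N ≤ k * m') (hc : c ≤ 1 / 4) :
    2 * m' * Real.exp (-(L ^ 2 / 2)) + (1 + 3 * N + 2 * N ^ 2) * Real.exp (-(2 * L ^ 2)) ≤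
      8 * k ^ 2 * Real.exp (-(c * L ^ 2)) := by
  set E := Real.exp (-(c * L ^ 2)) with hE
  have hm1 : 1 ≤ m' := by rw [hm]; exact Real.one_le_exp (by linarith)
  have hL2 : c * L ^ 2 ≤ L ^ 2 / 4 := by nlinarith [sq_nonneg L]
  -- For `L ≥ 4` the union bound over neurons is free: `m' = exp L` and `L ≤ L ^ 2 / 4`, leaving the
  -- exponent `-L ^ 2 / 4`.
  have h1 : m' * Real.exp (-(L ^ 2 / 2)) ≤ E := by
    rw [hm, ← Real.exp_add, hE, Real.exp_le_exp]
    nlinarith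
  have h2 : m' ^ 2 * Real.exp (-(2 * L ^ 2)) ≤ E := by
    rw [hm, ← Real.exp_nat_mul, ← Real.exp_add, hE, Real.exp_le_exp]
    push_cast
    nlinarith
  have hkm : 1 ≤ k * m' := one_le_mul_of_one_le_of_one_le hk hm1
  have h3 : 1 + 3 * N + 2 * N ^ 2 ≤ 6 * k ^ 2 * m' ^ 2 := by
    have h4 : 1 ≤ (k * m') ^ 2 := one_le_pow₀ hkm
    have h5 : N ≤ (k * m') ^ 2 := hN.trans (le_self_pow₀ hkm (by norm_num))
    have h6 : N ^ 2 ≤ (k * m') ^ 2 := by gcongr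
    have e : 6 * k ^ 2 * m' ^ 2 = 6 * (k * m') ^ 2 := by ring
    rw [e]; linarith
  have hk2 : 1 ≤ k ^ 2 := one_le_pow₀ hk
  have hE0 : 0 < E := Real.exp_pos _
  calc _ ≤ 2 * E + (6 * k ^ 2 * m' ^ 2) * Real.exp (-(2 * L ^ 2)) := by
        have := mul_le_mul_of_nonneg_right h3 (Real.exp_nonneg (-(2 * L ^ 2)))
        linarith
    _ = 2 * E + 6 * k ^ 2 * (m' ^ 2 * Real.exp (-(2 * L ^ 2))) := by ring
    _ ≤ 2 * E + 6 * k ^ 2 * E := by gcongr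
    _ ≤ 2 * k ^ 2 * E + 6 * k ^ 2 * E := by
        nlinarith
    _ = _ := by ring

end LocalGD

/-! ### Proof of the theorem -/

open LocalGD in
theorem mainTheorem1 (K : ℕ) (hK : 1 ≤ K) (B : ℝ) :
    ∃ c C : ℝ, 0 < c ∧ c ≤ 1 ∧ 0 < C ∧
      ∀ (ρ : Measure ℝ), (ρ = LocalGD.rademacher ∨ ρ = gaussianReal 0 1) →
      ∀ (n d m T τ : ℕ) (φ : ℝ)
        (x : Fin K → Fin n → EuclideanSpace ℝ (Fin d)) (y : Fin K → Fin n → ℝ),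
        1 ≤ n → 1 ≤ d → 2 ≤ m → 1 ≤ T → 1 ≤ τ → 0 < φ → φ ≤ 2 →
        LocalGD.GoodData B φ x y →
        (n : ℝ) ^ 21 * Real.log m ^ 3 * d / φ ^ 5 ≤ (m : ℝ) →
        (d : ℝ) ^ (1 / 2 : ℝ) * (n : ℝ) ^ (33 / 2 : ℝ) * Real.log T ^ 3 *
            Real.log m ^ (3 / 2 : ℝ) * τ / φ ^ 5 ≤ (T : ℝ) →
        1 - C * Real.exp (-(c * Real.log m ^ 2)) ≤
          (LocalGD.initLaw m d ρ).real
            {p : LocalGD.Weights m d × (Fin m → ℝ) |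
              ∀ t : ℕ, t ≤ T →
                LocalGD.frobNorm
                    (LocalGD.avgIterate p.2 x y (LocalGD.stepSize n d m T φ) τ p.1 t - p.1) ≤
                  C * (φ ^ (3 / 2 : ℝ) / ((n : ℝ) ^ 9 * Real.log m ^ (3 / 2 : ℝ))) ∧
                (∀ i : Fin K,
                  LocalGD.frobNorm
                    (LocalGD.localIterate p.2 x y (LocalGD.stepSize n d m T φ) τ p.1 t i - p.1) ≤
                  C * (φ ^ (3 / 2 : ℝ) / ((n : ℝ) ^ 9 * Real.log m ^ (3 / 2 : ℝ)))) ∧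
                LocalGD.globalLoss p.2 x y
                    (LocalGD.avgIterate p.2 x y (LocalGD.stepSize n d m T φ) τ p.1 t) ≤
                  (1 - c * (LocalGD.stepSize n d m T φ * m * φ / (d * n ^ 2))) ^ t *
                      LocalGD.globalLoss p.2 x y p.1 +
                    LocalGD.driftTerm C n d m τ φ (LocalGD.stepSize n d m T φ) *
                      LocalGD.globalLoss p.2 x y p.1} := by
  obtain ⟨Λ, hΛ⟩ := exists_largeLog (k := K) B
  have hK' : (1 : ℝ) ≤ K := by exact_mod_cast hK
  have hK0 : (0 : ℝ) < K := by linarith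
  set c := rateConst K with hc
  have hc0 : 0 < c := by rw [hc, rateConst]; positivity
  have hc1 : c ≤ 1 / 4 := by
    rw [hc, rateConst]
    have : (1 : ℝ) ≤ K ^ 2 := one_le_pow₀ hK'
    exact one_div_le_one_div_of_le (by norm_num) (by linarith)
  set C1 := 728 * K * (2 * |B| + 2173) with hC1
  have hC10 : 0 < C1 := by positivity
  -- The three summands of `C` make the claim vacuous for small widths, bound the failure
  -- probability, and bound the radius. The same `c` serves for rate and probability.
  refine ⟨c, Real.exp (c * Λ ^ 2) + 8 * K ^ 2 + C1, hc0, by linarith, by positivity, ?_⟩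
  set C := Real.exp (c * Λ ^ 2) + 8 * (K : ℝ) ^ 2 + C1 with hC
  have hC0 : 0 < C := by positivity
  intro ρ hρ' n d m T τ φ x y hn hd hm2 hT hτ hφ hφ2 hxy hmbig hTbig
  have hρ : OutputLaw ρ := by
    rcases hρ' with rfl | rfl
    · exact outputLaw_rademacher
    · exact outputLaw_gaussianReal
  have hm0 : 0 < m := by omega
  have hm' : (0 : ℝ) < m := by exact_mod_cast hm0
  set L := Real.log m with hL
  have hLpos : 0 < L := Real.log_pos (by exact_mod_cast hm2)
  -- Below the threshold the claimed probability is at most zero.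
  rcases lt_or_ge L Λ with hlt | hge
  · refine le_trans ?_ measureReal_nonneg
    have h1 : Real.exp (c * L ^ 2) ≤ C := by
      have : Real.exp (c * L ^ 2) ≤ Real.exp (c * Λ ^ 2) := by gcongr
      have : (0 : ℝ) ≤ 8 * K ^ 2 := by positivity
      linarith
    rw [Real.exp_neg, ← div_eq_mul_inv, sub_nonpos, one_le_div (Real.exp_pos _)]
    exact h1
  obtain ⟨hLarge, hL45⟩ := hΛ L hge
  have hexpL : Real.exp L = m := Real.exp_log hm'
  rw [hexpL] at hL45
  have hm5 : (n : ℝ) ^ 21 * L ^ 3 * d ≤ m * φ ^ 5 := by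
    rwa [div_le_iff₀ (by positivity)] at hmbig
  have hL4 := hLarge.four_le
  have hL1 : 1 ≤ L := by linarith
  have hn' : (1 : ℝ) ≤ n := by exact_mod_cast hn
  have hd' : (1 : ℝ) ≤ d := by exact_mod_cast hd
  have hn0 : (0 : ℝ) < n := by linarith
  set θ := φ ^ (1 / 3 : ℝ) with hθ
  have hθ0 : 0 < θ := Real.rpow_pos_of_pos hφ _
  have hθ3 : θ ^ 3 = φ := by
    rw [hθ, ← Real.rpow_natCast, ← Real.rpow_mul hφ.le]
    norm_num
  set δ := θ ^ 4 / (3 * widthConst K * n ^ 3 * Real.sqrt m) with hδ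
  have hδ0 : 0 ≤ δ := by
    have := one_le_widthConst hK'
    positivity
  have hL9 : L ^ 9 ≤ Real.sqrt m := by
    refine Real.le_sqrt_of_sq_le ?_
    rw [← pow_mul]
    exact (pow_le_pow_right₀ hL1 (by norm_num)).trans hL45
  have hL2m : L ^ 2 / m ≤ 1 / 4 := by
    rw [div_le_iff₀ hm']
    have h1 : L ^ 3 ≤ L ^ 45 := pow_le_pow_right₀ hL1 (by norm_num)
    nlinarith [sq_nonneg L]
  -- The union bound over pairs of samples costs order `n ^ 2`; comparing `n` with `m` lets
  -- `failure_probability_le` absorb it.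
  have hnm : (n : ℝ) ≤ m := by
    have h1 : φ ^ 5 ≤ 2 ^ 5 := by gcongr
    have h2 : (4 : ℝ) ^ 3 ≤ L ^ 3 := by gcongr
    have h3 : (n : ℝ) ≤ n ^ 21 := le_self_pow₀ hn' (by norm_num)
    have h4 : (n : ℝ) * 64 ≤ m * 32 := by
      calc (n : ℝ) * 64 ≤ n ^ 21 * L ^ 3 * d := by
            rw [← mul_one ((n : ℝ) * 64)]
            norm_num at h2
            gcongr
        _ ≤ m * φ ^ 5 := hm5
        _ ≤ m * 32 := by norm_num at h1; gcongr
    linarith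
  set ν := initLaw m d ρ with hν
  have hprob : IsProbabilityMeasure ν := by
    have := hρ.isProb
    rw [hν, initLaw_eq]; infer_instance
  have hbad := real_not_goodSample_le hm0 hρ (x := inputs x)
    (fun p => hxy.norm_eq_one p.1 p.2) hLpos hδ0 hL9 hL2m
  have hcard : (Fintype.card (Fin K × Fin n) : ℝ) = K * n := by simp
  rw [hcard] at hbad
  have hfail := hbad.trans (failure_probability_le hL4 hexpL.symm hK' (by positivity)
    (by gcongr) hc1)
  set S : Set (Weights m d × (Fin m → ℝ)) := _
  change 1 - C * Real.exp (-(c * L ^ 2)) ≤ ν.real S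
  have hsub : Set.univ ⊆ S ∪ {z | ¬ GoodSample ρ (inputs x) L δ z} := by
    intro z _
    by_cases hz : GoodSample ρ (inputs x) L δ z
    · left
      intro t _
      obtain ⟨c1, c2, c3⟩ := hz.convergence hρ hxy hK hn hd hm0 hφ2 hθ0 hθ3 hLarge hL45 hm5 hδ
        hT hτ hTbig t
      have hCC : C1 * (φ ^ (3 / 2 : ℝ) / ((n : ℝ) ^ 9 * L ^ (3 / 2 : ℝ))) ≤
          C * (φ ^ (3 / 2 : ℝ) / ((n : ℝ) ^ 9 * L ^ (3 / 2 : ℝ))) := by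
        refine mul_le_mul_of_nonneg_right ?_ (by positivity)
        have : 0 < Real.exp (c * Λ ^ 2) := Real.exp_pos _
        have : (0 : ℝ) ≤ 8 * K ^ 2 := by positivity
        linarith
      refine ⟨c1.trans hCC, fun i => (c2 i).trans hCC, c3.trans ?_⟩
      -- The linear decay already proves the bound, so the additive term only has to be nonnegative.
      refine le_add_of_nonneg_right (mul_nonneg (driftTerm_nonneg hC0.le hφ.le ?_ τ) ?_)
      · have : 0 ≤ Real.log T := Real.log_nonneg (by exact_mod_cast hT)
        rw [stepSize]; positivity
      · rw [globalLoss_eq]; positivity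
    · exact Or.inr hz
  have h1 := (measureReal_mono (μ := ν) hsub).trans (measureReal_union_le _ _)
  rw [probReal_univ] at h1
  have h2 : 8 * (K : ℝ) ^ 2 * Real.exp (-(c * L ^ 2)) ≤ C * Real.exp (-(c * L ^ 2)) := by
    gcongr
    have : 0 < Real.exp (c * Λ ^ 2) := Real.exp_pos _
    linarith
  linarith
end
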